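/- Let $K$ be a number field with ring of integers $\mathcal O$, let $K_1,\dots,K_r$ be the completions of $K$ at its archimedean places, and let $G=\prod_{i=1}^r \mathrm{SL}(2,K_i)$, $\Gamma=\mathrm{SL}(2,\mathcal O)$ embedded diagonally in $G$, $\pi:G\to G/\Gamma$, $g\mapsto g\Gamma$; $G$ acts on $G/\Gamma$ by left translations. Let $D_i$ be the identity component of the group of diagonal matrices of $\mathrm{SL}(2,K_i)$, $D_I=\prod_{i\in I}D_i\subset G$ for $I\subset\{1,\dots,r\}$, and $D=D_{\{1,\dots,r\}}$. A torus in $G$ is a subgroup conjugate to a closed connected subgroup of $D$. The orbit $D_I\pi(g)$ is called locally divergent if for every $i\in I$ the orbit map $D_i\to G/\Gamma$, $d\mapsto d\,\pi(g)$, is proper. Theorem. Let $\#I=2$ (so $r\ge 2$), let $g\in G$, and let $D_I\pi(g)$ be locally divergent. If the closure $\overline{D_I\pi(g)}$ is not an orbit of a torus, then $$\overline{D_I\pi(g)}=D_I\pi(g)\cup\bigcup_{i=1}^{s}T_i\pi(h_i),$$ where $2\le s\le 4$, $h_i\in G$, the $T_i$ are tori containing $D_I$, and the $T_i\pi(h_i)$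 are pairwise different, closed, non-compact orbits. In particular, if $\#I=2$, then no locally divergent orbit $D_I\pi(g)$ is dense in $G/\Gamma$. -/

import Mathlib

noncomputable section

namespace HilbertModular

open NumberField Topology
open scoped MatrixGroups

section General

variable {G : Type*} [Group G] [TopologicalSpace G] [IsTopologicalGroup G]

/-- The connected component of the identity of a subgroup `H` of a topological group `G`, for the
subspace topology of `H`, regarded as a subgroup of `G`. -/
def identityComponent (H : Subgroup G) : Subgroup G :=
  (Subgroup.connectedComponentOfOne H).map H.subtype

/-- The orbit `H x` is divergent: the orbit map `h ↦ h x` from `H` (with its subspace topology)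
is proper. -/
def IsDivergentOrbit {X : Type*} [TopologicalSpace X] [MulAction G X]
    (H : Subgroup G) (x : X) : Prop :=
  IsProperMap (fun h : H => (h : G) • x)

end General

/-- The group of diagonal matrices in `SL(2, F)`. -/
def diagonalSubgroup (F : Type*) [Field F] : Subgroup SL(2, F) where
  carrier := {g | g 0 1 = 0 ∧ g 1 0 = 0}
  one_mem' := by simp
  mul_mem' := by
    rintro a b ⟨ha, ha'⟩ ⟨hb, hb'⟩
    constructor <;>
      simp [Matrix.SpecialLinearGroup.coe_mul, Matrix.mul_apply, Fin.sum_univ_two, *]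
  inv_mem' := by
    rintro a ⟨ha, ha'⟩
    constructor <;>
      simp [Matrix.SpecialLinearGroup.coe_inv, Matrix.adjugate_fin_two, ha, ha']

variable (K : Type*) [Field K] [NumberField K]

/-- The group `G = ∏ SL(2, K_v)`, over all archimedean places `v` of `K`, where `K_v` is the
completion of `K` at `v`. It carries the product topology. -/
abbrev Grp : Type _ := (v : InfinitePlace K) → SL(2, v.Completion)

/-- The subgroup `Γ` of `G`: the diagonal image of `SL(2, 𝓞 K)`. -/
def Gam : Subgroup (Grp K) :=
  (MonoidHom.pi fun v : InfinitePlace K =>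
    Matrix.SpecialLinearGroup.map (n := Fin 2)
      ((algebraMap K v.Completion).comp (algebraMap (𝓞 K) K))).range

/-- The Hilbert modular space `G / Γ` (left cosets `gΓ`, quotient topology, `G` acting by left
translations). -/
abbrev Space : Type _ := Grp K ⧸ Gam K

variable {K}

/-- The projection `π : G → G / Γ`. -/
abbrev proj (g : Grp K) : Space K := QuotientGroup.mk g

/-- `D_v`, the identity component of the group of diagonal matrices in `SL(2, K_v)`. -/
def diagComponent (v : InfinitePlace K) : Subgroup SL(2, v.Completion) :=
  identityComponent (diagonalSubgroup v.Completion)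

/-- `D_I = ∏_{v ∈ I} D_v`, as a subgroup of `G` (trivial components outside `I`). -/
def diagTorus (I : Finset (InfinitePlace K)) : Subgroup (Grp K) where
  carrier := {g | (∀ v ∈ I, g v ∈ diagComponent v) ∧ ∀ v ∉ I, g v = 1}
  one_mem' := ⟨fun v _ => (diagComponent v).one_mem, fun _ _ => rfl⟩
  mul_mem' := fun {a b} ha hb =>
    ⟨fun v hv => (diagComponent v).mul_mem (ha.1 v hv) (hb.1 v hv), fun v hv => by
      rw [Pi.mul_apply, ha.2 v hv, hb.2 v hv, one_mul]⟩
  inv_mem' := fun {a} ha =>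
    ⟨fun v hv => (diagComponent v).inv_mem (ha.1 v hv), fun v hv => by
      rw [Pi.inv_apply, ha.2 v hv, inv_one]⟩

/-- A torus in `G`: a subgroup conjugate to a closed connected subgroup of `D`, the product of the
`D_v` over all archimedean places `v`. -/
def IsTorus (T : Subgroup (Grp K)) : Prop :=
  ∃ (a : Grp K) (S : Subgroup (Grp K)), S ≤ diagTorus Finset.univ ∧
    IsClosed (S : Set (Grp K)) ∧ IsConnected (S : Set (Grp K)) ∧
    T = S.map (MulAut.conj a).toMonoidHom

/-- A subset of `G / Γ` is an orbit of a torus. -/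
def IsTorusOrbit (Y : Set (Space K)) : Prop :=
  ∃ (T : Subgroup (Grp K)) (x : Space K), IsTorus T ∧ Y = MulAction.orbit T x

/-- The orbit `D_I x` is locally divergent: `D_v x` is divergent for every `v ∈ I`. -/
def IsLocallyDivergent (I : Finset (InfinitePlace K)) (x : Space K) : Prop :=
  ∀ v ∈ I, IsDivergentOrbit (diagTorus {v}) x

end HilbertModular

end

open HilbertModular

/-!
# Closures of locally divergent orbits of two-dimensional tori on Hilbert modular spaces

Write `I = {v₁, v₂}`. The proof follows a path `d n` in `D_I` for which `d n π(g)` converges and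
looks at which coordinate axes are contracted at `v₁` and `v₂`.

*Divergence is rational.* By Minkowski's theorem and a form of Mahler's compactness criterion
(`exists_bounded_representative`), a divergent orbit of `D_v` acquires short vectors of the lattice
`g 𝓞²`, where the size of a vector is measured by its `height`, the product of its norms over all
places. Two vectors of small height are proportional, so along a ray of `D_v` one and the same
rational line is contracted (`exists_rational_of_isDivergentOrbit`). Hence for `v ∈ I` both
coordinate axes of `K_v²` are images under `g_v` of lines of `K²`.

*Orbits through rational points.* For `A ∈ SL(2, K)` the stabilizer of `π(A)` in `D` contains a
finite-index group of units, and Dirichlet's unit theorem has two consequences. The orbit `D π(A)`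
is closed, and so the closure of `D_I π(A)` is the orbit of a torus (`exists_torus_closure_eq`); a
closed connected subgroup of `D` is found as the linear part of a closed subgroup in exponential
coordinates. And `π(A)` is recurrent under elements of `D_I` that contract the first axis at `v₁`
and the second one at `v₂` (`exists_recurrence`). Both facts are transported to `k π(A)`, where
`k ∈ G` is diagonal or antidiagonal at the places of `I`, because such a `k` normalizes `D_I`.

*Quadrants.* Suppose that `d n` contracts the axis `e_i` at `v₁` and `e_j` at `v₂`. If the
corresponding rational lines coincide, then the height of a rational vector tends to `0` along
`d n g`, and `d n π(g)` diverges. If they are different, take them as the columns of a matrix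
`A⁻¹ ∈ SL(2, K)`; then `g = u k A` with `k` diagonal or antidiagonal on `I` and `u` unipotent,
contracted by conjugation with `d n`. So in this quadrant `D_I π(g)` and `D_I π(k A)` have the same
limits (`tendsto_smul_proj_iff`), and recurrence shows that `π(k A)` is such a limit. If `d n` is
unbounded at only one place, the height argument again gives divergence, and if it is bounded, the
limit is in `D_I π(g)`. Thus the closure is the union of `D_I π(g)` and at most four closed orbits
of tori, one for each admissible quadrant; they are not compact because rational vectors can be
contracted in them.

*At least two orbits.* If no quadrant with `i ≠ j`, or no quadrant with `i = j`, is admissible, then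
the rational lines at `v₁` are those at `v₂`, `g` is itself of the form `k A`, and the closure is
an orbit of a torus. Otherwise one orbit arises from a quadrant with `i ≠ j` and one from a quadrant
with `i = j`. They are different, because the sequence in `D_I` that returns the second point to
itself would contract a rational vector of the first one (`proj_notMem_closure_orbit`).

*Not dense.* The closure lies in a finite union of sets `π(a D b)`. A unipotent one-parameter group
at one place meets each of the countably many sets `a D b γ`, `γ ∈ Γ`, in at most one point, so its
image in `G / Γ` is not covered (`exists_forall_ne_proj_mul`).
-/

noncomputable section

namespace HilbertModular

open NumberField Topology Filter
open NumberField.InfinitePlace NumberField.InfinitePlace.Completion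
open scoped MatrixGroups Matrix

/-! ### Exponential coordinates on the diagonal groups -/

section Local

variable {K : Type*} [Field K] (v : InfinitePlace K)

instance : ProperSpace v.Completion := by
  rcases isReal_or_isComplex v with h | h
  · exact (isometryEquivRealOfIsReal h).symm.isometry.antilipschitz.properSpace
      (isometryEquivRealOfIsReal h).symm.continuous (isometryEquivRealOfIsReal h).symm.surjective
  · exact (isometryEquivComplexOfIsComplex h).symm.isometry.antilipschitz.properSpace
      (isometryEquivComplexOfIsComplex h).symm.continuous
      (isometryEquivComplexOfIsComplex h).symm.surjective

lemma norm_extensionEmbedding (x : v.Completion) : ‖extensionEmbedding v x‖ = ‖x‖ :=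
  (isometry_extensionEmbedding v).norm_map_of_map_zero (map_zero _) x

lemma norm_algebraMap_completion (x : K) : ‖algebraMap K v.Completion x‖ = v x :=
  norm_coe v ((WithAbs.equiv v.1).symm x)

open Classical in
/-- The exponential map onto the identity component of the multiplicative group of `K_v`. At a real
place only the real part of the argument is used, so that one vector space serves all places. -/
def expAt (z : ℂ) : v.Completion :=
  if h : v.IsReal then (ringEquivRealOfIsReal h).symm (Real.exp z.re)
  else (ringEquivComplexOfIsComplex (not_isReal_iff_isComplex.1 h)).symm (Complex.exp z)

variable {v}

lemma extensionEmbedding_expAt_of_isReal (h : v.IsReal) (z : ℂ) :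
    extensionEmbedding v (expAt v z) = (Real.exp z.re : ℝ) := by
  rw [expAt, dif_pos h, ← extensionEmbeddingOfIsReal_apply h, ← ringEquivRealOfIsReal_apply h,
    RingEquiv.apply_symm_apply]

lemma extensionEmbedding_expAt_of_isComplex (h : v.IsComplex) (z : ℂ) :
    extensionEmbedding v (expAt v z) = Complex.exp z := by
  rw [expAt, dif_neg (not_isReal_iff_isComplex.2 h), ← ringEquivComplexOfIsComplex_apply h,
    RingEquiv.apply_symm_apply]

variable (v)

lemma expAt_add (z w : ℂ) : expAt v (z + w) = expAt v z * expAt v w := by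
  apply (extensionEmbedding v).injective
  rcases isReal_or_isComplex v with h | h
  · simp [extensionEmbedding_expAt_of_isReal h, Complex.exp_add]
  · simp [extensionEmbedding_expAt_of_isComplex h, Complex.exp_add]

@[simp] lemma expAt_zero : expAt v 0 = 1 := by
  apply (extensionEmbedding v).injective
  rcases isReal_or_isComplex v with h | h
  · simp [extensionEmbedding_expAt_of_isReal h]
  · simp [extensionEmbedding_expAt_of_isComplex h]

lemma continuous_expAt : Continuous (expAt v) := by
  rw [(isometry_extensionEmbedding v).isEmbedding.continuous_iff]
  rcases isReal_or_isComplex v with h | h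
  · refine Continuous.congr (f := fun z : ℂ => ((Real.exp z.re : ℝ) : ℂ)) (by fun_prop) fun z => ?_
    exact (extensionEmbedding_expAt_of_isReal h z).symm
  · refine Continuous.congr (f := fun z : ℂ => Complex.exp z) (by fun_prop) fun z => ?_
    exact (extensionEmbedding_expAt_of_isComplex h z).symm

@[simp] lemma norm_expAt (z : ℂ) : ‖expAt v z‖ = Real.exp z.re := by
  rw [← norm_extensionEmbedding]
  rcases isReal_or_isComplex v with h | h
  · rw [extensionEmbedding_expAt_of_isReal h, Complex.norm_real, Real.norm_eq_abs, Real.abs_exp]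
  · rw [extensionEmbedding_expAt_of_isComplex h, Complex.norm_exp]

lemma expAt_mul_neg (z : ℂ) : expAt v z * expAt v (-z) = 1 := by
  rw [← expAt_add, add_neg_cancel, expAt_zero]

lemma expAt_neg (z : ℂ) : expAt v (-z) = (expAt v z)⁻¹ :=
  eq_inv_of_mul_eq_one_right (expAt_mul_neg v z)

/-- A logarithm on `K_v`, inverse to `expAt v` near `1`. -/
def logAt (x : v.Completion) : ℂ := Complex.log (extensionEmbedding v x)

lemma logAt_one : logAt v 1 = 0 := by simp [logAt]

lemma continuousAt_logAt : ContinuousAt (logAt v) 1 := by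
  refine ContinuousAt.clog (isometry_extensionEmbedding v).continuous.continuousAt ?_
  simp

lemma eventually_expAt_logAt : ∀ᶠ x in 𝓝 (1 : v.Completion), expAt v (logAt v x) = x := by
  rcases isReal_or_isComplex v with h | h
  · have hc : Tendsto (fun x => extensionEmbeddingOfIsReal h x) (𝓝 1) (𝓝 1) := by
      have := ((isometry_extensionEmbeddingOfIsReal h).continuous).tendsto 1
      rwa [map_one] at this
    filter_upwards [hc.eventually (lt_mem_nhds (zero_lt_one' ℝ))] with x hx
    apply (extensionEmbedding v).injective
    rw [extensionEmbedding_expAt_of_isReal h, logAt, Complex.log_re,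
      ← extensionEmbeddingOfIsReal_apply h, Complex.norm_real, Real.norm_eq_abs, abs_of_pos hx,
      Real.exp_log hx]
  · filter_upwards [isOpen_ne.mem_nhds (one_ne_zero (α := v.Completion))] with x hx
    apply (extensionEmbedding v).injective
    rw [extensionEmbedding_expAt_of_isComplex h, logAt, Complex.exp_log]
    simpa using hx

/-- Squares lie in the identity component of the multiplicative group. -/
lemma exists_expAt_eq_sq {x : v.Completion} (hx : x ≠ 0) : ∃ z, expAt v z = x ^ 2 := by
  refine ⟨2 * Complex.log (extensionEmbedding v x), ?_⟩
  apply (extensionEmbedding v).injective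
  rcases isReal_or_isComplex v with h | h
  · have hx' : extensionEmbeddingOfIsReal h x ≠ 0 := by simpa using hx
    rw [extensionEmbedding_expAt_of_isReal h, two_mul, Complex.add_re, Real.exp_add, Complex.log_re,
      map_pow, ← extensionEmbeddingOfIsReal_apply h, Complex.norm_real, Real.norm_eq_abs,
      Real.exp_log (abs_pos.2 hx'), abs_mul_abs_self]
    push_cast
    ring
  · have hx' : extensionEmbedding v x ≠ 0 := by simpa using hx
    rw [extensionEmbedding_expAt_of_isComplex h, two_mul, Complex.exp_add, Complex.exp_log hx',
      map_pow, sq]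

/-- The imaginary part of a logarithm may be taken in `[-π, π]`. -/
lemma exists_expAt_eq_abs_im_le (z : ℂ) :
    ∃ z', expAt v z' = expAt v z ∧ z'.re = z.re ∧ |z'.im| ≤ Real.pi := by
  refine ⟨Complex.log (Complex.exp z), ?_, ?_, ?_⟩
  · apply (extensionEmbedding v).injective
    rcases isReal_or_isComplex v with h | h
    · simp [extensionEmbedding_expAt_of_isReal h, Complex.log_re, Complex.norm_exp]
    · simp [extensionEmbedding_expAt_of_isComplex h, Complex.exp_log (Complex.exp_ne_zero z)]
  · simp [Complex.log_re, Complex.norm_exp]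
  · rw [Complex.log_im]; exact Complex.abs_arg_le_pi _

/-- The diagonal matrix with entries `expAt v z` and `expAt v (-z)`. -/
def diagExp (z : ℂ) : SL(2, v.Completion) :=
  ⟨!![expAt v z, 0; 0, expAt v (-z)], by simp [Matrix.det_fin_two, expAt_mul_neg]⟩

@[simp] lemma diagExp_apply_zero_zero (z : ℂ) : diagExp v z 0 0 = expAt v z := rfl
@[simp] lemma diagExp_apply_zero_one (z : ℂ) : diagExp v z 0 1 = 0 := rfl
@[simp] lemma diagExp_apply_one_zero (z : ℂ) : diagExp v z 1 0 = 0 := rfl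
@[simp] lemma diagExp_apply_one_one (z : ℂ) : diagExp v z 1 1 = expAt v (-z) := rfl

lemma diagExp_add (z w : ℂ) : diagExp v (z + w) = diagExp v z * diagExp v w := by
  ext i j
  fin_cases i <;> fin_cases j <;>
    simp [Matrix.mul_apply, Fin.sum_univ_two, expAt_add, add_comm, mul_comm]

@[simp] lemma diagExp_zero : diagExp v 0 = 1 := by
  ext i j
  fin_cases i <;> fin_cases j <;> simp

lemma diagExp_neg (z : ℂ) : diagExp v (-z) = (diagExp v z)⁻¹ := by
  rw [eq_inv_iff_mul_eq_one, ← diagExp_add, neg_add_cancel, diagExp_zero]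

lemma continuous_SL_iff {X R : Type*} [TopologicalSpace X] [CommRing R] [TopologicalSpace R]
    [IsTopologicalRing R] [T1Space R]
    {f : X → SL(2, R)} : Continuous f ↔ ∀ i j, Continuous fun x => f x i j := by
  refine ⟨fun h i j => ?_, fun h => ?_⟩
  · exact (continuous_apply j).comp ((continuous_apply i).comp
      (Matrix.SpecialLinearGroup.isClosedEmbedding_val.continuous.comp h))
  · exact Matrix.SpecialLinearGroup.isClosedEmbedding_val.isEmbedding.continuous_iff.2
      (continuous_matrix h)

lemma continuous_diagExp : Continuous (diagExp v) := by
  rw [continuous_SL_iff]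
  intro i j
  fin_cases i <;> fin_cases j
  · exact continuous_expAt v
  · exact continuous_const
  · exact continuous_const
  · exact (continuous_expAt v).comp continuous_neg

/-- The image of `diagExp v`, as a subgroup of the diagonal group. -/
def diagExpSubgroup : Subgroup (diagonalSubgroup v.Completion) where
  carrier := {g | ∃ z, diagExp v z = g}
  one_mem' := ⟨0, diagExp_zero v⟩
  mul_mem' := by
    rintro a b ⟨z, hz⟩ ⟨w, hw⟩
    exact ⟨z + w, by rw [diagExp_add, hz, hw]; rfl⟩
  inv_mem' := by
    rintro a ⟨z, hz⟩
    exact ⟨-z, by rw [diagExp_neg, hz]; rfl⟩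

lemma isOpen_diagExpSubgroup :
    IsOpen (diagExpSubgroup v : Set (diagonalSubgroup v.Completion)) := by
  refine Subgroup.isOpen_of_mem_nhds _ (g := 1) ?_
  have hc : Continuous fun g : diagonalSubgroup v.Completion => (g : SL(2, v.Completion)) 0 0 :=
    continuous_SL_iff.1 continuous_subtype_val 0 0
  have ht : Tendsto (fun g : diagonalSubgroup v.Completion => (g : SL(2, v.Completion)) 0 0)
      (𝓝 1) (𝓝 1) := by simpa using hc.tendsto 1
  filter_upwards [ht.eventually (eventually_expAt_logAt v)] with g hg
  refine ⟨logAt v ((g : SL(2, v.Completion)) 0 0), ?_⟩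
  have hd := Matrix.det_fin_two (g : SL(2, v.Completion)).1
  have h01 : (g : SL(2, v.Completion)) 0 1 = 0 := g.2.1
  have h10 : (g : SL(2, v.Completion)) 1 0 = 0 := g.2.2
  have h11 : (g : SL(2, v.Completion)) 0 0 * (g : SL(2, v.Completion)) 1 1 = 1 := by
    have := (g : SL(2, v.Completion)).2
    rw [hd] at this
    simpa [h01] using this
  refine Matrix.SpecialLinearGroup.ext _ _ fun i j => ?_
  fin_cases i <;> fin_cases j
  · exact hg
  · exact h01.symm
  · exact h10.symm
  · change expAt v (-_) = _
    rw [expAt_neg, hg]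
    exact (eq_inv_of_mul_eq_one_right h11).symm

/-- `D_v` is the image of the exponential map, because this image is connected and is open in the
diagonal group. -/
lemma mem_diagComponent_iff {g : SL(2, v.Completion)} :
    g ∈ diagComponent v ↔ ∃ z, diagExp v z = g := by
  constructor
  · rintro ⟨h, hh, rfl⟩
    have hsub : connectedComponent (1 : diagonalSubgroup v.Completion) ⊆ diagExpSubgroup v :=
      isPreconnected_connectedComponent.subset_isClopen
        ⟨Subgroup.isClosed_of_isOpen _ (isOpen_diagExpSubgroup v), isOpen_diagExpSubgroup v⟩
        ⟨1, mem_connectedComponent, (diagExpSubgroup v).one_mem⟩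
    exact hsub hh
  · rintro ⟨z, rfl⟩
    let f : ℂ → diagonalSubgroup v.Completion := fun z => ⟨diagExp v z, rfl, rfl⟩
    have hf : Continuous f := (continuous_diagExp v).subtype_mk _
    have hr : Set.range f ⊆ connectedComponent (1 : diagonalSubgroup v.Completion) :=
      (isPreconnected_range hf).subset_connectedComponent
        ⟨0, Subtype.ext (diagExp_zero v)⟩
    exact ⟨f z, hr ⟨z, rfl⟩, rfl⟩

end Local

section Global

variable {K : Type*} [Field K]

/-- The exponential map onto the full torus `D`. -/
def torusExp (z : InfinitePlace K → ℂ) : Grp K := fun v => diagExp v (z v)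

@[simp] lemma torusExp_apply (z : InfinitePlace K → ℂ) (v : InfinitePlace K) :
    torusExp z v = diagExp v (z v) := rfl

lemma torusExp_add (z w : InfinitePlace K → ℂ) : torusExp (z + w) = torusExp z * torusExp w :=
  funext fun v => diagExp_add v _ _

@[simp] lemma torusExp_zero : torusExp (0 : InfinitePlace K → ℂ) = 1 :=
  funext fun v => diagExp_zero v

lemma torusExp_neg (z : InfinitePlace K → ℂ) : torusExp (-z) = (torusExp z)⁻¹ :=
  funext fun v => diagExp_neg v _

lemma continuous_torusExp : Continuous (torusExp (K := K)) :=
  continuous_pi fun v => (continuous_diagExp v).comp (continuous_apply v)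

lemma mem_diagTorus_iff {I : Finset (InfinitePlace K)} {d : Grp K} :
    d ∈ diagTorus I ↔ ∃ z : InfinitePlace K → ℂ, (∀ v ∉ I, z v = 0) ∧ torusExp z = d := by
  constructor
  · rintro ⟨h1, h2⟩
    have h : ∀ v, ∃ z : ℂ, (v ∉ I → z = 0) ∧ diagExp v z = d v := by
      intro v
      by_cases hv : v ∈ I
      · obtain ⟨z, hz⟩ := (mem_diagComponent_iff v).1 (h1 v hv)
        exact ⟨z, fun h => absurd hv h, hz⟩
      · exact ⟨0, fun _ => rfl, by rw [diagExp_zero, h2 v hv]⟩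
    choose z hz hz' using h
    exact ⟨z, hz, funext hz'⟩
  · rintro ⟨z, hz, rfl⟩
    refine ⟨fun v _ => (mem_diagComponent_iff v).2 ⟨z v, rfl⟩, fun v hv => ?_⟩
    simp [hz v hv]

lemma torusExp_mem_diagTorus {I : Finset (InfinitePlace K)} {z : InfinitePlace K → ℂ}
    (hz : ∀ v ∉ I, z v = 0) : torusExp z ∈ diagTorus I := mem_diagTorus_iff.2 ⟨z, hz, rfl⟩

lemma diagTorus_mono {I J : Finset (InfinitePlace K)} (h : I ⊆ J) :
    diagTorus I ≤ diagTorus J := by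
  intro d hd
  obtain ⟨z, hz, rfl⟩ := mem_diagTorus_iff.1 hd
  exact torusExp_mem_diagTorus fun v hv => hz v fun h' => hv (h h')

/-- Elements of `D_I` have logarithms in `ℂ^I` with imaginary parts in `[-π, π]`. -/
lemma exists_torusExp_eq_of_mem {I : Finset (InfinitePlace K)} {d : Grp K} (hd : d ∈ diagTorus I) :
    ∃ z : InfinitePlace K → ℂ, (∀ v ∉ I, z v = 0) ∧ torusExp z = d ∧
      ∀ v, |(z v).im| ≤ Real.pi := by
  obtain ⟨z, hz, rfl⟩ := mem_diagTorus_iff.1 hd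
  have h : ∀ v, ∃ w : ℂ, (v ∉ I → w = 0) ∧ diagExp v w = diagExp v (z v) ∧ |w.im| ≤ Real.pi := by
    intro v
    by_cases hv : v ∈ I
    · obtain ⟨w, hw, -, hw'⟩ := exists_expAt_eq_abs_im_le v (z v)
      refine ⟨w, fun h => absurd hv h, ?_, hw'⟩
      ext i j
      fin_cases i <;> fin_cases j <;> simp [expAt_neg, hw]
    · exact ⟨0, fun _ => rfl, by rw [hz v hv], by simp [Real.pi_nonneg]⟩
  choose w hw hw' hw'' using h
  exact ⟨w, hw, funext hw', hw''⟩

end Global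

/-! ### The arithmetic lattice and heights of vectors -/

section Lattice

variable {K : Type*} [Field K]

/-- The diagonal embedding of `SL(2, K)` in `G`. -/
def emb : SL(2, K) →* Grp K :=
  MonoidHom.pi fun v : InfinitePlace K =>
    Matrix.SpecialLinearGroup.map (n := Fin 2) (algebraMap K v.Completion)

lemma emb_apply_apply (A : SL(2, K)) (v : InfinitePlace K) (i j : Fin 2) :
    emb A v i j = algebraMap K v.Completion (A i j) := rfl

/-- The inclusion of `SL(2, 𝓞 K)` in `SL(2, K)`. -/
abbrev intSL : SL(2, 𝓞 K) →* SL(2, K) := Matrix.SpecialLinearGroup.map (algebraMap (𝓞 K) K)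

variable (K) in
/-- The value in `K_v²` of a vector of `K²`. -/
def vecAt (v : InfinitePlace K) (w : Fin 2 → K) : Fin 2 → v.Completion :=
  fun i => algebraMap K v.Completion (w i)

lemma vecAt_smul (v : InfinitePlace K) (c : K) (w : Fin 2 → K) :
    vecAt K v (c • w) = algebraMap K v.Completion c • vecAt K v w := by
  ext i : 1; simp only [vecAt, Pi.smul_apply, smul_eq_mul, map_mul]

lemma vecAt_ne_zero {v : InfinitePlace K} {w : Fin 2 → K} (hw : w ≠ 0) : vecAt K v w ≠ 0 := by
  contrapose! hw
  ext i
  have := congrFun hw i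
  exact (map_eq_zero (algebraMap K v.Completion)).1 this

lemma emb_mulVec_vecAt (A : SL(2, K)) (v : InfinitePlace K) (w : Fin 2 → K) :
    (emb A v).1 *ᵥ vecAt K v w = vecAt K v (A.1 *ᵥ w) := by
  ext i : 1
  simp only [Matrix.mulVec, dotProduct, vecAt, map_sum, map_mul]
  rfl

/-- The inclusion of `𝓞²` in `K²`. -/
def intVec (w : Fin 2 → 𝓞 K) : Fin 2 → K := fun i => (w i : K)

lemma intVec_ne_zero {w : Fin 2 → 𝓞 K} (hw : w ≠ 0) : intVec w ≠ 0 := by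
  contrapose! hw
  ext i
  simpa [intVec] using congrFun hw i

lemma intSL_mulVec_intVec (A : SL(2, 𝓞 K)) (w : Fin 2 → 𝓞 K) :
    (intSL A).1 *ᵥ intVec w = intVec (A.1 *ᵥ w) := by
  ext i
  simp only [Matrix.mulVec, dotProduct, intVec, map_sum, map_mul]
  rfl

lemma SL_mulVec_ne_zero {F : Type*} [Field F] (A : SL(2, F)) {w : Fin 2 → F} (hw : w ≠ 0) :
    A.1 *ᵥ w ≠ 0 := by
  intro h
  apply hw
  have : (A⁻¹ * A).1 *ᵥ w = 0 := by
    rw [Matrix.SpecialLinearGroup.coe_mul, ← Matrix.mulVec_mulVec, h, Matrix.mulVec_zero]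
  simpa using this

/-- The sum of the norms of the entries of a matrix, a bound for its operator norm. -/
def entrySum {F : Type*} [NormedField F] (A : Matrix (Fin 2) (Fin 2) F) : ℝ := ∑ i, ∑ j, ‖A i j‖

lemma norm_mulVec_le {F : Type*} [NormedField F] (A : Matrix (Fin 2) (Fin 2) F) (x : Fin 2 → F) :
    ‖A *ᵥ x‖ ≤ entrySum A * ‖x‖ := by
  have h0 : 0 ≤ entrySum A :=
    Finset.sum_nonneg fun i _ => Finset.sum_nonneg fun j _ => norm_nonneg _
  refine (pi_norm_le_iff_of_nonneg (by positivity)).2 fun i => ?_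
  calc ‖∑ j, A i j * x j‖ ≤ ∑ j, ‖A i j * x j‖ := norm_sum_le _ _
    _ ≤ ∑ j, ‖A i j‖ * ‖x‖ := Finset.sum_le_sum fun j _ => by
        rw [norm_mul]; gcongr; exact norm_le_pi_norm x j
    _ = (∑ j, ‖A i j‖) * ‖x‖ := by rw [Finset.sum_mul]
    _ ≤ entrySum A * ‖x‖ := by
        gcongr
        exact Finset.single_le_sum (f := fun i => ∑ j, ‖A i j‖)
          (fun i _ => Finset.sum_nonneg fun j _ => norm_nonneg _) (Finset.mem_univ i)

lemma norm_le_mul_norm_mulVec {F : Type*} [NormedField F] (A : SL(2, F)) (x : Fin 2 → F) :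
    ‖x‖ ≤ entrySum (A⁻¹).1 * ‖A.1 *ᵥ x‖ := by
  have : (A⁻¹).1 *ᵥ (A.1 *ᵥ x) = x := by
    rw [Matrix.mulVec_mulVec, ← Matrix.SpecialLinearGroup.coe_mul, inv_mul_cancel]; simp
  conv_lhs => rw [← this]
  exact norm_mulVec_le _ _

end Lattice

section Arithmetic

variable {K : Type*} [Field K]

lemma mem_Gam_iff {γ : Grp K} : γ ∈ Gam K ↔ ∃ A : SL(2, 𝓞 K), emb (intSL A) = γ := Iff.rfl

lemma proj_eq_iff {g h : Grp K} :
    proj g = proj h ↔ ∃ A : SL(2, 𝓞 K), h = g * emb (intSL A) := by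
  rw [QuotientGroup.eq, mem_Gam_iff]
  refine exists_congr fun A => ?_
  rw [eq_inv_mul_iff_mul_eq, eq_comm]

variable [NumberField K]

/-- The product is the absolute value of the norm of `a`, a non-zero integer. -/
lemma one_le_prod_place {a : 𝓞 K} (ha : a ≠ 0) :
    1 ≤ ∏ v : InfinitePlace K, v (a : K) ^ v.mult := by
  rw [prod_eq_abs_norm, ← Algebra.coe_norm_int]
  have : Algebra.norm ℤ a ≠ 0 := Algebra.norm_ne_zero_iff.2 ha
  exact_mod_cast Int.one_le_abs this

instance discreteTopology_Gam : DiscreteTopology (Gam K) := by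
  apply discreteTopology_of_isOpen_singleton_one
  have hc : ∀ v i j, Continuous fun γ : Gam K => ‖(γ : Grp K) v i j - (1 : Grp K) v i j‖ :=
    fun v i j => ((continuous_SL_iff.1 ((continuous_apply v).comp continuous_subtype_val) i j).sub
      continuous_const).norm
  have ho : IsOpen {γ : Gam K | ∀ v i j, ‖(γ : Grp K) v i j - (1 : Grp K) v i j‖ < 1} := by
    simp only [Set.ofPred_forall]
    exact isOpen_iInter_of_finite fun v => isOpen_iInter_of_finite fun i =>
      isOpen_iInter_of_finite fun j => isOpen_lt (hc v i j) continuous_const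
  convert ho using 1
  ext γ
  simp only [Set.mem_singleton_iff, Set.mem_ofPred_eq]
  refine ⟨fun h => by subst h; simp, fun h => ?_⟩
  obtain ⟨_, A, rfl⟩ := γ
  have hA : A = 1 := by
    refine Matrix.SpecialLinearGroup.ext _ _ fun i j => ?_
    rw [← sub_eq_zero]
    by_contra hne
    refine absurd (one_le_prod_place hne) (not_le.2 ?_)
    have hlt : ∀ v : InfinitePlace K,
        v ((A i j - (1 : SL(2, 𝓞 K)) i j : 𝓞 K) : K) < 1 := fun v => by
      have := h v i j
      have h1 : (1 : Grp K) v i j = algebraMap K v.Completion ((1 : SL(2, 𝓞 K)) i j : 𝓞 K) := by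
        rw [show (1 : Grp K) = emb (intSL 1) by rw [map_one, map_one]]
        rfl
      rw [h1] at this
      change ‖algebraMap K v.Completion (A i j : K) - _‖ < 1 at this
      rw [← map_sub, norm_algebraMap_completion] at this
      simpa using this
    obtain ⟨v0⟩ := (inferInstance : Nonempty (InfinitePlace K))
    calc ∏ v : InfinitePlace K, v ((A i j - (1 : SL(2, 𝓞 K)) i j : 𝓞 K) : K) ^ v.mult
        < ∏ v : InfinitePlace K, (1 : ℝ) :=
          Finset.prod_lt_prod_of_nonempty
            (fun v _ => pow_pos (by
              rw [InfinitePlace.pos_iff]; exact_mod_cast hne) _)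
            (fun v _ => pow_lt_one₀ (apply_nonneg _ _) (hlt v) v.mult_pos.ne')
            ⟨v0, Finset.mem_univ _⟩
      _ = 1 := by simp
  subst hA
  exact Subtype.ext (map_one _)

/-- `G / Γ` is Hausdorff because the discrete subgroup `Γ` is closed. -/
instance : T2Space (Space K) := by
  have : IsClosed (Gam K : Set (Grp K)) := Subgroup.isClosed_of_discrete
  rw [t2Space_iff_of_isOpenQuotientMap QuotientGroup.isOpenQuotientMap_mk]
  have : {q : Grp K × Grp K | proj q.1 = proj q.2} =
      (fun q : Grp K × Grp K => q.1⁻¹ * q.2) ⁻¹' Gam K := by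
    ext q
    exact QuotientGroup.eq
  rw [this]
  exact IsClosed.preimage (by fun_prop) ‹_›

/-- The height of the vector `g w`: the product over all places of the normalised sup norms. -/
def height (g : Grp K) (w : Fin 2 → K) : ℝ :=
  ∏ v : InfinitePlace K, ‖(g v).1 *ᵥ vecAt K v w‖ ^ v.mult

lemma height_mul_emb (g : Grp K) (A : SL(2, K)) (w : Fin 2 → K) :
    height (g * emb A) w = height g (A.1 *ᵥ w) := by
  refine Finset.prod_congr rfl fun v _ => ?_
  rw [← emb_mulVec_vecAt, Matrix.mulVec_mulVec]
  rfl

lemma height_smul (g : Grp K) (c : K) (w : Fin 2 → K) :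
    height g (c • w) = (∏ v : InfinitePlace K, v c ^ v.mult) * height g w := by
  rw [height, height, ← Finset.prod_mul_distrib]
  refine Finset.prod_congr rfl fun v _ => ?_
  rw [vecAt_smul, Matrix.mulVec_smul, norm_smul, norm_algebraMap_completion, mul_pow]

lemma height_nonneg (g : Grp K) (w : Fin 2 → K) : 0 ≤ height g w :=
  Finset.prod_nonneg fun _ _ => by positivity

/-- A bound for the factor by which `g⁻¹` can increase heights, continuous in `g`. -/
def distortion (g : Grp K) : ℝ := ∏ v : InfinitePlace K, entrySum ((g v)⁻¹).1 ^ v.mult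

lemma continuous_distortion : Continuous (distortion (K := K)) := by
  refine continuous_finsetProd _ fun v _ => Continuous.pow ?_ _
  refine continuous_finsetSum _ fun i _ => continuous_finsetSum _ fun j _ => Continuous.norm ?_
  exact continuous_SL_iff.1 (continuous_inv.comp (continuous_apply v)) i j

lemma one_le_distortion_mul_height (g : Grp K) {w : Fin 2 → 𝓞 K} (hw : w ≠ 0) :
    1 ≤ distortion g * height g (intVec w) := by
  obtain ⟨i, hi⟩ := Function.ne_iff.1 hw
  refine (one_le_prod_place hi).trans ?_
  rw [distortion, height, ← Finset.prod_mul_distrib]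
  refine Finset.prod_le_prod (fun v _ => pow_nonneg (apply_nonneg _ _) _) fun v _ => ?_
  rw [← mul_pow]
  gcongr
  calc v (w i : K) = ‖vecAt K v (intVec w) i‖ := (norm_algebraMap_completion v _).symm
    _ ≤ ‖vecAt K v (intVec w)‖ := norm_le_pi_norm _ i
    _ ≤ _ := norm_le_mul_norm_mulVec _ _

lemma exists_smul_eq_intVec {w : Fin 2 → K} (hw : w ≠ 0) :
    ∃ (n : 𝓞 K) (w' : Fin 2 → 𝓞 K), n ≠ 0 ∧ w' ≠ 0 ∧ (n : K) • w = intVec w' := by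
  obtain ⟨b, hb⟩ := IsLocalization.exist_integer_multiples_of_finite (nonZeroDivisors (𝓞 K)) w
  choose w' hw' using hb
  have hb0 : (b : 𝓞 K) ≠ 0 := nonZeroDivisors.coe_ne_zero b
  have he : ((b : 𝓞 K) : K) • w = intVec w' := by
    ext i
    exact (hw' i).symm
  refine ⟨b, w', hb0, ?_, he⟩
  rintro rfl
  apply hw
  have h2 : intVec (0 : Fin 2 → 𝓞 K) = 0 := by ext i; simp [intVec]
  rw [h2, smul_eq_zero] at he
  exact he.resolve_left (by exact_mod_cast hb0)

/-- Near every point of `G / Γ` the heights of a fixed non-zero rational vector are bounded below,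
uniformly over all representatives. -/
lemma exists_eventually_le_height (y : Space K) {w : Fin 2 → K} (hw : w ≠ 0) :
    ∃ c > 0, ∀ᶠ x in 𝓝 y, ∀ g, proj g = x → c ≤ height g w := by
  obtain ⟨h, rfl⟩ := QuotientGroup.mk_surjective y
  obtain ⟨n, w', hn, hw', hnw⟩ := exists_smul_eq_intVec hw
  have hN : 0 < ∏ v : InfinitePlace K, v (n : K) ^ v.mult := zero_lt_one.trans_le
    (one_le_prod_place hn)
  have hU : {g : Grp K | distortion g < distortion h + 1} ∈ 𝓝 h :=
    (isOpen_lt continuous_distortion continuous_const).mem_nhds (by simp)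
  have hd : 0 ≤ distortion h := Finset.prod_nonneg fun v _ => pow_nonneg
    (Finset.sum_nonneg fun i _ => Finset.sum_nonneg fun j _ => norm_nonneg _) _
  refine ⟨(∏ v : InfinitePlace K, v (n : K) ^ v.mult)⁻¹ * (distortion h + 1)⁻¹, by positivity, ?_⟩
  filter_upwards [QuotientGroup.isOpenMap_coe.image_mem_nhds hU]
  rintro _ ⟨g', hg', rfl⟩ g hg
  obtain ⟨A, rfl⟩ := proj_eq_iff.1 hg.symm
  have h1 := height_smul (g' * emb (intSL A)) (n : K) w
  rw [hnw, height_mul_emb, intSL_mulVec_intVec] at h1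
  have hne : A.1 *ᵥ w' ≠ 0 := by
    intro h0
    have := SL_mulVec_ne_zero (intSL A) (intVec_ne_zero hw')
    rw [intSL_mulVec_intVec, h0] at this
    exact this (by ext i; simp [intVec])
  have h2 := one_le_distortion_mul_height g' hne
  rw [h1] at h2
  have hg'' : distortion g' < distortion h + 1 := hg'
  rw [← mul_inv, inv_le_iff_one_le_mul₀ (by positivity)]
  refine h2.trans ?_
  have := height_nonneg (g' * emb (intSL A)) w
  calc _ ≤ (distortion h + 1) * _ := mul_le_mul_of_nonneg_right hg''.le (by positivity)
    _ = _ := by ring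

/-- A path along which the height of a fixed rational vector tends to `0` has no limit point in
`G / Γ`. -/
lemma not_tendsto_height_zero {ι : Type*} {F : Filter ι} [F.NeBot] {d : ι → Grp K} {y : Space K}
    (h : Tendsto (fun i => proj (d i)) F (𝓝 y)) {w : Fin 2 → K} (hw : w ≠ 0) :
    ¬ Tendsto (fun i => height (d i) w) F (𝓝 0) := by
  intro h0
  obtain ⟨c, hc, hy⟩ := exists_eventually_le_height y hw
  obtain ⟨i, hi, hi'⟩ := ((h.eventually hy).and (h0.eventually (gt_mem_nhds hc))).exists
  exact absurd (hi _ rfl) (not_le.2 hi')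

end Arithmetic

/-! ### Minkowski's theorem and compactness in `G / Γ` -/

section Minkowski

variable {K : Type*} [Field K] [NumberField K]

open mixedEmbedding MeasureTheory Module
open scoped Classical

lemma norm_le_norm_ringEquiv_mixedSpace (x : InfiniteAdeleRing K) (v : InfinitePlace K) :
    ‖x v‖ ≤ ‖InfiniteAdeleRing.ringEquiv_mixedSpace K x‖ := by
  rw [InfiniteAdeleRing.ringEquiv_mixedSpace_apply, ← norm_extensionEmbedding]
  rcases isReal_or_isComplex v with h | h
  · refine le_trans ?_ (norm_fst_le _)
    rw [← extensionEmbeddingOfIsReal_apply h, Complex.norm_real]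
    exact norm_le_pi_norm (fun v : {w : InfinitePlace K // IsReal w} =>
      extensionEmbeddingOfIsReal v.2 (x v)) ⟨v, h⟩
  · refine le_trans ?_ (norm_snd_le _)
    exact norm_le_pi_norm (fun v : {w : InfinitePlace K // IsComplex w} =>
      extensionEmbedding v.1 (x v)) ⟨v, h⟩

/-- The action of `g ∈ G` on `(K ⊗ ℝ)²`, in the model `ℝ^r₁ × ℂ^r₂` of `K ⊗ ℝ`. -/
def mixedMatrix (g : Grp K) : Matrix (Fin 2) (Fin 2) (mixedSpace K) :=
  fun i j => InfiniteAdeleRing.ringEquiv_mixedSpace K (fun v => g v i j)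

omit [NumberField K] in
lemma det_mixedMatrix (g : Grp K) : (mixedMatrix g).det = 1 := by
  rw [Matrix.det_fin_two]
  let a : Fin 2 → Fin 2 → InfiniteAdeleRing K := fun i j v => g v i j
  have h : a 0 0 * a 1 1 - a 0 1 * a 1 0 = 1 := by
    funext v
    have := (g v).2
    rw [Matrix.det_fin_two] at this
    exact this
  have h' := congrArg (InfiniteAdeleRing.ringEquiv_mixedSpace K) h
  rwa [map_sub, map_mul, map_mul, map_one] at h'

omit [NumberField K] in
lemma mixedMatrix_mulVec (g : Grp K) (w : Fin 2 → K) (i : Fin 2) :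
    (mixedMatrix g *ᵥ fun j => mixedEmbedding K (w j)) i =
      InfiniteAdeleRing.ringEquiv_mixedSpace K (fun v => ((g v).1 *ᵥ vecAt K v w) i) := by
  let a : Fin 2 → InfiniteAdeleRing K := fun j v => g v i j
  let b : Fin 2 → InfiniteAdeleRing K := fun j => algebraMap K _ (w j)
  have h : (fun v => ((g v).1 *ᵥ vecAt K v w) i) = a 0 * b 0 + a 1 * b 1 := by
    funext v
    simp only [Matrix.mulVec, dotProduct, Fin.sum_univ_two]
    rfl
  let φ := InfiniteAdeleRing.ringEquiv_mixedSpace K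
  have h' : φ (a 0 * b 0 + a 1 * b 1) = φ (a 0) * φ (b 0) + φ (a 1) * φ (b 1) := by
    rw [map_add, map_mul, map_mul]
  refine Eq.trans ?_ (congrArg φ h).symm
  rw [h', Matrix.mulVec, dotProduct, Fin.sum_univ_two,
    InfiniteAdeleRing.mixedEmbedding_eq_algebraMap_comp,
    InfiniteAdeleRing.mixedEmbedding_eq_algebraMap_comp]
  rfl

lemma det_toLin'_mixedMatrix (g : Grp K) :
    LinearMap.det ((Matrix.toLin' (mixedMatrix g)).restrictScalars ℝ) = 1 := by
  rw [LinearMap.det_restrictScalars, LinearMap.det_toLin', det_mixedMatrix, map_one]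

/-- The standard lattice `𝓞²` in `(K ⊗ ℝ)²`. -/
def stdBasis : Basis (Σ _ : Fin 2, Free.ChooseBasisIndex ℤ (𝓞 K)) ℝ (Fin 2 → mixedSpace K) :=
  Pi.basis fun _ => mixedEmbedding.latticeBasis K

lemma exists_of_mem_span_stdBasis {x : Fin 2 → mixedSpace K}
    (hx : x ∈ Submodule.span ℤ (Set.range (stdBasis (K := K)))) :
    ∃ w : Fin 2 → 𝓞 K, ∀ i, x i = mixedEmbedding K (intVec w i) := by
  induction hx using Submodule.span_induction with
  | mem x hx =>
    obtain ⟨⟨j, i⟩, rfl⟩ := hx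
    refine ⟨Pi.single j (RingOfIntegers.basis K i), fun k => ?_⟩
    rw [stdBasis, Pi.basis_apply, mixedEmbedding.latticeBasis_apply, integralBasis_apply]
    by_cases hk : k = j
    · subst hk; simp [intVec]
    · simp [intVec, hk]
  | zero => exact ⟨0, fun i => by simp [intVec]⟩
  | add x y _ _ hx hy =>
    obtain ⟨w, hw⟩ := hx
    obtain ⟨w', hw'⟩ := hy
    exact ⟨w + w', fun i => by
      simp only [Pi.add_apply, hw, hw', intVec, map_add]⟩
  | smul a x _ hx =>
    obtain ⟨w, hw⟩ := hx
    exact ⟨a • w, fun i => by simp only [Pi.smul_apply, hw, intVec, map_zsmul]⟩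

/-- Minkowski's theorem for unimodular images of a fixed lattice: all of them have a non-zero vector
in one common ball. -/
theorem exists_short_vector_of_basis {E ι : Type*} [NormedAddCommGroup E] [NormedSpace ℝ E]
    [FiniteDimensional ℝ E] [Nontrivial E] [Finite ι] (b : Basis ι ℝ E) :
    ∃ n : ℕ, 0 < n ∧ ∀ f : E →ₗ[ℝ] E, LinearMap.det f = 1 →
      ∃ x ∈ Submodule.span ℤ (Set.range b), x ≠ 0 ∧ ‖f x‖ ≤ n := by
  borelize E
  let μ : Measure E := Measure.addHaar
  let B := fun n : ℕ => Metric.closedBall (0 : E) n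
  have hB : Tendsto (fun n => μ (B n)) atTop (𝓝 ⊤) := by
    have h := tendsto_measure_iUnion_atTop (μ := μ) (s := B)
      (fun m n h => Metric.closedBall_subset_closedBall (by exact_mod_cast h))
    have hu : ⋃ n, B n = Set.univ := by
      refine Set.eq_univ_of_forall fun x => ?_
      obtain ⟨n, hn⟩ := exists_nat_ge ‖x‖
      exact Set.mem_iUnion.2 ⟨n, by simpa [B] using hn⟩
    rwa [hu, measure_univ_of_isAddLeftInvariant] at h
  have hfin : μ (ZSpan.fundamentalDomain b) * 2 ^ finrank ℝ E < ⊤ := by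
    refine ENNReal.mul_lt_top ?_ (by finiteness)
    exact (ZSpan.fundamentalDomain_isBounded _).measure_lt_top
  obtain ⟨n, hn, hn0⟩ := ((hB.eventually (lt_mem_nhds hfin)).and (eventually_gt_atTop 0)).exists
  refine ⟨n, hn0, fun f hdet => ?_⟩
  have hs : μ (f ⁻¹' B n) = μ (B n) := by
    rw [Measure.addHaar_preimage_linearMap μ (by rw [hdet]; exact one_ne_zero), hdet]; simp
  have : Countable (Submodule.span ℤ (Set.range b)).toAddSubgroup := by
    change Countable (Submodule.span ℤ (Set.range b))
    infer_instance
  obtain ⟨⟨x, hx⟩, hx0, hxs⟩ := exists_ne_zero_mem_lattice_of_measure_mul_two_pow_lt_measure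
    (μ := μ) (s := f ⁻¹' B n) (ZSpan.isAddFundamentalDomain' b μ)
    (fun x hx => by
      simp only [Set.mem_preimage, map_neg, B, Metric.mem_closedBall, dist_zero_right,
        norm_neg] at hx ⊢
      exact hx)
    ((convex_closedBall _ _).linear_preimage f) (by rwa [hs])
  exact ⟨x, hx, fun h => hx0 (Subtype.ext h), by simpa [B] using hxs⟩

/-- Every translate `g 𝓞²`, `g ∈ G`, of the standard lattice has a non-zero vector of norm at most
a constant that does not depend on `g`. -/
theorem exists_short_vector : ∃ C : ℝ, 0 < C ∧ ∀ g : Grp K, ∃ w : Fin 2 → 𝓞 K, w ≠ 0 ∧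
    ∀ v, ‖(g v).1 *ᵥ vecAt K v (intVec w)‖ ≤ C := by
  obtain ⟨n, hn, h⟩ := exists_short_vector_of_basis (stdBasis (K := K))
  refine ⟨n, by exact_mod_cast hn, fun g => ?_⟩
  obtain ⟨x, hx, hx0, hxn⟩ := h _ (det_toLin'_mixedMatrix g)
  obtain ⟨w, hw⟩ := exists_of_mem_span_stdBasis hx
  refine ⟨w, ?_, fun v => ?_⟩
  · rintro rfl
    apply hx0
    funext i
    rw [hw i]
    simp [intVec]
  · refine (pi_norm_le_iff_of_nonneg (Nat.cast_nonneg _)).2 fun i => ?_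
    refine le_trans ?_ ((norm_le_pi_norm _ i).trans hxn)
    have h2 : (Matrix.toLin' (mixedMatrix g)).restrictScalars ℝ x i =
        InfiniteAdeleRing.ringEquiv_mixedSpace K
        (fun v => ((g v).1 *ᵥ vecAt K v (intVec w)) i) := by
      rw [← mixedMatrix_mulVec, ← funext hw]
      rfl
    rw [h2]
    exact norm_le_norm_ringEquiv_mixedSpace (fun v => ((g v).1 *ᵥ vecAt K v (intVec w)) i) v

end Minkowski

section Det

/-- The determinant of a pair of vectors of `F²`. -/
def det2 {F : Type*} [CommRing F] (x y : Fin 2 → F) : F := x 0 * y 1 - x 1 * y 0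

lemma exists_eq_smul_of_det2_eq_zero {F : Type*} [Field F] {x y : Fin 2 → F} (hx : x ≠ 0)
    (h : det2 x y = 0) : ∃ c : F, y = c • x := by
  rw [det2, sub_eq_zero] at h
  by_cases h0 : x 0 = 0
  · have h1 : x 1 ≠ 0 := fun h1 => hx (by ext i; fin_cases i <;> simp [h0, h1])
    refine ⟨y 1 / x 1, ?_⟩
    rw [h0, zero_mul, eq_comm, mul_eq_zero] at h
    have hy0 := h.resolve_left h1
    ext i; fin_cases i <;> simp [h0, hy0, h1]
  · refine ⟨y 0 / x 0, ?_⟩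
    ext i; fin_cases i
    · simp [h0]
    · simp only [Fin.mk_one, Pi.smul_apply, smul_eq_mul]
      field_simp
      linear_combination h

lemma det2_mulVec {F : Type*} [CommRing F] (A : Matrix (Fin 2) (Fin 2) F) (x y : Fin 2 → F) :
    det2 (A *ᵥ x) (A *ᵥ y) = A.det * det2 x y := by
  simp only [det2, Matrix.mulVec, dotProduct, Fin.sum_univ_two, Matrix.det_fin_two]; ring

lemma det2_SL_mulVec {F : Type*} [CommRing F] (A : SL(2, F)) (x y : Fin 2 → F) :
    det2 (A.1 *ᵥ x) (A.1 *ᵥ y) = det2 x y := by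
  rw [det2_mulVec, A.2, one_mul]

lemma norm_det2_le {F : Type*} [NormedField F] (x y : Fin 2 → F) :
    ‖det2 x y‖ ≤ 2 * (‖x‖ * ‖y‖) := by
  calc ‖det2 x y‖ ≤ ‖x 0 * y 1‖ + ‖x 1 * y 0‖ := norm_sub_le _ _
    _ ≤ ‖x‖ * ‖y‖ + ‖x‖ * ‖y‖ := by
        rw [norm_mul, norm_mul]
        gcongr <;> exact norm_le_pi_norm _ _
    _ = _ := by ring

/-- A vector of norm in `[δ, C]` is the first column of a matrix in `SL(2, F)` whose second column
has norm at most `δ⁻¹`; `k` is the inverse of this matrix. -/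
lemma exists_SL_mulVec_eq {F : Type*} [NormedField F] {x : Fin 2 → F} {δ : ℝ} (hδ : 0 < δ)
    (hx : δ ≤ ‖x‖) : ∃ k : SL(2, F), k.1 *ᵥ x = ![1, 0] ∧
      ∀ y, ‖y‖ ≤ ‖x‖ * ‖(k.1 *ᵥ y) 0‖ + δ⁻¹ * ‖(k.1 *ᵥ y) 1‖ := by
  obtain ⟨z, hz, hzn⟩ : ∃ z : Fin 2 → F, det2 x z = 1 ∧ ‖z‖ ≤ δ⁻¹ := by
    obtain ⟨i, hi⟩ : ∃ i, δ ≤ ‖x i‖ := by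
      by_contra! h
      exact absurd hx (not_le.2 ((pi_norm_lt_iff hδ).2 h))
    have hi0 : x i ≠ 0 := norm_pos_iff.1 (hδ.trans_le hi)
    have hin : ‖(x i)⁻¹‖ ≤ δ⁻¹ := by rw [norm_inv]; gcongr
    fin_cases i
    · refine ⟨![0, (x 0)⁻¹], ?_, (pi_norm_le_iff_of_nonneg (by positivity)).2 fun j => ?_⟩
      · simpa [det2] using mul_inv_cancel₀ hi0
      · fin_cases j
        · simpa using hδ.le
        · simpa using hin
    · refine ⟨![-(x 1)⁻¹, 0], ?_, (pi_norm_le_iff_of_nonneg (by positivity)).2 fun j => ?_⟩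
      · simpa [det2] using mul_inv_cancel₀ hi0
      · fin_cases j
        · simpa using hin
        · simpa using hδ.le
  refine ⟨⟨!![z 1, -z 0; -x 1, x 0], ?_⟩, ?_, fun y => ?_⟩
  · rw [Matrix.det_fin_two_of]; rw [det2] at hz; linear_combination hz
  · rw [det2] at hz
    ext i; fin_cases i
    · simp [Matrix.mulVec, dotProduct, Fin.sum_univ_two]; linear_combination hz
    · simp [Matrix.mulVec, dotProduct, Fin.sum_univ_two]; ring
  · set a := (!![z 1, -z 0; -x 1, x 0] *ᵥ y) 0 with ha
    set b := (!![z 1, -z 0; -x 1, x 0] *ᵥ y) 1 with hb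
    have hy : y = a • x + b • z := by
      rw [det2] at hz
      simp [Matrix.mulVec, dotProduct, Fin.sum_univ_two] at ha hb
      ext i; fin_cases i
      · simp [ha, hb]; linear_combination - y 0 * hz
      · simp [ha, hb]; linear_combination - y 1 * hz
    calc ‖y‖ = ‖a • x + b • z‖ := by rw [← hy]
      _ ≤ ‖a‖ * ‖x‖ + ‖b‖ * ‖z‖ := by
          refine (norm_add_le _ _).trans ?_
          rw [norm_smul, norm_smul]
      _ ≤ ‖a‖ * ‖x‖ + ‖b‖ * δ⁻¹ := by gcongr
      _ = _ := by ring

end Det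

section IntegralMatrices

variable {K : Type*} [Field K] [NumberField K]

/-- Integral matrices of fixed determinant `m ≠ 0` form finitely many cosets `SL(2, 𝓞) M`, because
two such matrices congruent modulo `m` lie in the same coset. With `D` the adjugate of a
representative of the coset of `M`, this gives `M D = m γ` with `γ ∈ SL(2, 𝓞)` and `D` bounded. -/
lemma exists_bound_of_det_eq {m : 𝓞 K} (hm : m ≠ 0) : ∃ R : ℝ,
    ∀ M : Matrix (Fin 2) (Fin 2) (𝓞 K), M.det = m → ∃ (γ : SL(2, 𝓞 K))
      (D : Matrix (Fin 2) (Fin 2) (𝓞 K)), M * D = m • γ.1 ∧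
      ∀ (v : InfinitePlace K) i j, v (D i j : K) ≤ R * v (m : K) := by
  classical
  have hfin : Finite (𝓞 K ⧸ Ideal.span {m}) :=
    Ideal.finiteQuotientOfFreeOfNeBot _ (by simpa using hm)
  let q := Ideal.Quotient.mk (Ideal.span {m})
  let X := {M : Matrix (Fin 2) (Fin 2) (𝓞 K) // M.det = m}
  let Φ : X → Matrix (Fin 2) (Fin 2) (𝓞 K ⧸ Ideal.span {m}) := fun M => M.1.map q
  have hr : Finite (Set.range Φ) := Subtype.finite
  have hsec : ∀ c : Set.range Φ, ∃ M : X, Φ M = c := fun c => c.2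
  choose rep hrep using hsec
  cases nonempty_fintype (Set.range Φ)
  have hmv : ∀ v : InfinitePlace K, 0 < v (m : K) := fun v =>
    InfinitePlace.pos_iff.2 (by exact_mod_cast hm)
  refine ⟨∑ c, ∑ v : InfinitePlace K, ∑ i, ∑ j,
    v ((rep c).1.adjugate i j : K) / v (m : K), fun M hM => ?_⟩
  let c : Set.range Φ := ⟨Φ ⟨M, hM⟩, ⟨M, hM⟩, rfl⟩
  have hc : ∀ i j, q ((rep c).1 i j) = q (M i j) := fun i j =>
    congrFun (congrFun (hrep c) i) j
  have hdiv : ∀ i j, m ∣ (M * (rep c).1.adjugate) i j := by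
    intro i j
    rw [← Ideal.mem_span_singleton, ← Ideal.Quotient.eq_zero_iff_mem]
    have h1 : ((rep c).1 * (rep c).1.adjugate) i j =
        m * (1 : Matrix (Fin 2) (Fin 2) (𝓞 K)) i j := by
      rw [Matrix.mul_adjugate, (rep c).2]; rfl
    have h2 : q ((M * (rep c).1.adjugate) i j) = q (((rep c).1 * (rep c).1.adjugate) i j) := by
      simp only [Matrix.mul_apply, map_sum, map_mul, hc]
    have h3 : q m = 0 := Ideal.Quotient.eq_zero_iff_mem.2 (Ideal.mem_span_singleton_self m)
    change q _ = 0
    rw [h2, h1, map_mul, h3, zero_mul]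
  choose γ hγ using hdiv
  have hMD : M * (rep c).1.adjugate = m • Matrix.of γ := by
    ext i j : 2
    rw [hγ]; rfl
  have hdet : (Matrix.of γ).det = 1 := by
    have h := congrArg Matrix.det hMD
    rw [Matrix.det_mul, Matrix.det_adjugate, Matrix.det_smul, (rep c).2, hM] at h
    simp only [Fintype.card_fin] at h
    have h4 : m ^ 2 * ((Matrix.of γ).det - 1) = 0 := by linear_combination -h
    exact sub_eq_zero.1 ((mul_eq_zero.1 h4).resolve_left (pow_ne_zero _ hm))
  refine ⟨⟨Matrix.of γ, hdet⟩, (rep c).1.adjugate, hMD, fun v i j => ?_⟩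
  rw [← div_le_iff₀ (hmv v)]
  have hnn : ∀ (c) (v : InfinitePlace K) (i j), 0 ≤ v ((rep c).1.adjugate i j : K) / v (m : K) :=
    fun c v i j => div_nonneg (apply_nonneg _ _) (apply_nonneg _ _)
  calc _ ≤ ∑ j, v ((rep c).1.adjugate i j : K) / v (m : K) :=
        Finset.single_le_sum (fun j _ => hnn c v i j) (Finset.mem_univ j)
    _ ≤ ∑ i, ∑ j, v ((rep c).1.adjugate i j : K) / v (m : K) :=
        Finset.single_le_sum (f := fun i => ∑ j, v ((rep c).1.adjugate i j : K) / v (m : K))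
          (fun i _ => Finset.sum_nonneg fun j _ => hnn c v i j) (Finset.mem_univ i)
    _ ≤ ∑ v : InfinitePlace K, ∑ i, ∑ j, v ((rep c).1.adjugate i j : K) / v (m : K) :=
        Finset.single_le_sum
          (f := fun v : InfinitePlace K => ∑ i, ∑ j, v ((rep c).1.adjugate i j : K) / v (m : K))
          (fun v _ => Finset.sum_nonneg fun i _ => Finset.sum_nonneg fun j _ => hnn c v i j)
          (Finset.mem_univ v)
    _ ≤ _ := Finset.single_le_sum (f := fun c => ∑ v : InfinitePlace K, ∑ i, ∑ j,
          v ((rep c).1.adjugate i j : K) / v (m : K))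
          (fun c _ => Finset.sum_nonneg fun v _ => Finset.sum_nonneg fun i _ =>
            Finset.sum_nonneg fun j _ => hnn c v i j) (Finset.mem_univ c)

/-- The bound of `exists_bound_of_det_eq` is uniform in the determinant, since there are only
finitely many algebraic integers all of whose conjugates are bounded by `B`. -/
lemma exists_bound_of_det_le (B : ℝ) : ∃ R : ℝ, 0 ≤ R ∧
    ∀ M : Matrix (Fin 2) (Fin 2) (𝓞 K), M.det ≠ 0 →
      (∀ v : InfinitePlace K, v (M.det : K) ≤ B) → ∃ (γ : SL(2, 𝓞 K))
      (D : Matrix (Fin 2) (Fin 2) (𝓞 K)), M * D = M.det • γ.1 ∧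
      ∀ (v : InfinitePlace K) i j, v (D i j : K) ≤ R * v (M.det : K) := by
  have hS : {m : 𝓞 K | ∀ v : InfinitePlace K, v (m : K) ≤ B}.Finite := by
    have h := Embeddings.finite_of_norm_le K ℂ B
    refine Set.Finite.of_finite_image (f := fun m : 𝓞 K => (m : K)) (h.subset ?_)
      RingOfIntegers.coe_injective.injOn
    rintro _ ⟨m, hm, rfl⟩
    exact ⟨m.2, fun φ => hm (InfinitePlace.mk φ)⟩
  have hR : ∀ m : 𝓞 K, ∃ R : ℝ, m ≠ 0 →
    ∀ M : Matrix (Fin 2) (Fin 2) (𝓞 K), M.det = m → ∃ (γ : SL(2, 𝓞 K))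
      (D : Matrix (Fin 2) (Fin 2) (𝓞 K)), M * D = m • γ.1 ∧
      ∀ (v : InfinitePlace K) i j, v (D i j : K) ≤ R * v (m : K) := by
    intro m
    by_cases hm : m = 0
    · exact ⟨0, fun h => absurd hm h⟩
    · obtain ⟨R, h⟩ := exists_bound_of_det_eq hm
      exact ⟨R, fun _ => h⟩
  choose R hR using hR
  refine ⟨∑ m ∈ hS.toFinset, |R m|, Finset.sum_nonneg fun _ _ => abs_nonneg _,
    fun M hM hMB => ?_⟩
  obtain ⟨γ, D, h1, h2⟩ := hR M.det hM M rfl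
  refine ⟨γ, D, h1, fun v i j => (h2 v i j).trans ?_⟩
  gcongr
  exact (le_abs_self _).trans (Finset.single_le_sum (f := fun m => |R m|)
    (fun _ _ => abs_nonneg _) (hS.mem_toFinset.2 hMB))

/-- If a product of factors in `[0, C]` is at least `ε`, then no factor is small. -/
lemma min_le_of_le_prod {a : InfinitePlace K → ℝ} {C ε : ℝ} (hC : 1 ≤ C)
    (ha : ∀ v, 0 ≤ a v) (haC : ∀ v, a v ≤ C) (h : ε ≤ ∏ v, a v ^ v.mult) (v : InfinitePlace K) :
    min 1 (ε / C ^ (∑ v : InfinitePlace K, v.mult)) ≤ a v := by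
  classical
  rcases le_total 1 (a v) with h1 | h1
  · exact (min_le_left _ _).trans h1
  refine (min_le_right _ _).trans ?_
  rw [div_le_iff₀ (by positivity)]
  refine h.trans ?_
  rw [← Finset.mul_prod_erase _ _ (Finset.mem_univ v)]
  gcongr
  · exact Finset.prod_nonneg fun u _ => pow_nonneg (ha u) _
  · exact ha v
  · exact pow_le_of_le_one (ha v) h1 v.mult_pos.ne'
  · calc ∏ u ∈ Finset.univ.erase v, a u ^ u.mult
        ≤ ∏ u ∈ Finset.univ.erase v, C ^ u.mult :=
          Finset.prod_le_prod (fun u _ => pow_nonneg (ha u) _)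
            fun u _ => pow_le_pow_left₀ (ha u) (haC u) _
      _ = C ^ ∑ u ∈ Finset.univ.erase v, u.mult := Finset.prod_pow_eq_pow_sum _ _ _
      _ ≤ C ^ ∑ u : InfinitePlace K, u.mult := pow_le_pow_right₀ hC
          (Finset.sum_le_sum_of_subset (Finset.erase_subset _ _))

end IntegralMatrices

section Mahler

variable {K : Type*} [Field K]

lemma norm_diagExp_mulVec_zero (v : InfinitePlace K) (z : ℂ) (x : Fin 2 → v.Completion) :
    ‖((diagExp v z).1 *ᵥ x) 0‖ = Real.exp z.re * ‖x 0‖ := by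
  rw [← norm_expAt v z, ← norm_mul]
  congr 1
  simp [Matrix.mulVec, dotProduct, Fin.sum_univ_two]

lemma norm_diagExp_mulVec_one (v : InfinitePlace K) (z : ℂ) (x : Fin 2 → v.Completion) :
    ‖((diagExp v z).1 *ᵥ x) 1‖ = Real.exp (-z.re) * ‖x 1‖ := by
  rw [← Complex.neg_re, ← norm_expAt v (-z), ← norm_mul]
  congr 1
  simp [Matrix.mulVec, dotProduct, Fin.sum_univ_two]

lemma vecAt_det2 (v : InfinitePlace K) (x y : Fin 2 → K) :
    det2 (vecAt K v x) (vecAt K v y) = algebraMap K v.Completion (det2 x y) := by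
  simp only [det2, vecAt, map_sub, map_mul]

lemma intVec_det2 (x y : Fin 2 → 𝓞 K) : det2 (intVec x) (intVec y) = (det2 x y : 𝓞 K) := by
  simp only [det2, intVec, map_sub, map_mul]

/-- The place `v` of the determinant of two vectors is controlled by their images under `g_v`. -/
lemma place_det2_le (g : Grp K) (v : InfinitePlace K) (x y : Fin 2 → K) :
    v (det2 x y) ≤ 2 * (‖(g v).1 *ᵥ vecAt K v x‖ * ‖(g v).1 *ᵥ vecAt K v y‖) := by
  rw [← norm_algebraMap_completion, ← vecAt_det2, ← det2_SL_mulVec (g v)]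
  exact norm_det2_le _ _

variable [NumberField K]

lemma sum_mult_pos : 0 < ∑ v : InfinitePlace K, v.mult :=
  Finset.sum_pos (fun v _ => v.mult_pos) Finset.univ_nonempty

/-- Given a short vector `w` of `g 𝓞²` and a lower bound for all heights, there is a second short
vector, independent of `w`: Minkowski's theorem is applied after expanding the direction of `w`
so strongly that a multiple of `w` that is still in the ball would have too small a height. -/
lemma exists_second_short_vector {C ε : ℝ} (hC : 1 ≤ C) (hε : 0 < ε)
    (hmin : ∀ g : Grp K, ∃ w : Fin 2 → 𝓞 K, w ≠ 0 ∧
      ∀ v, ‖(g v).1 *ᵥ vecAt K v (intVec w)‖ ≤ C) :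
    ∃ C' : ℝ, C ≤ C' ∧ ∀ (g : Grp K) (w : Fin 2 → 𝓞 K), w ≠ 0 →
      (∀ v, ‖(g v).1 *ᵥ vecAt K v (intVec w)‖ ≤ C) →
      (∀ w : Fin 2 → 𝓞 K, w ≠ 0 → ε ≤ height g (intVec w)) →
      ∃ w' : Fin 2 → 𝓞 K, det2 w w' ≠ 0 ∧ ∀ v, ‖(g v).1 *ᵥ vecAt K v (intVec w')‖ ≤ C' := by
  have hC0 : 0 < C := zero_lt_one.trans_le hC
  set M := ∑ v : InfinitePlace K, v.mult with hM
  set δ := min 1 (ε / C ^ M) with hδ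
  have hδ0 : 0 < δ := lt_min one_pos (by positivity)
  -- the direction of `w` is expanded by `τ⁻¹`; a multiple of `w` that is then still in the ball has
  -- height at most `C τ C < ε`
  set τ := min 1 ε / (2 * C ^ 2) with hτ
  have hτ0 : 0 < τ := by have : 0 < min 1 ε := lt_min one_pos hε
                         positivity
  refine ⟨max C (C * (C * τ) + δ⁻¹ * (C * τ⁻¹)), le_max_left _ _, fun g w hw hwC hg => ?_⟩
  have hlow : ∀ v, δ ≤ ‖(g v).1 *ᵥ vecAt K v (intVec w)‖ := fun v =>
    min_le_of_le_prod hC (fun v => norm_nonneg _) hwC (hg w hw) v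
  choose k hk hk' using fun v => exists_SL_mulVec_eq hδ0 (hlow v)
  let c : ℂ := (-Real.log τ : ℝ)
  have hc1 : Real.exp c.re = τ⁻¹ := by
    rw [Complex.ofReal_re, Real.exp_neg, Real.exp_log hτ0]
  have hc2 : Real.exp (-c.re) = τ := by
    rw [Complex.ofReal_re, neg_neg, Real.exp_log hτ0]
  -- `k v` moves `g w` to `e₀`, whose direction `diagExp v c` expands
  let h : Grp K := fun v => diagExp v c * (k v * g v)
  obtain ⟨w', hw', hw'C⟩ := hmin h
  have hh : ∀ v, (h v).1 *ᵥ vecAt K v (intVec w') =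
      (diagExp v c).1 *ᵥ ((k v).1 *ᵥ ((g v).1 *ᵥ vecAt K v (intVec w'))) := fun v => by
    rw [Matrix.mulVec_mulVec, Matrix.mulVec_mulVec, Matrix.mul_assoc]; rfl
  have h0 : ∀ v, ‖((k v).1 *ᵥ ((g v).1 *ᵥ vecAt K v (intVec w'))) 0‖ ≤ C * τ := fun v => by
    have h1 := (norm_le_pi_norm _ 0).trans (hw'C v)
    rw [hh, norm_diagExp_mulVec_zero, hc1] at h1
    rwa [inv_mul_le_iff₀ hτ0, mul_comm] at h1
  have h1 : ∀ v, ‖((k v).1 *ᵥ ((g v).1 *ᵥ vecAt K v (intVec w'))) 1‖ ≤ C * τ⁻¹ := fun v => by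
    have h1 := (norm_le_pi_norm _ 1).trans (hw'C v)
    rw [hh, norm_diagExp_mulVec_one, hc2] at h1
    rwa [← div_eq_mul_inv, le_div_iff₀ hτ0, mul_comm]
  refine ⟨w', fun hdet => ?_, fun v => ?_⟩
  · have hdet' : det2 (intVec w) (intVec w') = 0 := by rw [intVec_det2, hdet]; simp
    obtain ⟨a, ha⟩ := exists_eq_smul_of_det2_eq_zero (intVec_ne_zero hw) hdet'
    have ha' : ∀ v : InfinitePlace K, v a ≤ C * τ := fun v => by
      have h2 := h0 v
      rw [ha, vecAt_smul, Matrix.mulVec_smul, Matrix.mulVec_smul, hk, Pi.smul_apply] at h2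
      simp only [Matrix.cons_val_zero, smul_eq_mul, mul_one] at h2
      rwa [norm_algebraMap_completion] at h2
    have h3 : height g (intVec w') ≤ (C * τ * C) ^ M := by
      rw [height, hM, ← Finset.prod_pow_eq_pow_sum]
      refine Finset.prod_le_prod (fun v _ => by positivity) fun v _ => ?_
      gcongr
      rw [ha, vecAt_smul, Matrix.mulVec_smul, norm_smul, norm_algebraMap_completion]
      exact mul_le_mul (ha' v) (hwC v) (norm_nonneg _) (by positivity)
    have h4 : C * τ * C = min 1 ε / 2 := by rw [hτ]; field_simp
    have h5 : 0 < min 1 ε := lt_min one_pos hε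
    have h6 : (C * τ * C) ^ M ≤ C * τ * C := pow_le_of_le_one (by positivity)
      (by rw [h4]; linarith [min_le_left 1 ε]) sum_mult_pos.ne'
    have := hg w' hw'
    rw [h4] at h6
    rw [h4] at h3
    linarith [min_le_right 1 ε]
  · refine le_trans ?_ (le_max_right _ _)
    refine (hk' v _).trans ?_
    have hinv : (0 : ℝ) ≤ δ⁻¹ := by positivity
    gcongr
    · exact hwC v
    · exact h0 v
    · exact h1 v

/-- Mahler's compactness criterion for `SL(2, 𝓞)`: if all heights on `g 𝓞²` are at least `ε`, then
`g Γ` has a representative whose entries are bounded in terms of `ε`. -/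
theorem exists_bounded_representative {ε : ℝ} (hε : 0 < ε) : ∃ R : ℝ, ∀ g : Grp K,
    (∀ w : Fin 2 → 𝓞 K, w ≠ 0 → ε ≤ height g (intVec w)) →
    ∃ A : SL(2, 𝓞 K), ∀ v i j, ‖(g * emb (intSL A)) v i j‖ ≤ R := by
  obtain ⟨C₀, -, hC₀⟩ := exists_short_vector (K := K)
  set C := max 1 C₀ with hCdef
  have hC : 1 ≤ C := le_max_left _ _
  have hmin : ∀ g : Grp K, ∃ w : Fin 2 → 𝓞 K, w ≠ 0 ∧
      ∀ v, ‖(g v).1 *ᵥ vecAt K v (intVec w)‖ ≤ C := fun g => by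
    obtain ⟨w, hw, h⟩ := hC₀ g
    exact ⟨w, hw, fun v => (h v).trans (le_max_right _ _)⟩
  obtain ⟨C', hCC', hC'⟩ := exists_second_short_vector hC hε hmin
  have hC'0 : 0 < C' := zero_lt_one.trans_le (hC.trans hCC')
  obtain ⟨R, hR0, hR⟩ := exists_bound_of_det_le (K := K) (2 * (C' * C'))
  refine ⟨2 * (C' * R), fun g hg => ?_⟩
  obtain ⟨w, hw, hwC⟩ := hmin g
  obtain ⟨w', hdet, hw'C⟩ := hC' g w hw hwC hg
  -- the integral matrix with the columns `w` and `w'`; `g M` is bounded, and `M` is replaced by an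
  -- element of its coset in `SL(2, 𝓞)`
  let M : Matrix (Fin 2) (Fin 2) (𝓞 K) := Matrix.of fun i j => ![w, w'] j i
  have hMdet : M.det = det2 w w' := by
    rw [Matrix.det_fin_two, det2]; simp [M]; ring
  have hcol : ∀ v i k, ‖∑ j, g v i j * algebraMap K v.Completion (M j k : K)‖ ≤ C' := by
    intro v i k
    fin_cases k
    · exact (norm_le_pi_norm ((g v).1 *ᵥ vecAt K v (intVec w)) i).trans ((hwC v).trans hCC')
    · exact (norm_le_pi_norm ((g v).1 *ᵥ vecAt K v (intVec w')) i).trans (hw'C v)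
  obtain ⟨γ, D, hMD, hD⟩ := hR M (by rwa [hMdet]) fun v => by
    rw [hMdet, ← intVec_det2]
    refine (place_det2_le g v _ _).trans ?_
    gcongr
    · exact (hwC v).trans hCC'
    · exact hw'C v
  refine ⟨γ, fun v i j => ?_⟩
  have hm0 : 0 < v (M.det : K) := InfinitePlace.pos_iff.2 (by
    rw [hMdet]; exact_mod_cast hdet)
  -- `det M • (g γ) = (g M) D`
  have hkey : algebraMap K v.Completion (M.det : K) * (g * emb (intSL γ)) v i j =
      ∑ k, (∑ l, g v i l * algebraMap K v.Completion (M l k : K)) *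
        algebraMap K v.Completion (D k j : K) := by
    have h1 : ∀ l, algebraMap K v.Completion (M.det : K) * algebraMap K v.Completion (γ l j : K) =
        ∑ k, algebraMap K v.Completion (M l k : K) * algebraMap K v.Completion (D k j : K) := by
      intro l
      have h2 : (M * D) l j = M.det * γ l j := by rw [hMD]; rfl
      rw [Matrix.mul_apply] at h2
      have h3 := congrArg (fun x : 𝓞 K => algebraMap K v.Completion (x : K)) h2
      simp only [map_sum, map_mul] at h3
      exact h3.symm
    have h4 : (g * emb (intSL γ)) v i j =
        ∑ l, g v i l * algebraMap K v.Completion (γ l j : K) := by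
      change ((g v).1 * (emb (intSL γ) v).1) i j = _
      rw [Matrix.mul_apply]; rfl
    rw [h4, Finset.mul_sum]
    simp_rw [Finset.sum_mul]
    rw [Finset.sum_comm]
    refine Finset.sum_congr rfl fun l _ => ?_
    rw [mul_left_comm, h1, Finset.mul_sum]
    exact Finset.sum_congr rfl fun k _ => by ring
  have hnorm := congrArg norm hkey
  rw [norm_mul, norm_algebraMap_completion] at hnorm
  have hle : v (M.det : K) * ‖(g * emb (intSL γ)) v i j‖ ≤ v (M.det : K) * (2 * (C' * R)) := by
    rw [hnorm]
    refine (norm_sum_le _ _).trans ?_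
    rw [Fin.sum_univ_two]
    have : ∀ k, ‖(∑ l, g v i l * algebraMap K v.Completion (M l k : K)) *
        algebraMap K v.Completion (D k j : K)‖ ≤ C' * (R * v (M.det : K)) := fun k => by
      rw [norm_mul, norm_algebraMap_completion]
      exact mul_le_mul (hcol v i k) (hD v k j) (apply_nonneg _ _) hC'0.le
    linarith [this 0, this 1]
  exact le_of_mul_le_mul_left hle hm0

omit [NumberField K] in
lemma isCompact_entries_le (R : ℝ) : IsCompact {g : Grp K | ∀ v i j, ‖g v i j‖ ≤ R} := by
  have h : {g : Grp K | ∀ v i j, ‖g v i j‖ ≤ R} =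
      Set.univ.pi fun v : InfinitePlace K => {A : SL(2, v.Completion) | ∀ i j, ‖A i j‖ ≤ R} := by
    ext g; simp
  rw [h]
  refine isCompact_univ_pi fun v => ?_
  have h2 : IsCompact (Set.univ.pi fun _ : Fin 2 => Set.univ.pi fun _ : Fin 2 =>
      Metric.closedBall (0 : v.Completion) R) :=
    isCompact_univ_pi fun _ => isCompact_univ_pi fun _ => isCompact_closedBall _ _
  have h3 := (Matrix.SpecialLinearGroup.isClosedEmbedding_val
    (n := Fin 2) (R := v.Completion)).isCompact_preimage h2
  have h4 : {A : SL(2, v.Completion) | ∀ i j, ‖A i j‖ ≤ R} =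
      (fun A : SL(2, v.Completion) => A.1) ⁻¹' (Set.univ.pi fun _ : Fin 2 =>
        Set.univ.pi fun _ : Fin 2 => Metric.closedBall (0 : v.Completion) R) := by
    exact Set.ext fun A => ⟨fun h i _ j _ => mem_closedBall_zero_iff.2 (h i j),
      fun h i j => mem_closedBall_zero_iff.1 (h i trivial j trivial)⟩
  rw [h4]
  exact h3

end Mahler

/-! ### Divergent orbits of one-dimensional tori -/

section Divergent

variable {K : Type*} [Field K] [NumberField K]

omit [NumberField K] in
lemma norm_diagExp_mulVec_le (v : InfinitePlace K) (z : ℂ) (x : Fin 2 → v.Completion) :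
    ‖(diagExp v z).1 *ᵥ x‖ ≤ Real.exp |z.re| * ‖x‖ := by
  refine (pi_norm_le_iff_of_nonneg (by positivity)).2 fun i => ?_
  fin_cases i
  · refine (norm_diagExp_mulVec_zero v z x).le.trans ?_
    gcongr
    exacts [le_abs_self _, norm_le_pi_norm _ _]
  · refine (norm_diagExp_mulVec_one v z x).le.trans ?_
    gcongr
    exacts [neg_le_abs _, norm_le_pi_norm _ _]

lemma height_torusExp_mul_le (z : InfinitePlace K → ℂ) (g : Grp K) (w : Fin 2 → K) :
    height (torusExp z * g) w ≤ (∏ v, Real.exp |(z v).re| ^ v.mult) * height g w := by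
  rw [height, height, ← Finset.prod_mul_distrib]
  refine Finset.prod_le_prod (fun v _ => by positivity) fun v _ => ?_
  rw [← mul_pow]
  gcongr
  have : ((torusExp z * g) v).1 *ᵥ vecAt K v w =
      (diagExp v (z v)).1 *ᵥ ((g v).1 *ᵥ vecAt K v w) := by
    rw [Matrix.mulVec_mulVec]; rfl
  rw [this]
  exact norm_diagExp_mulVec_le v _ _

/-- Two integral vectors of small height are proportional. -/
lemma det2_eq_zero_of_height_mul_lt (g : Grp K) (x y : Fin 2 → 𝓞 K)
    (h : 2 ^ (∑ v : InfinitePlace K, v.mult) * (height g (intVec x) * height g (intVec y)) < 1) :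
    det2 x y = 0 := by
  by_contra hne
  refine absurd ((one_le_prod_place hne).trans ?_) (not_le.2 h)
  rw [height, height, ← Finset.prod_pow_eq_pow_sum, ← Finset.prod_mul_distrib,
    ← Finset.prod_mul_distrib]
  refine Finset.prod_le_prod (fun v _ => pow_nonneg (apply_nonneg _ _) _) fun v _ => ?_
  rw [← mul_pow, ← mul_pow, ← intVec_det2]
  exact pow_le_pow_left₀ (apply_nonneg _ _) (place_det2_le g v _ _) _

lemma det2_eq_zero_trans {F : Type*} [CommRing F] [IsDomain F] {x y z : Fin 2 → F} (hy : y ≠ 0)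
    (h1 : det2 x y = 0) (h2 : det2 y z = 0) : det2 x z = 0 := by
  simp only [det2] at *
  obtain ⟨i, hi⟩ := Function.ne_iff.1 hy
  refine (mul_eq_zero.1 (?_ : y i * _ = 0)).resolve_left hi
  fin_cases i
  · simp only [Fin.zero_eta]; linear_combination z 0 * h1 + x 0 * h2
  · simp only [Fin.mk_one]; linear_combination z 1 * h1 + x 1 * h2

open Classical in
/-- A divergent orbit of `D_v` cannot stay in a compact set along an unbounded sequence, so by the
compactness criterion it acquires arbitrarily short vectors. -/
lemma eventually_exists_height_lt {v : InfinitePlace K} {g : Grp K}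
    (h : IsDivergentOrbit (diagTorus {v}) (proj g)) {z : ℕ → ℂ}
    (hz : Tendsto (fun n => |(z n).re|) atTop atTop) {ε : ℝ} (hε : 0 < ε) :
    ∀ᶠ n in atTop, ∃ w : Fin 2 → 𝓞 K, w ≠ 0 ∧
      height (torusExp (Function.update 0 v (z n)) * g) (intVec w) < ε := by
  by_contra hcon
  rw [Filter.not_eventually] at hcon
  obtain ⟨R, hR⟩ := exists_bounded_representative (K := K) hε
  have hd : ∀ n, torusExp (Function.update 0 v (z n)) ∈ diagTorus (K := K) {v} := fun n =>
    torusExp_mem_diagTorus fun u hu => Function.update_of_ne (by simpa using hu) _ _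
  let d : ℕ → diagTorus (K := K) {v} := fun n => ⟨_, hd n⟩
  have hC : IsCompact ((fun d : diagTorus (K := K) {v} => (d : Grp K) • proj g) ⁻¹'
      (proj '' {g : Grp K | ∀ v i j, ‖g v i j‖ ≤ R})) :=
    h.isCompact_preimage ((isCompact_entries_le R).image QuotientGroup.continuous_mk)
  have hf : Continuous fun d : diagTorus (K := K) {v} =>
      ‖(d : Grp K) v 0 0‖ + ‖(d : Grp K) v 1 1‖ :=
    ((continuous_SL_iff.1 ((continuous_apply v).comp continuous_subtype_val) 0 0).norm).add
      ((continuous_SL_iff.1 ((continuous_apply v).comp continuous_subtype_val) 1 1).norm)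
  obtain ⟨B, hB⟩ := hC.bddAbove_image hf.continuousOn
  obtain ⟨n, hn, hnB⟩ := (hcon.and_eventually
    (hz.eventually (eventually_gt_atTop (Real.log (max B 1))))).exists
  push Not at hn
  obtain ⟨A, hA⟩ := hR _ hn
  have hmem : d n ∈ (fun d : diagTorus (K := K) {v} => (d : Grp K) • proj g) ⁻¹'
      (proj '' {g : Grp K | ∀ v i j, ‖g v i j‖ ≤ R}) :=
    ⟨_, hA, (proj_eq_iff.2 ⟨A, rfl⟩).symm⟩
  have h1 := hB ⟨d n, hmem, rfl⟩
  have h2 : ‖(d n : Grp K) v 0 0‖ = Real.exp (z n).re := by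
    simp [d]
  have h3 : ‖(d n : Grp K) v 1 1‖ = Real.exp (-(z n).re) := by
    simp [d]
  rw [← Real.exp_lt_exp, Real.exp_log (by positivity)] at hnB
  have h4 : Real.exp |(z n).re| ≤ Real.exp (z n).re + Real.exp (-(z n).re) := by
    rcases abs_choice (z n).re with h | h <;> rw [h] <;>
      linarith [Real.exp_pos (z n).re, Real.exp_pos (-(z n).re)]
  simp only [h2, h3] at h1
  linarith [le_max_left B 1]

/-- The height of an integral vector proportional to the integral vector `p` is not much smaller
than that of `p`. -/
lemma height_le_mul_of_det2_eq_zero (g : Grp K) {p w : Fin 2 → 𝓞 K} {j : Fin 2} (hp : p j ≠ 0)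
    (hw : w ≠ 0) (h : det2 p w = 0) :
    height g (intVec p) ≤ (∏ u : InfinitePlace K, u (p j : K) ^ u.mult) * height g (intVec w) := by
  have hp0 : p ≠ 0 := fun h => hp (by rw [h]; rfl)
  obtain ⟨a, ha⟩ := exists_eq_smul_of_det2_eq_zero (intVec_ne_zero hp0)
    (by rw [intVec_det2, h]; simp : det2 (intVec p) (intVec w) = 0)
  have ha0 : a ≠ 0 := by
    rintro rfl
    exact intVec_ne_zero hw (by rw [ha, zero_smul])
  have hwj : w j ≠ 0 := by
    intro h0
    have := congrFun ha j
    simp only [intVec, h0, map_zero, Pi.smul_apply, smul_eq_mul, zero_eq_mul] at this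
    exact this.elim ha0 (by exact_mod_cast hp)
  have h1 : 1 ≤ (∏ u : InfinitePlace K, u (p j : K) ^ u.mult) *
      ∏ u : InfinitePlace K, u a ^ u.mult := by
    refine (one_le_prod_place hwj).trans_eq ?_
    rw [← Finset.prod_mul_distrib]
    refine Finset.prod_congr rfl fun u _ => ?_
    rw [← mul_pow, ← map_mul, mul_comm]
    exact congrArg (fun x => u x ^ u.mult) (congrFun ha j)
  rw [ha, height_smul, ← mul_assoc]
  exact le_mul_of_one_le_left (height_nonneg _ _) h1

/-- The heights of a fixed vector are bounded below as long as only the component at `v` varies and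
the norm at `v` does not become small. -/
lemma exists_pos_le_height {g : Grp K} {v : InfinitePlace K} {p : Fin 2 → K} (hp : p ≠ 0) {b : ℝ}
    (hb : 0 < b) : ∃ c > 0, ∀ h : Grp K, (∀ u ≠ v, h u = g u) →
      b ≤ ‖(h v).1 *ᵥ vecAt K v p‖ → c ≤ height h p := by
  classical
  refine ⟨∏ u : InfinitePlace K, (if u = v then b else
    ‖(g u).1 *ᵥ vecAt K u p‖) ^ u.mult, Finset.prod_pos fun u _ => ?_, fun h hg hv => ?_⟩
  · refine pow_pos ?_ _
    split_ifs
    · exact hb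
    · exact norm_pos_iff.2 (SL_mulVec_ne_zero _ (vecAt_ne_zero hp))
  · refine Finset.prod_le_prod (fun u _ => ?_) fun u _ => ?_
    · split_ifs <;> positivity
    · by_cases huv : u = v
      · subst huv
        rw [if_pos rfl]
        exact pow_le_pow_left₀ hb.le hv _
      · rw [if_neg huv, hg u huv]

/-- If the orbit `D_v π(g)` is divergent, then the two coordinate lines of `K_v²` are mapped by
`g_v⁻¹` to lines defined over `K`. Along a ray of `D_v` a vector that is short at one time is
proportional to the one that is short at the next time, so a single rational line is contracted
along the whole ray. -/
theorem exists_rational_of_isDivergentOrbit {v : InfinitePlace K} {g : Grp K}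
    (h : IsDivergentOrbit (diagTorus {v}) (proj g)) (i : Fin 2) :
    ∃ p : Fin 2 → K, p ≠ 0 ∧ ((g v).1 *ᵥ vecAt K v p) (1 - i) = 0 := by
  classical
  -- `s` is the sign for which the coordinate `i` is contracted and `1 - i` is expanded
  let s : ℝ := if i = 0 then -1 else 1
  have hs : |s| = 1 := by simp only [s]; split_ifs <;> simp
  let z : ℕ → ℂ := fun n => ((s * n : ℝ) : ℂ)
  have hz : Tendsto (fun n => |(z n).re|) atTop atTop := by
    simp only [z, Complex.ofReal_re, abs_mul, hs, one_mul, Nat.abs_cast]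
    exact tendsto_natCast_atTop_atTop
  let d : ℕ → Grp K := fun n => torusExp (Function.update 0 v (z n)) * g
  have hexp : ∀ n (w : Fin 2 → K), ‖((g v).1 *ᵥ vecAt K v w) (1 - i)‖ ≤
      ‖(d n v).1 *ᵥ vecAt K v w‖ := by
    intro n w
    refine le_trans ?_ (norm_le_pi_norm _ (1 - i))
    have h1 : (d n v).1 *ᵥ vecAt K v w = (diagExp v (z n)).1 *ᵥ ((g v).1 *ᵥ vecAt K v w) := by
      rw [Matrix.mulVec_mulVec]
      simp only [d, Pi.mul_apply, torusExp_apply, Function.update_self]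
      rfl
    rw [h1]
    fin_cases i
    · refine le_trans ?_ (norm_diagExp_mulVec_one v _ _).ge
      refine le_mul_of_one_le_left (norm_nonneg _) (Real.one_le_exp ?_)
      simp [z, s]
    · refine le_trans ?_ (norm_diagExp_mulVec_zero v _ _).ge
      refine le_mul_of_one_le_left (norm_nonneg _) (Real.one_le_exp ?_)
      simp [z, s]
  -- the factor by which heights grow at most in one step of the sequence `d`
  set κ := ∏ u : InfinitePlace K,
    Real.exp |((Function.update (0 : InfinitePlace K → ℂ) v (s : ℂ)) u).re| ^ u.mult with hκ
  have hκ1 : 1 ≤ κ := by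
    rw [hκ, ← Finset.prod_const_one (s := (Finset.univ : Finset (InfinitePlace K)))]
    exact Finset.prod_le_prod (fun _ _ => zero_le_one) fun u _ =>
      one_le_pow₀ (Real.one_le_exp (abs_nonneg _))
  have hstep : ∀ n w, height (d (n + 1)) w ≤ κ * height (d n) w := by
    intro n w
    have h1 : d (n + 1) = torusExp (Function.update 0 v (s : ℂ)) * d n := by
      simp only [d]
      rw [← mul_assoc, ← torusExp_add, ← Function.update_add]
      congr 3
      · simp
      · simp only [z]; push_cast; ring
    rw [h1]
    exact height_torusExp_mul_le _ _ _
  set M := ∑ v : InfinitePlace K, v.mult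
  set ε : ℝ := 1 / (2 * 2 ^ M * κ) with hε
  have hε0 : 0 < ε := by positivity
  have h2M : (1 : ℝ) ≤ 2 ^ M := one_le_pow₀ (by norm_num)
  have hε1 : ε ≤ 1 := by
    rw [hε, div_le_one (by positivity)]
    nlinarith
  have hεκ : 2 ^ M * (κ * ε) < 1 := by
    rw [hε]; field_simp; norm_num
  obtain ⟨n₀, hn₀⟩ := eventually_atTop.1 (eventually_exists_height_lt h hz hε0)
  choose! w hw hwε using hn₀
  have hlt : ∀ a b : ℝ, 0 ≤ a → 0 ≤ b → a ≤ κ * ε → b ≤ 1 → 2 ^ M * (a * b) < 1 := by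
    intro a b ha hb h1 h2
    refine lt_of_le_of_lt ?_ hεκ
    have : a * b ≤ κ * ε * 1 := mul_le_mul h1 h2 hb (by positivity)
    rw [mul_one] at this
    gcongr
  -- all vectors of height less than `ε` are on the same line, by comparison of successive times
  have hpar : ∀ n ≥ n₀, det2 (w n₀) (w n) = 0 := by
    intro n hn
    induction n, hn using Nat.le_induction with
    | base => simp [det2, mul_comm]
    | succ n hn ih =>
      refine det2_eq_zero_trans (hw n hn) ih (det2_eq_zero_of_height_mul_lt (d (n + 1)) _ _ ?_)
      refine hlt _ _ (height_nonneg _ _) (height_nonneg _ _) ?_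
        ((hwε (n + 1) (by omega)).le.trans hε1)
      exact (hstep n _).trans (by gcongr; exact (hwε n hn).le)
  refine ⟨intVec (w n₀), intVec_ne_zero (hw n₀ le_rfl), ?_⟩
  -- otherwise the norm of `p` at `v` is bounded below along the ray, which contradicts the
  -- existence of arbitrarily short vectors on the line of `p`
  by_contra hb
  set p := w n₀ with hp
  have hp0 : p ≠ 0 := hw n₀ le_rfl
  obtain ⟨j, hj⟩ := Function.ne_iff.1 hp0
  obtain ⟨c, hc0, hc⟩ := exists_pos_le_height (g := g) (v := v) (intVec_ne_zero hp0)
    (norm_pos_iff.2 hb)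
  have hN : 0 < ∏ u : InfinitePlace K, u (p j : K) ^ u.mult :=
    zero_lt_one.trans_le (one_le_prod_place hj)
  have hmin : 0 < min 1 (c / ∏ u : InfinitePlace K, u (p j : K) ^ u.mult) :=
    lt_min one_pos (by positivity)
  obtain ⟨n, ⟨w', hw', hw'ε⟩, hn⟩ := ((eventually_exists_height_lt h hz hmin).and
    (eventually_ge_atTop n₀)).exists
  have hpar' : det2 p w' = 0 := by
    refine det2_eq_zero_trans (hw n hn) (hpar n hn)
      (det2_eq_zero_of_height_mul_lt (d n) _ _ ?_)
    refine hlt _ _ (height_nonneg _ _) (height_nonneg _ _) ?_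
      (hw'ε.le.trans (min_le_left _ _))
    exact (hwε n hn).le.trans (le_mul_of_one_le_left hε0.le hκ1)
  have h1 := hc (d n) (fun u hu => by simp [d, Function.update_of_ne hu]) (hexp n _)
  have h2 := height_le_mul_of_det2_eq_zero (d n) hj hw' hpar'
  have h3 := hw'ε.trans_le (min_le_right _ _)
  rw [lt_div_iff₀ hN, mul_comm] at h3
  exact absurd (h1.trans h2) (not_le.2 h3)

end Divergent

/-! ### Units -/

section Units

variable {K : Type*} [Field K] [NumberField K]

open NumberField.Units NumberField.Units.dirichletUnitTheorem

/-- Dirichlet's unit theorem: the logarithms of units are cocompact in the hyperplane of trace zero.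
The logarithmic embedding omits the place `w₀`, where the estimate follows from the others. -/
lemma exists_unit_log_near : ∃ C : ℝ, ∀ x : InfinitePlace K → ℝ,
    ∑ v : InfinitePlace K, (v.mult : ℝ) * x v = 0 →
    ∃ u : (𝓞 K)ˣ, ∀ v : InfinitePlace K, |x v - Real.log (v (u : K))| ≤ C := by
  classical
  let b := (basisUnitLattice K).ofZLatticeBasis ℝ (unitLattice K)
  set C₀ := ∑ i, ‖b i‖
  have hC₀ : 0 ≤ C₀ := Finset.sum_nonneg fun _ _ => norm_nonneg _
  refine ⟨C₀ + ∑ _w : {w : InfinitePlace K // w ≠ w₀}, C₀, fun x hx => ?_⟩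
  let y : logSpace K := fun w => (w.1.mult : ℝ) * x w.1
  have hmem : ((ZSpan.floor b y : Submodule.span ℤ (Set.range b)) : logSpace K) ∈
      unitLattice K := by
    rw [← (basisUnitLattice K).ofZLatticeBasis_span ℝ (unitLattice K)]
    exact (ZSpan.floor b y).2
  obtain ⟨u, -, hu⟩ := hmem
  have hu' : logEmbedding K u = (ZSpan.floor b y : logSpace K) := hu
  have hfr := ZSpan.norm_fract_le (K := ℝ) b y
  rw [ZSpan.fract_apply, ← hu'] at hfr
  have hw : ∀ w : {w : InfinitePlace K // w ≠ w₀},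
      |(w.1.mult : ℝ) * (x w.1 - Real.log (w.1 (u.toMul : K)))| ≤ C₀ := fun w => by
    have h := (norm_le_pi_norm _ w).trans hfr
    rw [Real.norm_eq_abs] at h
    rw [mul_sub]
    exact h
  have hm : ∀ v : InfinitePlace K, ∀ t B : ℝ, |(v.mult : ℝ) * t| ≤ B → |t| ≤ B := by
    intro v t B h
    rw [abs_mul, Nat.abs_cast] at h
    have : (1 : ℝ) ≤ v.mult := by exact_mod_cast v.mult_pos
    exact (le_mul_of_one_le_left (abs_nonneg t) this).trans h
  refine ⟨u.toMul, fun v => ?_⟩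
  by_cases hv : v = w₀
  · subst hv
    refine hm w₀ _ _ ?_
    have h1 : ∑ v : InfinitePlace K, (v.mult : ℝ) * (x v - Real.log (v (u.toMul : K))) = 0 := by
      simp only [mul_sub, Finset.sum_sub_distrib]
      rw [hx, sum_mult_mul_log, sub_zero]
    rw [Fintype.sum_eq_add_sum_subtype_ne _ w₀] at h1
    rw [eq_neg_of_add_eq_zero_left h1, abs_neg]
    refine (Finset.abs_sum_le_sum_abs _ _).trans ?_
    refine (Finset.sum_le_sum fun w _ => hw w).trans ?_
    linarith
  · refine (hm v _ _ (hw ⟨v, hv⟩)).trans ?_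
    have : 0 ≤ ∑ _w : {w : InfinitePlace K // w ≠ w₀}, C₀ := Finset.sum_nonneg fun _ _ => hC₀
    linarith

/-- A form of Dirichlet's unit theorem: the squares of units congruent to `1` modulo `m` form a
cocompact subgroup of the hyperplane of trace zero. -/
theorem exists_unit_sq_log_near {m : 𝓞 K} (hm : m ≠ 0) : ∃ C : ℝ, ∀ x : InfinitePlace K → ℝ,
    ∑ v : InfinitePlace K, (v.mult : ℝ) * x v = 0 →
    ∃ u : (𝓞 K)ˣ, m ∣ (u : 𝓞 K) - 1 ∧
      ∀ v : InfinitePlace K, |x v + Real.log (v ((u ^ 2 : (𝓞 K)ˣ) : K))| ≤ C := by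
  have hfin : Finite (𝓞 K ⧸ Ideal.span {m}) :=
    Ideal.finiteQuotientOfFreeOfNeBot _ (by simpa using hm)
  obtain ⟨C, hC⟩ := exists_unit_log_near (K := K)
  -- `e`-th powers of units are congruent to `1` modulo `m`
  set e := Nat.card (𝓞 K ⧸ Ideal.span {m})ˣ with he
  have he0 : 0 < e := Nat.card_pos
  have he' : (0 : ℝ) < 2 * e := by positivity
  refine ⟨2 * e * C, fun x hx => ?_⟩
  obtain ⟨u, hu⟩ := hC (fun v => x v / (2 * e)) (by
    simp only [← mul_div_assoc, ← Finset.sum_div, hx, zero_div])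
  refine ⟨u⁻¹ ^ e, ?_, fun v => ?_⟩
  · rw [← Ideal.mem_span_singleton, ← Ideal.Quotient.eq_zero_iff_mem, map_sub, map_one, sub_eq_zero]
    have h1 : (Units.map (Ideal.Quotient.mk (Ideal.span {m})).toMonoidHom u⁻¹) ^ e = 1 :=
      pow_card_eq_one'
    rw [← map_pow] at h1
    exact congrArg Units.val h1
  · have h1 : Real.log (v (((u⁻¹ ^ e) ^ 2 : (𝓞 K)ˣ) : K)) = -(2 * e) * Real.log (v (u : K)) := by
      have h2 : (((u⁻¹ ^ e) ^ 2 : (𝓞 K)ˣ) : K) = ((u : K)⁻¹) ^ (e * 2) := by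
        rw [← pow_mul]; simp
      rw [h2, map_pow, map_inv₀, Real.log_pow, Real.log_inv]
      push_cast; ring
    have h2 : x v + Real.log (v (((u⁻¹ ^ e) ^ 2 : (𝓞 K)ˣ) : K)) =
        (2 * e) * (x v / (2 * e) - Real.log (v (u : K))) := by
      rw [h1]; field_simp; ring
    rw [h2, abs_mul, abs_of_pos he']
    exact mul_le_mul_of_nonneg_left (hu v) he'.le

/-- Units that are small at `v₁`, large at `v₂` and close to `1` at all other places, and squares of
units congruent to `1` modulo `m`. They exist because units of size about `e^{-s}` at `v₁` and
bounded away from `v₁` and `v₂` have an accumulation point at the remaining places as `s` grows;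
quotients of two of them have the required properties. -/
theorem exists_seq_unit_sq {m : 𝓞 K} (hm : m ≠ 0) {v₁ v₂ : InfinitePlace K} (h12 : v₁ ≠ v₂) :
    ∃ u : ℕ → (𝓞 K)ˣ, (∀ n, m ∣ (u n : 𝓞 K) - 1) ∧
      Tendsto (fun n => v₁ ((u n ^ 2 : (𝓞 K)ˣ) : K)) atTop (𝓝 0) ∧
      Tendsto (fun n => v₂ ((u n ^ 2 : (𝓞 K)ˣ) : K)) atTop atTop ∧
      ∀ v, v ≠ v₁ → v ≠ v₂ →
        Tendsto (fun n => algebraMap K v.Completion ((u n ^ 2 : (𝓞 K)ˣ) : K)) atTop (𝓝 1) := by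
  classical
  obtain ⟨C, hC⟩ := exists_unit_sq_log_near hm
  have hm1 : (0 : ℝ) < v₁.mult := by exact_mod_cast v₁.mult_pos
  have hm2 : (0 : ℝ) < v₂.mult := by exact_mod_cast v₂.mult_pos
  let x : ℕ → InfinitePlace K → ℝ := fun s v =>
    if v = v₁ then s / v₁.mult else if v = v₂ then -(s / v₂.mult) else 0
  have hx : ∀ s, ∑ v : InfinitePlace K, (v.mult : ℝ) * x s v = 0 := by
    intro s
    rw [← Finset.sum_subset (Finset.subset_univ {v₁, v₂}) (fun v _ hv => ?_),
      Finset.sum_pair h12]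
    · simp only [x, if_true, if_neg h12.symm]
      field_simp
      ring
    · simp only [Finset.mem_insert, Finset.mem_singleton, not_or] at hv
      simp [x, hv.1, hv.2]
  choose u hum hu using fun s => hC (x s) (hx s)
  -- the squares of the units `u s` at the places other than `v₁` and `v₂`
  let a : ℕ → ∀ v : InfinitePlace K, v.Completion := fun s v =>
    if v = v₁ ∨ v = v₂ then 1 else algebraMap K v.Completion ((u s ^ 2 : (𝓞 K)ˣ) : K)
  have hpos : ∀ s (v : InfinitePlace K), 0 < v ((u s ^ 2 : (𝓞 K)ˣ) : K) := fun s v =>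
    pos_at_place _ v
  have hlog : ∀ s v, v ≠ v₁ → v ≠ v₂ → |Real.log (v ((u s ^ 2 : (𝓞 K)ˣ) : K))| ≤ C := by
    intro s v h1 h2
    have := hu s v
    simpa [x, h1, h2] using this
  have hC0 : 0 ≤ C := (abs_nonneg _).trans (hu 0 v₁)
  have ha : ∀ s v, ‖a s v‖ ∈ Set.Icc (Real.exp (-C)) (Real.exp C) := by
    intro s v
    simp only [a]
    split_ifs with h
    · rw [norm_one]
      exact ⟨Real.exp_le_one_iff.2 (by linarith), Real.one_le_exp hC0⟩
    · rw [not_or] at h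
      rw [norm_algebraMap_completion, ← Real.exp_log (hpos s v)]
      have := abs_le.1 (hlog s v h.1 h.2)
      exact ⟨Real.exp_le_exp.2 this.1, Real.exp_le_exp.2 this.2⟩
  obtain ⟨l, hl, φ, hφ, hlim⟩ := (isCompact_univ_pi fun v : InfinitePlace K =>
    isCompact_closedBall (0 : v.Completion) (Real.exp C)).tendsto_subseq (x := a)
      (fun s v _ => mem_closedBall_zero_iff.2 (ha s v).2)
  rw [tendsto_pi_nhds] at hlim
  have hl0 : ∀ v, l v ≠ 0 := fun v => by
    rw [← norm_pos_iff]
    exact (Real.exp_pos (-C)).trans_le (ge_of_tendsto' (hlim v).norm fun n => (ha _ v).1)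
  -- `φ (ψ n) - φ n → ∞`, so that the quotients `u (φ (ψ n)) / u (φ n)` are unbounded at `v₁`, `v₂`
  let ψ : ℕ → ℕ := fun n => φ n + n
  have hψ : Tendsto ψ atTop atTop := tendsto_atTop_mono (fun n => Nat.le_add_left n _) tendsto_id
  have hψn : ∀ n, φ n + n ≤ φ (ψ n) := fun n => hφ.id_le (ψ n)
  have hval : ∀ n, (((u (φ (ψ n)) * (u (φ n))⁻¹) ^ 2 : (𝓞 K)ˣ) : K) =
      ((u (φ (ψ n)) ^ 2 : (𝓞 K)ˣ) : K) / ((u (φ n) ^ 2 : (𝓞 K)ˣ) : K) := fun n => by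
    simp [mul_pow, div_eq_mul_inv]
  have hlogdiv : ∀ n (v : InfinitePlace K),
      Real.log (v (((u (φ (ψ n)) * (u (φ n))⁻¹) ^ 2 : (𝓞 K)ˣ) : K)) =
      Real.log (v ((u (φ (ψ n)) ^ 2 : (𝓞 K)ˣ) : K)) -
        Real.log (v ((u (φ n) ^ 2 : (𝓞 K)ˣ) : K)) := fun n v => by
    rw [hval, map_div₀, Real.log_div (hpos _ v).ne' (hpos _ v).ne']
  have hgap : ∀ n : ℕ, (n : ℝ) ≤ (φ (ψ n) : ℝ) - φ n := fun n => by
    have : ((φ n + n : ℕ) : ℝ) ≤ φ (ψ n) := by exact_mod_cast hψn n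
    push_cast at this
    linarith
  have hlin : ∀ c : ℝ, 0 < c → Tendsto (fun n : ℕ => (n : ℝ) / c - 2 * C) atTop atTop := fun c hc =>
    tendsto_atTop_add_const_right _ _ (tendsto_natCast_atTop_atTop.atTop_div_const hc)
  refine ⟨fun n => u (φ (ψ n)) * (u (φ n))⁻¹, fun n => ?_, ?_, ?_, fun v h1 h2 => ?_⟩
  · have h1 : ((u (φ (ψ n)) * (u (φ n))⁻¹ : (𝓞 K)ˣ) : 𝓞 K) - 1 =
        (((u (φ (ψ n)) : 𝓞 K) - 1) - ((u (φ n) : 𝓞 K) - 1)) * ((u (φ n))⁻¹ : (𝓞 K)ˣ) := by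
      have := (u (φ n)).mul_inv
      push_cast
      linear_combination this
    rw [h1]
    exact ((hum _).sub (hum _)).mul_right _
  · have h3 : Tendsto (fun n => Real.log (v₁ (((u (φ (ψ n)) * (u (φ n))⁻¹) ^ 2 : (𝓞 K)ˣ) : K)))
        atTop atBot := by
      rw [← tendsto_neg_atTop_iff]
      refine tendsto_atTop_mono (fun n => ?_) (hlin _ hm1)
      have h4 := abs_le.1 (hu (φ (ψ n)) v₁)
      have h5 := abs_le.1 (hu (φ n) v₁)
      have h6 := div_le_div_of_nonneg_right (hgap n) hm1.le
      rw [sub_div] at h6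
      simp only [x, if_true] at h4 h5
      rw [hlogdiv]
      linarith [h4.2, h5.1]
    refine (Real.tendsto_exp_atBot.comp h3).congr fun n => ?_
    exact Real.exp_log (pos_at_place _ _)
  · have h3 : Tendsto (fun n => Real.log (v₂ (((u (φ (ψ n)) * (u (φ n))⁻¹) ^ 2 : (𝓞 K)ˣ) : K)))
        atTop atTop := by
      refine tendsto_atTop_mono (fun n => ?_) (hlin _ hm2)
      have h4 := abs_le.1 (hu (φ (ψ n)) v₂)
      have h5 := abs_le.1 (hu (φ n) v₂)
      have h6 := div_le_div_of_nonneg_right (hgap n) hm2.le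
      rw [sub_div] at h6
      simp only [x, if_true, if_neg h12.symm] at h4 h5
      rw [hlogdiv]
      linarith [h4.1, h5.2]
    refine (Real.tendsto_exp_atTop.comp h3).congr fun n => ?_
    exact Real.exp_log (pos_at_place _ _)
  · have h3 := ((hlim v).comp hψ).div (hlim v) (hl0 v)
    rw [div_self (hl0 v)] at h3
    refine h3.congr fun n => ?_
    simp only [Pi.div_apply, Function.comp_apply, a, h1, h2, or_self, if_false]
    rw [hval, map_div₀]

end Units

/-! ### Closed subgroups of vector spaces and of the torus `D` -/

section ClosedSubgroup

variable {V : Type*} [NormedAddCommGroup V] [NormedSpace ℝ V]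

/-- The largest linear subspace contained in a subgroup `H` of a real vector space. -/
def linearPart (H : AddSubgroup V) : Submodule ℝ V where
  carrier := {x | ∀ t : ℝ, t • x ∈ H}
  add_mem' hx hy t := by rw [smul_add]; exact H.add_mem (hx t) (hy t)
  zero_mem' t := by rw [smul_zero]; exact H.zero_mem
  smul_mem' c x hx t := by rw [smul_smul]; exact hx _

lemma mem_linearPart {H : AddSubgroup V} {x : V} :
    x ∈ linearPart H ↔ ∀ t : ℝ, t • x ∈ H := Iff.rfl

/-- If non-zero elements `y n` of a closed subgroup tend to `0` and their directions converge, then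
the limit direction spans a line inside the subgroup. -/
lemma mem_linearPart_of_tendsto {H : AddSubgroup V} (hH : IsClosed (H : Set V)) {y : ℕ → V}
    (hy : ∀ n, y n ∈ H) (hy0 : ∀ n, y n ≠ 0) (hlim : Tendsto y atTop (𝓝 0)) {u : V}
    (hu : Tendsto (fun n => ‖y n‖⁻¹ • y n) atTop (𝓝 u)) : u ∈ linearPart H := by
  intro t
  have hnorm : Tendsto (fun n => ‖y n‖) atTop (𝓝 0) := by simpa using hlim.norm
  have hfl : Tendsto (fun n => (⌊t / ‖y n‖⌋ : ℝ) * ‖y n‖) atTop (𝓝 t) := by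
    rw [tendsto_iff_norm_sub_tendsto_zero]
    refine squeeze_zero (fun n => norm_nonneg _) (fun n => ?_) hnorm
    have hp : 0 < ‖y n‖ := norm_pos_iff.2 (hy0 n)
    have h1 := Int.floor_le (t / ‖y n‖)
    have h2 := Int.lt_floor_add_one (t / ‖y n‖)
    rw [le_div_iff₀ hp] at h1
    rw [div_lt_iff₀ hp] at h2
    rw [Real.norm_eq_abs, abs_le]
    constructor <;> linarith
  have hmem : ∀ n, ((⌊t / ‖y n‖⌋ : ℝ) * ‖y n‖) • (‖y n‖⁻¹ • y n) ∈ H := fun n => by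
    rw [smul_smul, mul_assoc, mul_inv_cancel₀ (norm_ne_zero_iff.2 (hy0 n)), mul_one,
      Int.cast_smul_eq_zsmul]
    exact H.zsmul_mem (hy n) _
  exact hH.mem_of_tendsto (hfl.smul hu) (Eventually.of_forall hmem)

/-- The linear part of a closed subgroup of `ℝⁿ` is open in it. -/
theorem exists_forall_norm_lt_mem_linearPart [FiniteDimensional ℝ V] {H : AddSubgroup V}
    (hH : IsClosed (H : Set V)) : ∃ ε > 0, ∀ x ∈ H, ‖x‖ < ε → x ∈ linearPart H := by
  by_contra! hcon
  set W := linearPart H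
  obtain ⟨W', hW'⟩ := W.exists_isCompl
  have hcon' : ∀ n : ℕ, ∃ x ∈ H, ‖x‖ < 1 / ((n : ℝ) + 1) ∧ x ∉ W := fun n =>
    hcon _ Nat.one_div_pos_of_nat
  choose x hxH hxn hxW using hcon'
  -- the projection onto a complement of `W`; it maps `H` to `H`, and a limit of directions of the
  -- elements `P (x n)` would lie both in `W'` and in `W`
  let P : V →ₗ[ℝ] V := W'.subtype ∘ₗ Submodule.projectionOnto W' W hW'.symm
  have hP : ∀ z, P z ∈ W' := fun z => Subtype.property _
  have hPW : ∀ z, z - P z ∈ W := fun z => by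
    have h := Submodule.projectionOnto_apply_left hW'.symm
      (Submodule.projectionOnto W' W hW'.symm z)
    rw [← Submodule.projectionOnto_apply_eq_zero_iff hW'.symm, map_sub, sub_eq_zero]
    exact h.symm
  have hWH : ∀ z ∈ W, z ∈ H := fun z hz => by simpa using hz 1
  have hx0 : Tendsto x atTop (𝓝 0) := by
    rw [tendsto_zero_iff_norm_tendsto_zero]
    exact squeeze_zero (fun n => norm_nonneg _) (fun n => (hxn n).le)
      tendsto_one_div_add_atTop_nhds_zero_nat
  have hyH : ∀ n, P (x n) ∈ H := fun n => by
    have := H.sub_mem (hxH n) (hWH _ (hPW (x n)))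
    rwa [sub_sub_cancel] at this
  have hy0 : ∀ n, P (x n) ≠ 0 := fun n h => hxW n (by have := hPW (x n); rwa [h, sub_zero] at this)
  have hyl : Tendsto (fun n => P (x n)) atTop (𝓝 0) := by
    have := (P.continuous_of_finiteDimensional.tendsto 0).comp hx0
    rwa [map_zero] at this
  have : ProperSpace V := FiniteDimensional.proper ℝ V
  obtain ⟨u, hu, φ, hφ, hlim⟩ := (isCompact_sphere (0 : V) 1).tendsto_subseq
    (x := fun n => ‖P (x n)‖⁻¹ • P (x n)) (fun n => by
      rw [mem_sphere_zero_iff_norm, norm_smul, norm_inv, norm_norm,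
        inv_mul_cancel₀ (norm_ne_zero_iff.2 (hy0 n))])
  have huW : u ∈ W := mem_linearPart_of_tendsto hH (fun n => hyH (φ n)) (fun n => hy0 (φ n))
    (hyl.comp hφ.tendsto_atTop) hlim
  have huW' : u ∈ W' := (W'.closed_of_finiteDimensional).mem_of_tendsto hlim
    (Eventually.of_forall fun n => W'.smul_mem _ (hP _))
  have hu0 : u = 0 := by
    have : u ∈ W ⊓ W' := ⟨huW, huW'⟩
    rwa [hW'.inf_eq_bot] at this
  rw [hu0] at hu
  simp at hu

end ClosedSubgroup

section Torus

variable {K : Type*} [Field K]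

lemma continuous_entry (v : InfinitePlace K) (i j : Fin 2) : Continuous fun g : Grp K => g v i j :=
  continuous_SL_iff.1 (continuous_apply v) i j

lemma mul_eq_one_of_mem_diagTorus {I : Finset (InfinitePlace K)} {d : Grp K}
    (hd : d ∈ diagTorus I) (v : InfinitePlace K) : d v 0 0 * d v 1 1 = 1 := by
  obtain ⟨z, -, rfl⟩ := mem_diagTorus_iff.1 hd
  exact expAt_mul_neg v _

lemma diagTorus_commute {I J : Finset (InfinitePlace K)} {d e : Grp K} (hd : d ∈ diagTorus I)
    (he : e ∈ diagTorus J) : d * e = e * d := by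
  obtain ⟨z, -, rfl⟩ := mem_diagTorus_iff.1 hd
  obtain ⟨w, -, rfl⟩ := mem_diagTorus_iff.1 he
  rw [← torusExp_add, ← torusExp_add, add_comm]

variable [NumberField K]

/-- Elements of `D_I` with bounded entries accumulate in `D_I`. The logarithms are bounded too,
as their imaginary parts may be taken in `[-π, π]`. -/
lemma exists_tendsto_of_norm_bounded {ι : Type*} {U : Ultrafilter ι} {I : Finset (InfinitePlace K)}
    {d : ι → Grp K} (hd : ∀ n, d n ∈ diagTorus I) {R : InfinitePlace K → ℝ}
    (h : ∀ v ∈ I, ∀ᶠ n in U, |Real.log ‖d n v 0 0‖| ≤ R v) :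
    ∃ d' ∈ diagTorus I, Tendsto d U (𝓝 d') := by
  choose z hz hzd hzπ using fun n => exists_torusExp_eq_of_mem (hd n)
  have hre : ∀ n v, Real.log ‖d n v 0 0‖ = (z n v).re := fun n v => by
    rw [← hzd n, torusExp_apply, diagExp_apply_zero_zero, norm_expAt, Real.log_exp]
  have hc : IsCompact (Set.univ.pi fun v : InfinitePlace K =>
      Metric.closedBall (0 : ℂ) (|R v| + Real.pi)) :=
    isCompact_univ_pi fun v => isCompact_closedBall _ _
  have hmem : ∀ᶠ n in U, z n ∈ Set.univ.pi fun v : InfinitePlace K =>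
      Metric.closedBall (0 : ℂ) (|R v| + Real.pi) := by
    have : ∀ v, ∀ᶠ n in U, z n v ∈ Metric.closedBall (0 : ℂ) (|R v| + Real.pi) := fun v => by
      by_cases hv : v ∈ I
      · filter_upwards [h v hv] with n hn
        rw [mem_closedBall_zero_iff]
        refine (Complex.norm_le_abs_re_add_abs_im _).trans ?_
        rw [← hre]
        exact add_le_add (hn.trans (le_abs_self _)) (hzπ n v)
      · refine Eventually.of_forall fun n => ?_
        rw [hz n v hv]
        simpa using by positivity
    filter_upwards [eventually_all.2 this] with n hn v _ using hn v
  obtain ⟨z₀, -, hz₀⟩ := hc.ultrafilter_le_nhds' (U.map z) hmem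
  have hz₀' : Tendsto z U (𝓝 z₀) := hz₀
  refine ⟨torusExp z₀, torusExp_mem_diagTorus fun v hv => ?_, ?_⟩
  · refine tendsto_nhds_unique ((tendsto_pi_nhds.1 hz₀') v) ?_
    simp only [hz _ v hv]
    exact tendsto_const_nhds
  · refine ((continuous_torusExp.tendsto z₀).comp hz₀').congr fun n => hzd n

lemma isClosed_diagTorus (I : Finset (InfinitePlace K)) : IsClosed (diagTorus I : Set (Grp K)) := by
  rw [isClosed_iff_clusterPt]
  intro g hg
  obtain ⟨U, hU, hUg⟩ := (clusterPt_iff_ultrafilter).1 hg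
  have hU' : (diagTorus I : Set (Grp K)) ∈ U := by simpa using hU
  classical
  let d : Grp K → Grp K := fun g => if g ∈ diagTorus I then g else 1
  have hd : ∀ g, d g ∈ diagTorus I := fun g => by
    simp only [d]; split_ifs with h; exacts [h, one_mem _]
  have hdU : d =ᶠ[U] id := by
    filter_upwards [hU'] with g hg using if_pos hg
  have hdg : Tendsto d U (𝓝 g) := (tendsto_id'.2 hUg).congr' hdU.symm
  have hent : ∀ v i, Tendsto (fun n => d n v i i) U (𝓝 (g v i i)) := fun v i =>
    ((continuous_entry v i i).tendsto g).comp hdg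
  have hne : ∀ v, g v 0 0 ≠ 0 := fun v h0 => by
    have h1 := (hent v 0).mul (hent v 1)
    simp only [mul_eq_one_of_mem_diagTorus (hd _), h0, zero_mul] at h1
    exact one_ne_zero (tendsto_nhds_unique tendsto_const_nhds h1)
  obtain ⟨d', hd', hlim⟩ := exists_tendsto_of_norm_bounded (U := U) hd
    (R := fun v => |Real.log ‖g v 0 0‖| + 1) fun v _ => by
      have h1 : Tendsto (fun n => |Real.log ‖d n v 0 0‖|) U (𝓝 |Real.log ‖g v 0 0‖|) :=
        ((hent v 0).norm.log (norm_ne_zero_iff.2 (hne v))).abs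
      exact (h1.eventually (gt_mem_nhds (lt_add_one _))).mono fun _ => le_of_lt
  rw [tendsto_nhds_unique hdg hlim]
  exact hd'

/-- Elements of `D` near the identity have small logarithms. -/
lemma eventually_exists_torusExp_eq {ε : ℝ} (hε : 0 < ε) : ∀ᶠ g in 𝓝 (1 : Grp K),
    g ∈ diagTorus Finset.univ → ∃ z : InfinitePlace K → ℂ, ‖z‖ < ε ∧ torusExp z = g := by
  have hent : ∀ v, Tendsto (fun g : Grp K => g v 0 0) (𝓝 1) (𝓝 1) := fun v => by
    simpa using (continuous_entry v 0 0).tendsto 1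
  have h1 : ∀ v, ∀ᶠ g : Grp K in 𝓝 1, expAt v (logAt v (g v 0 0)) = g v 0 0 := fun v =>
    (hent v).eventually (eventually_expAt_logAt v)
  have h2 : ∀ v, ∀ᶠ g : Grp K in 𝓝 1, ‖logAt v (g v 0 0)‖ < ε := fun v => by
    have h3 := ((continuousAt_logAt v).tendsto.comp (hent v)).norm
    rw [logAt_one, norm_zero] at h3
    exact h3.eventually (gt_mem_nhds hε)
  filter_upwards [eventually_all.2 h1, eventually_all.2 h2] with g hg hg' hgD
  refine ⟨fun v => logAt v (g v 0 0), (pi_norm_lt_iff hε).2 hg', ?_⟩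
  obtain ⟨z, -, rfl⟩ := mem_diagTorus_iff.1 hgD
  funext v
  refine Matrix.SpecialLinearGroup.ext _ _ fun i j => ?_
  have := hg v
  fin_cases i <;> fin_cases j
  · exact this
  · rfl
  · rfl
  · change expAt v (-_) = expAt v (-z v)
    rw [expAt_neg, this, expAt_neg]; rfl

end Torus

/-! ### Orbits through rational points -/

section Recurrence

variable {K : Type*} [Field K]

lemma tendsto_SL_iff {ι R : Type*} [CommRing R] [TopologicalSpace R] [IsTopologicalRing R]
    [T1Space R] {F : Filter ι} {f : ι → SL(2, R)} {A : SL(2, R)} :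
    Tendsto f F (𝓝 A) ↔ ∀ i j, Tendsto (fun n => f n i j) F (𝓝 (A i j)) :=
  Matrix.SpecialLinearGroup.isClosedEmbedding_val.isEmbedding.tendsto_nhds_iff.trans
    (tendsto_pi_nhds.trans (forall_congr' fun _ => tendsto_pi_nhds))

/-- The diagonal matrix with entries `u²` and `u⁻²`, for a unit `u`. The square makes it lie in
`D`, whose components at the real places are positive. -/
def sqDiag (u : (𝓞 K)ˣ) : SL(2, K) :=
  ⟨!![((u ^ 2 : (𝓞 K)ˣ) : K), 0; 0, (((u ^ 2)⁻¹ : (𝓞 K)ˣ) : K)], by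
    rw [Matrix.det_fin_two_of, mul_zero, sub_zero, ← map_mul, ← Units.val_mul, mul_inv_cancel]
    simp⟩

lemma emb_sqDiag_apply (u : (𝓞 K)ˣ) (v : InfinitePlace K) :
    ∃ z, diagExp v z = emb (sqDiag u) v := by
  have hu : algebraMap K v.Completion (u : K) ≠ 0 := by simp [-Completion.algebraMap_apply]
  obtain ⟨z, hz⟩ := exists_expAt_eq_sq v hu
  refine ⟨z, Matrix.SpecialLinearGroup.ext _ _ fun i j => ?_⟩
  fin_cases i <;> fin_cases j
  · change expAt v z = algebraMap K v.Completion ((u ^ 2 : (𝓞 K)ˣ) : K)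
    rw [hz, ← map_pow]
    simp [-Completion.algebraMap_apply]
  · exact (map_zero (algebraMap K v.Completion)).symm
  · exact (map_zero (algebraMap K v.Completion)).symm
  · change expAt v (-z) = algebraMap K v.Completion (((u ^ 2)⁻¹ : (𝓞 K)ˣ) : K)
    rw [expAt_neg, hz, ← map_pow, ← map_inv₀]
    simp [-Completion.algebraMap_apply]

/-- Units congruent to `1` modulo a suitable `m` give diagonal matrices in `A SL(2, 𝓞) A⁻¹`. -/
lemma exists_modulus [NumberField K] (A : SL(2, K)) : ∃ m : 𝓞 K, m ≠ 0 ∧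
    ∀ u : (𝓞 K)ˣ, m ∣ (u : 𝓞 K) - 1 → emb (sqDiag u) • proj (emb A) = proj (emb A) := by
  obtain ⟨n, hn⟩ := IsLocalization.exist_integer_multiples_of_finite (nonZeroDivisors (𝓞 K))
    (fun p : Fin 2 × Fin 2 => A p.1 p.2)
  choose a ha using hn
  have ha' : ∀ i j, (a (i, j) : K) = (n : 𝓞 K) * A i j := fun i j => ha (i, j)
  have hn0 : (n : 𝓞 K) ≠ 0 := nonZeroDivisors.coe_ne_zero n
  refine ⟨(n : 𝓞 K) ^ 2, pow_ne_zero _ hn0, fun u hu => ?_⟩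
  set c : 𝓞 K := ((u ^ 2 : (𝓞 K)ˣ) : 𝓞 K) with hc
  set e : 𝓞 K := (((u ^ 2)⁻¹ : (𝓞 K)ˣ) : 𝓞 K) with he
  have hce : c * e = 1 := by rw [hc, he, ← Units.val_mul, mul_inv_cancel]; rfl
  obtain ⟨t, ht⟩ : (n : 𝓞 K) ^ 2 ∣ c - e := by
    have h1 : c - e = ((u : 𝓞 K) - 1) * (((u : 𝓞 K) + 1) * ((u : 𝓞 K) ^ 2 + 1) * e) := by
      have h2 : c = (u : 𝓞 K) ^ 2 := by rw [hc]; rfl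
      rw [h2] at hce ⊢
      linear_combination (-(u : 𝓞 K) ^ 2) * hce
    rw [h1]
    exact hu.mul_right _
  have hdet : A 0 0 * A 1 1 - A 0 1 * A 1 0 = 1 := by
    have := A.2; rwa [Matrix.det_fin_two] at this
  have htK : (c : K) - (e : K) = ((n : 𝓞 K) : K) ^ 2 * (t : K) := by
    rw [← map_pow, ← map_mul, ← ht, map_sub]
  -- `A⁻¹ diag(c, e) A`, which is integral because `n²` divides `c - e` and `n A` is integral
  let B : Matrix (Fin 2) (Fin 2) (𝓞 K) :=
    !![c + t * a (0, 1) * a (1, 0), t * a (0, 1) * a (1, 1);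
      -(t * a (0, 0) * a (1, 0)), e - t * a (0, 1) * a (1, 0)]
  have hBA : (sqDiag u).1 * A.1 = A.1 * B.map (algebraMap (𝓞 K) K) := by
    ext i j
    have e1 : ∀ i j, (algebraMap (𝓞 K) K) (a (i, j)) = (n : 𝓞 K) * A i j := ha'
    fin_cases i <;> fin_cases j <;>
      simp [Matrix.mul_apply, Fin.sum_univ_two, B, e1, sqDiag, -Units.val_pow_eq_pow_val,
        -map_units_inv, ← hc, ← he]
    · ring
    · linear_combination A 0 1 * htK - ((n : 𝓞 K) : K) ^ 2 * (t : K) * A 0 1 * hdet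
    · linear_combination -A 1 0 * htK + ((n : 𝓞 K) : K) ^ 2 * (t : K) * A 1 0 * hdet
    · ring
  have hBdet : B.det = 1 := by
    have h := congrArg Matrix.det hBA
    rw [Matrix.det_mul, Matrix.det_mul, (sqDiag u).2, A.2, one_mul, one_mul] at h
    have h2 : (B.map (algebraMap (𝓞 K) K)).det = algebraMap (𝓞 K) K B.det :=
      ((algebraMap (𝓞 K) K).map_det B).symm
    rw [h2] at h
    exact RingOfIntegers.coe_injective (by rw [← h, map_one])
  have hfin : sqDiag u * A = A * intSL ⟨B, hBdet⟩ := Subtype.ext hBA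
  change proj (emb (sqDiag u) * emb A) = _
  rw [← map_mul, hfin, map_mul]
  exact (proj_eq_iff.2 ⟨_, rfl⟩).symm

/-- Recurrence: the point `π(A)`, `A ∈ SL(2, K)`, returns to itself under elements of `D_{v₁,v₂}`
that contract the first coordinate at `v₁` and the second one at `v₂`. -/
theorem exists_recurrence [NumberField K] (A : SL(2, K)) {v₁ v₂ : InfinitePlace K} (h12 : v₁ ≠ v₂)
    {I : Finset (InfinitePlace K)} (hI : ∀ v, v ∈ I ↔ v = v₁ ∨ v = v₂) :
    ∃ δ : ℕ → Grp K, (∀ n, δ n ∈ diagTorus I) ∧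
      Tendsto (fun n => δ n • proj (emb A)) atTop (𝓝 (proj (emb A))) ∧
      Tendsto (fun n => ‖δ n v₁ 0 0‖) atTop (𝓝 0) ∧
      Tendsto (fun n => ‖δ n v₂ 1 1‖) atTop (𝓝 0) := by
  classical
  obtain ⟨m, hm, hmA⟩ := exists_modulus A
  obtain ⟨u, hum, hu1, hu2, hu⟩ := exists_seq_unit_sq hm h12
  -- the components in `I` of a unit that fixes `π(A)`; its other components, the inverses
  -- of those of `ρ`, tend to `1`
  let δ : ℕ → Grp K := fun n v => if v ∈ I then emb (sqDiag (u n)) v else 1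
  let ρ : ℕ → Grp K := fun n v => if v ∈ I then 1 else (emb (sqDiag (u n)) v)⁻¹
  have hδρ : ∀ n, δ n = ρ n * emb (sqDiag (u n)) := fun n => by
    funext v
    simp only [δ, ρ, Pi.mul_apply]
    split_ifs <;> simp
  have hρ : Tendsto ρ atTop (𝓝 1) := by
    rw [tendsto_pi_nhds]
    intro v
    by_cases hv : v ∈ I
    · simp only [ρ, if_pos hv]; exact tendsto_const_nhds
    · simp only [ρ, if_neg hv]
      rw [hI, not_or] at hv
      have h1 := hu v hv.1 hv.2
      have h2 : Tendsto (fun n => emb (sqDiag (u n)) v) atTop (𝓝 1) := by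
        rw [tendsto_SL_iff]
        intro i j
        fin_cases i <;> fin_cases j
        · exact h1
        · exact tendsto_const_nhds.congr fun n => (map_zero (algebraMap K v.Completion)).symm
        · exact tendsto_const_nhds.congr fun n => (map_zero (algebraMap K v.Completion)).symm
        · have h3 := h1.inv₀ one_ne_zero
          rw [inv_one] at h3
          refine h3.congr fun n => ?_
          rw [← map_inv₀]
          change _ = algebraMap K v.Completion (((u n ^ 2)⁻¹ : (𝓞 K)ˣ) : K)
          simp [-Completion.algebraMap_apply]
      simpa using h2.inv
  refine ⟨δ, fun n => ⟨fun v hv => ?_, fun v hv => if_neg hv⟩, ?_, ?_, ?_⟩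
  · simp only [δ, if_pos hv]
    exact (mem_diagComponent_iff v).2 (emb_sqDiag_apply _ _)
  · have h1 : Tendsto (fun n => ρ n • proj (emb A)) atTop (𝓝 ((1 : Grp K) • proj (emb A))) :=
      hρ.smul_const _
    rw [one_smul] at h1
    refine h1.congr fun n => ?_
    rw [hδρ, mul_smul, hmA _ (hum n)]
  · refine hu1.congr fun n => ?_
    simp only [δ, if_pos ((hI v₁).2 (Or.inl rfl))]
    exact (norm_algebraMap_completion v₁ _).symm
  · refine hu2.inv_tendsto_atTop.congr fun n => ?_
    simp only [δ, if_pos ((hI v₂).2 (Or.inr rfl))]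
    change (v₂ ((u n ^ 2 : (𝓞 K)ˣ) : K))⁻¹ =
      ‖algebraMap K v₂.Completion (((u n ^ 2)⁻¹ : (𝓞 K)ˣ) : K)‖
    rw [norm_algebraMap_completion, ← map_inv₀]
    simp

end Recurrence

section Closure

variable {K : Type*} [Field K]

lemma vecAt_single (v : InfinitePlace K) (c : Fin 2) :
    vecAt K v (Pi.single c 1) = Pi.single c 1 := by
  ext i : 1
  by_cases h : i = c
  · subst h; simp [vecAt, -Completion.algebraMap_apply]
  · simp [vecAt, h, -Completion.algebraMap_apply]

variable [NumberField K]

/-- The vector `A⁻¹ e_c` is an eigenvector of `A⁻¹ d A`. -/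
lemma height_mul_mem_diagTorus {I : Finset (InfinitePlace K)} {d : Grp K} (hd : d ∈ diagTorus I)
    (k : Grp K) (A : SL(2, K)) (c : Fin 2) :
    height (k * d * emb A) ((A⁻¹).1 *ᵥ Pi.single c 1) =
      (∏ v, ‖d v c c‖ ^ v.mult) * height k (Pi.single c 1) := by
  rw [height_mul_emb, Matrix.mulVec_mulVec,
    show A.1 * (A⁻¹).1 = 1 from congrArg Subtype.val (mul_inv_cancel A), Matrix.one_mulVec,
    height, height, ← Finset.prod_mul_distrib]
  refine Finset.prod_congr rfl fun v _ => ?_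
  obtain ⟨z, -, rfl⟩ := mem_diagTorus_iff.1 hd
  have h : ((torusExp z) v).1 *ᵥ Pi.single c 1 =
      (torusExp z v c c) • (Pi.single c 1 : Fin 2 → v.Completion) := by
    ext i : 1
    fin_cases i <;> fin_cases c <;> simp
  have h2 : ((k * torusExp z) v).1 = (k v).1 * ((torusExp z) v).1 := rfl
  rw [vecAt_single, h2, ← Matrix.mulVec_mulVec, h, Matrix.mulVec_smul, norm_smul, mul_pow]

lemma height_mem_diagTorus {I : Finset (InfinitePlace K)} {d : Grp K} (hd : d ∈ diagTorus I)
    (A : SL(2, K)) (c : Fin 2) :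
    height (d * emb A) ((A⁻¹).1 *ᵥ Pi.single c 1) = ∏ v, ‖d v c c‖ ^ v.mult := by
  have h1 : height (1 : Grp K) (Pi.single c 1) = 1 := Finset.prod_eq_one fun v _ => by
    rw [show ((1 : Grp K) v).1 = 1 from rfl, Matrix.one_mulVec, vecAt_single, Pi.norm_single,
      norm_one, one_pow]
  rw [← one_mul d, height_mul_mem_diagTorus hd, h1, mul_one, one_mul]

lemma single_one_ne_zero (c : Fin 2) : (Pi.single c 1 : Fin 2 → K) ≠ 0 := by
  intro h
  have := congrFun h c
  simp at this

/-- The orbit `D π(A)`, `A ∈ SL(2, K)`, is closed: modulo diagonal matrices attached to units, which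
fix `π(A)`, a path in `D` whose image in `G / Γ` converges is relatively compact. The product of the
norms of its first diagonal entries is bounded because heights are bounded below; the individual
norms become bounded after multiplication by units. -/
lemma exists_correction (A : SL(2, K)) {ι : Type*} {U : Ultrafilter ι} {d : ι → Grp K}
    (hd : ∀ n, d n ∈ diagTorus Finset.univ) {y : Space K}
    (hy : Tendsto (fun n => d n • proj (emb A)) U (𝓝 y)) :
    ∃ e : ι → Grp K, (∀ n, e n ∈ diagTorus Finset.univ) ∧
      (∀ n, e n • proj (emb A) = proj (emb A)) ∧
      ∃ d', Tendsto (fun n => d n * e n) U (𝓝 d') := by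
  obtain ⟨m, hm, hmA⟩ := exists_modulus A
  obtain ⟨C, hC⟩ := exists_unit_sq_log_near hm
  have hw : ∀ c : Fin 2, ((A⁻¹).1 *ᵥ Pi.single c 1 : Fin 2 → K) ≠ 0 := fun c =>
    SL_mulVec_ne_zero _ (single_one_ne_zero c)
  obtain ⟨c₀, hc₀, h0⟩ := exists_eventually_le_height y (hw 0)
  obtain ⟨c₁, hc₁, h1⟩ := exists_eventually_le_height y (hw 1)
  have hpos : ∀ n v, 0 < ‖d n v 0 0‖ := fun n v => norm_pos_iff.2 fun h => by
    have := mul_eq_one_of_mem_diagTorus (hd n) v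
    rw [h, zero_mul] at this
    exact zero_ne_one this
  have hinv : ∀ n v, ‖d n v 1 1‖ = ‖d n v 0 0‖⁻¹ := fun n v => by
    refine eq_inv_of_mul_eq_one_right ?_
    rw [← norm_mul, mul_eq_one_of_mem_diagTorus (hd n), norm_one]
  set M : ℝ := ∑ v : InfinitePlace K, (v.mult : ℝ) with hM
  have hM1 : 1 ≤ M := by
    rw [hM, ← Nat.cast_sum]; exact_mod_cast sum_mult_pos
  let S : ι → ℝ := fun n => ∑ v : InfinitePlace K, (v.mult : ℝ) * Real.log ‖d n v 0 0‖
  have hlogprod : ∀ n, Real.log (∏ v, ‖d n v 0 0‖ ^ v.mult) = S n := fun n => by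
    rw [Real.log_prod (fun v _ => pow_ne_zero _ (hpos n v).ne')]
    exact Finset.sum_congr rfl fun v _ => Real.log_pow _ _
  have hS : ∀ᶠ n in U, |S n| ≤ |Real.log c₀| + |Real.log c₁| := by
    filter_upwards [hy.eventually h0, hy.eventually h1] with n hn0 hn1
    have h2 := hn0 (d n * emb A) rfl
    have h3 := hn1 (d n * emb A) rfl
    rw [height_mem_diagTorus (hd n)] at h2 h3
    have h4 := Real.log_le_log hc₀ h2
    have h5 := Real.log_le_log hc₁ h3
    rw [hlogprod] at h4
    have h6 : ∏ v, ‖d n v 1 1‖ ^ v.mult = (∏ v, ‖d n v 0 0‖ ^ v.mult)⁻¹ := by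
      rw [← Finset.prod_inv_distrib]
      exact Finset.prod_congr rfl fun v _ => by rw [hinv, inv_pow]
    rw [h6, Real.log_inv, hlogprod] at h5
    rw [abs_le]
    constructor <;> linarith [abs_nonneg (Real.log c₀), abs_nonneg (Real.log c₁),
      neg_abs_le (Real.log c₀), neg_abs_le (Real.log c₁)]
  have hx : ∀ n, ∑ v : InfinitePlace K, (v.mult : ℝ) * (Real.log ‖d n v 0 0‖ - S n / M) = 0 := by
    intro n
    simp only [mul_sub, Finset.sum_sub_distrib]
    rw [← Finset.sum_mul, mul_div_cancel₀ _ (by positivity : M ≠ 0), sub_self]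
  choose u hum hu using fun n => hC _ (hx n)
  have heD : ∀ n, emb (sqDiag (u n)) ∈ diagTorus (K := K) Finset.univ := fun n =>
    ⟨fun v _ => (mem_diagComponent_iff v).2 (emb_sqDiag_apply _ _),
      fun v hv => absurd (Finset.mem_univ v) hv⟩
  refine ⟨fun n => emb (sqDiag (u n)), heD, fun n => hmA _ (hum n), ?_⟩
  obtain ⟨d', -, hd'⟩ := exists_tendsto_of_norm_bounded (U := U)
    (d := fun n => d n * emb (sqDiag (u n))) (fun n => mul_mem (hd n) (heD n))
    (R := fun _ => C + (|Real.log c₀| + |Real.log c₁|)) fun v _ => by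
      filter_upwards [hS] with n hn
      have h2 : (d n * emb (sqDiag (u n))) v 0 0 =
          d n v 0 0 * algebraMap K v.Completion ((u n ^ 2 : (𝓞 K)ˣ) : K) := by
        obtain ⟨z, -, hz⟩ := mem_diagTorus_iff.1 (hd n)
        rw [← hz]
        change ((diagExp v (z v)).1 * (emb (sqDiag (u n)) v).1) 0 0 = _
        rw [Matrix.mul_apply, Fin.sum_univ_two, diagExp_apply_zero_one, zero_mul, add_zero]
        rfl
      rw [h2, norm_mul, norm_algebraMap_completion, Real.log_mul (hpos n v).ne'
        (Units.pos_at_place _ v).ne']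
      have h3 := hu n v
      have h4 : |S n / M| ≤ |S n| := by
        rw [abs_div, abs_of_pos (by positivity : (0 : ℝ) < M)]
        exact div_le_self (abs_nonneg _) hM1
      have h5 : Real.log ‖d n v 0 0‖ + Real.log (v ((u n ^ 2 : (𝓞 K)ˣ) : K)) =
          (Real.log ‖d n v 0 0‖ - S n / M + Real.log (v ((u n ^ 2 : (𝓞 K)ˣ) : K))) + S n / M := by
        ring
      rw [h5]
      exact (abs_add_le _ _).trans (add_le_add h3 (h4.trans hn))
  exact ⟨d', hd'⟩

/-- The elements of `D` that map the point `x` into its `D_I`-orbit. -/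
def returnSubgroup (I : Finset (InfinitePlace K)) (x : Space K) : Subgroup (Grp K) where
  carrier := {g | g ∈ diagTorus Finset.univ ∧ ∃ d ∈ diagTorus I, g • x = d • x}
  one_mem' := ⟨one_mem _, 1, one_mem _, rfl⟩
  mul_mem' := by
    rintro a b ⟨ha, d, hd, hax⟩ ⟨hb, e, he, hbx⟩
    refine ⟨mul_mem ha hb, e * d, mul_mem he hd, ?_⟩
    rw [mul_smul, hbx, ← mul_smul, diagTorus_commute ha he, mul_smul, hax, mul_smul]
  inv_mem' := by
    rintro a ⟨ha, d, hd, hax⟩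
    refine ⟨inv_mem ha, d⁻¹, inv_mem hd, ?_⟩
    rw [inv_smul_eq_iff, ← mul_smul, diagTorus_commute ha (inv_mem hd), mul_smul, hax,
      inv_smul_smul]

/-- The preimage of a subgroup of `G` under the exponential map of `D`. -/
def logSubgroup (H : Subgroup (Grp K)) : AddSubgroup (InfinitePlace K → ℂ) where
  carrier := {z | torusExp z ∈ H}
  add_mem' {a b} ha hb := by
    change torusExp (a + b) ∈ H
    rw [torusExp_add]; exact mul_mem ha hb
  zero_mem' := by
    change torusExp 0 ∈ H
    rw [torusExp_zero]; exact one_mem _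
  neg_mem' {a} ha := by
    change torusExp (-a) ∈ H
    rw [torusExp_neg]; exact inv_mem ha

/-- The image of a real vector space under the exponential map of `D`. -/
def expSubgroup (W : Submodule ℝ (InfinitePlace K → ℂ)) : Subgroup (Grp K) where
  carrier := torusExp '' W
  mul_mem' := by
    rintro _ _ ⟨a, ha, rfl⟩ ⟨b, hb, rfl⟩
    exact ⟨a + b, W.add_mem ha hb, torusExp_add a b⟩
  one_mem' := ⟨0, W.zero_mem, torusExp_zero⟩
  inv_mem' := by
    rintro _ ⟨a, ha, rfl⟩
    exact ⟨-a, W.neg_mem ha, torusExp_neg a⟩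

omit [NumberField K] in
lemma isConnected_expSubgroup (W : Submodule ℝ (InfinitePlace K → ℂ)) :
    IsConnected (expSubgroup W : Set (Grp K)) :=
  ⟨⟨1, one_mem _⟩, W.convex.isPreconnected.image _ continuous_torusExp.continuousOn⟩

/-- Elements of `H` in the closure of `R ≤ H` are in `R S` if `S` contains a neighbourhood of `1`
in `H`. -/
lemma exists_inv_mul_mem {G : Type*} [Group G] [TopologicalSpace G] [IsTopologicalGroup G]
    {H S R : Subgroup G} (hR : R ≤ H) (h : ∀ᶠ g in 𝓝 (1 : G), g ∈ H → g ∈ S) {g : G}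
    (hgH : g ∈ H) (hg : g ∈ closure (R : Set G)) : ∃ f ∈ R, f⁻¹ * g ∈ S := by
  have hc : Continuous fun f : G => f⁻¹ * g := by fun_prop
  have h1 : Tendsto (fun f : G => f⁻¹ * g) (𝓝 g) (𝓝 1) := by simpa using hc.tendsto g
  obtain ⟨f, hf, hfR⟩ := mem_closure_iff_nhds.1 hg _ (h1.eventually h)
  exact ⟨f, hfR, hf (mul_mem (inv_mem (hR hfR)) hgH)⟩

/-- A subgroup of `H` that contains a neighbourhood of `1` in `H` is closed if `H` is. -/
lemma isClosed_of_eventually_mem {G : Type*} [Group G] [TopologicalSpace G] [IsTopologicalGroup G]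
    {H S : Subgroup G} (hH : IsClosed (H : Set G)) (hS : S ≤ H)
    (h : ∀ᶠ g in 𝓝 (1 : G), g ∈ H → g ∈ S) : IsClosed (S : Set G) := by
  refine isClosed_of_closure_subset fun g hg => ?_
  obtain ⟨f, hf, hfg⟩ := exists_inv_mul_mem hS h (closure_minimal hS hH hg) hg
  have := mul_mem hf hfg
  rwa [mul_inv_cancel_left] at this

/-- A closed subgroup `H` of `D` has an open subgroup that is closed and connected, namely the image
of the linear part of its preimage under the exponential map. -/
lemma exists_open_connected_subgroup {H : Subgroup (Grp K)} (hHc : IsClosed (H : Set (Grp K)))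
    (hHD : H ≤ diagTorus Finset.univ) : ∃ S ≤ H, IsClosed (S : Set (Grp K)) ∧
      IsConnected (S : Set (Grp K)) ∧ (∀ᶠ g in 𝓝 (1 : Grp K), g ∈ H → g ∈ S) ∧
      ∀ I, diagTorus I ≤ H → diagTorus I ≤ S := by
  have hc : IsClosed (logSubgroup H : Set (InfinitePlace K → ℂ)) :=
    hHc.preimage continuous_torusExp
  obtain ⟨ε, hε, hW⟩ := exists_forall_norm_lt_mem_linearPart hc
  have hSH : expSubgroup (linearPart (logSubgroup H)) ≤ H := by
    rintro _ ⟨a, ha, rfl⟩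
    have h1 := mem_linearPart.1 ha 1
    rw [one_smul] at h1
    exact h1
  have hnear : ∀ᶠ g in 𝓝 (1 : Grp K), g ∈ H → g ∈ expSubgroup (linearPart (logSubgroup H)) := by
    filter_upwards [eventually_exists_torusExp_eq hε] with g hg hgH
    obtain ⟨z, hz, rfl⟩ := hg (hHD hgH)
    exact ⟨z, hW z hgH hz, rfl⟩
  refine ⟨_, hSH, isClosed_of_eventually_mem hHc hSH hnear, isConnected_expSubgroup _, hnear,
    fun I hI d hd => ?_⟩
  obtain ⟨z, hz, rfl⟩ := mem_diagTorus_iff.1 hd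
  refine ⟨z, fun t => hI (torusExp_mem_diagTorus fun v hv => ?_), rfl⟩
  rw [Pi.smul_apply, hz v hv, smul_zero]

/-- A limit point of an orbit is a limit of points `d i • x`, indexed by an ultrafilter. -/
lemma exists_ultrafilter_of_mem_closure_orbit {G X : Type*} [Group G] [TopologicalSpace X]
    [MulAction G X] {H : Subgroup G} {x y : X} (hy : y ∈ closure (MulAction.orbit H x)) :
    ∃ (U : Ultrafilter X) (d : X → G), (∀ p, d p ∈ H) ∧ Tendsto (fun p => d p • x) U (𝓝 y) := by
  obtain ⟨U, hU, hUy⟩ := mem_closure_iff_ultrafilter.1 hy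
  have hsec : ∀ p : X, ∃ d ∈ H, p ∈ MulAction.orbit H x → d • x = p := fun p => by
    by_cases hp : p ∈ MulAction.orbit H x
    · obtain ⟨d, hd⟩ := hp
      exact ⟨d, d.2, fun _ => hd⟩
    · exact ⟨1, one_mem _, fun h => absurd h hp⟩
  choose d hd hdp using hsec
  refine ⟨U, d, hd, ?_⟩
  have h1 : Tendsto id (U : Filter X) (𝓝 y) := hUy
  refine h1.congr' ?_
  filter_upwards [hU] with p hp using (hdp p hp).symm

/-- The closure of the orbit `D_I π(A)`, `A ∈ SL(2, K)`, is the orbit of a torus, namely of an open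
subgroup of the closure of the group of elements of `D` that map `π(A)` into `D_I π(A)`. -/
theorem exists_torus_closure_eq (I : Finset (InfinitePlace K)) (A : SL(2, K)) :
    ∃ S : Subgroup (Grp K), S ≤ diagTorus Finset.univ ∧ IsClosed (S : Set (Grp K)) ∧
      IsConnected (S : Set (Grp K)) ∧ diagTorus I ≤ S ∧
      closure (MulAction.orbit (diagTorus I) (proj (emb A))) =
        MulAction.orbit S (proj (emb A)) := by
  set x := proj (emb A) with hx
  have hRH := Subgroup.le_topologicalClosure (returnSubgroup I x)
  have hHc := Subgroup.isClosed_topologicalClosure (returnSubgroup I x)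
  have hcl : ∀ g, g ∈ (returnSubgroup I x).topologicalClosure →
      g ∈ closure (returnSubgroup I x : Set (Grp K)) := fun g hg => hg
  have hHD : (returnSubgroup I x).topologicalClosure ≤ diagTorus Finset.univ :=
    Subgroup.topologicalClosure_minimal _ (fun g hg => hg.1) (isClosed_diagTorus _)
  generalize (returnSubgroup I x).topologicalClosure = H at *
  obtain ⟨S, hSH, hSc, hSconn, hnear, hIS'⟩ := exists_open_connected_subgroup hHc hHD
  have hIS : diagTorus I ≤ S := hIS' I fun d hd =>
    hRH ⟨diagTorus_mono (Finset.subset_univ I) hd, d, hd, rfl⟩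
  have hSD := hSH.trans hHD
  refine ⟨S, hSD, hSc, hSconn, hIS, Set.Subset.antisymm (fun y hy => ?_) ?_⟩
  · -- `y = d' x`, where `d'` is a limit of elements `d p * e p` of the return subgroup
    obtain ⟨U, d, hd, hdU⟩ := exists_ultrafilter_of_mem_closure_orbit hy
    have hdD := fun p => diagTorus_mono (Finset.subset_univ I) (hd p)
    obtain ⟨e, he, hex, d', hd'⟩ := exists_correction A hdD hdU
    have hd'x : y = d' • x := by
      refine tendsto_nhds_unique hdU ((hd'.smul_const x).congr fun p => ?_)
      rw [mul_smul, hex]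
    have hd'H : d' ∈ H := by
      refine hHc.mem_of_tendsto hd' (Eventually.of_forall fun p => ?_)
      refine hRH ⟨mul_mem (hdD p) (he p), d p, hd p, ?_⟩
      rw [mul_smul, hex]
    obtain ⟨f, hfR, hs⟩ := exists_inv_mul_mem hRH hnear hd'H (hcl _ hd'H)
    obtain ⟨hfD, d₁, hd₁, hfx⟩ := hfR
    refine ⟨⟨(f⁻¹ * d') * d₁, mul_mem hs (hIS hd₁)⟩, ?_⟩
    change ((f⁻¹ * d') * d₁) • x = y
    rw [mul_smul, ← hfx, ← mul_smul, ← diagTorus_commute hfD (hSD hs), mul_inv_cancel_left, hd'x]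
  · rintro _ ⟨s, rfl⟩
    have h1 := mem_closure_image (f := fun g : Grp K => g • x)
      (Continuous.continuousAt (by fun_prop)) (hcl _ (hSH s.2))
    refine closure_mono ?_ h1
    rintro _ ⟨f, ⟨-, d, hd, hfx⟩, rfl⟩
    exact ⟨⟨d, hd⟩, hfx.symm⟩

end Closure

/-! ### Points whose representatives are monomial at the places of `I` -/

/-- The matrix `k` maps the coordinate axes `e₀`, `e₁` to the coordinate axes `e_i`, `e_(1 - i)`:
it is diagonal if `i = 0` and antidiagonal if `i = 1`. -/
def MapsAxes {F : Type*} [CommRing F] (k : SL(2, F)) (i : Fin 2) : Prop :=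
  k (1 - i) 0 = 0 ∧ k i 1 = 0

section Monomial

variable {K : Type*} [Field K]

lemma mapsAxes_mul_diagExp {v : InfinitePlace K} {k : SL(2, v.Completion)} {i : Fin 2}
    (hk : MapsAxes k i) (z : ℂ) : k * diagExp v z = diagExp v (if i = 0 then z else -z) * k := by
  refine Matrix.SpecialLinearGroup.ext _ _ fun a b => ?_
  obtain ⟨h1, h2⟩ := hk
  change (k.1 * (diagExp v z).1) a b = ((diagExp v _).1 * k.1) a b
  rw [Matrix.mul_apply, Matrix.mul_apply, Fin.sum_univ_two, Fin.sum_univ_two]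
  fin_cases i <;> fin_cases a <;> fin_cases b <;> simp at h1 h2 ⊢ <;> simp [h1, h2, mul_comm]

variable {I : Finset (InfinitePlace K)} {k : Grp K} {i : InfinitePlace K → Fin 2}

lemma mapsAxes_mul_torusExp (hk : ∀ v ∈ I, MapsAxes (k v) (i v)) {z : InfinitePlace K → ℂ}
    (hz : ∀ v ∉ I, z v = 0) :
    k * torusExp z = torusExp (fun v => if i v = 0 then z v else -z v) * k := by
  funext v
  by_cases hv : v ∈ I
  · exact mapsAxes_mul_diagExp (hk v hv) _
  · change k v * diagExp v (z v) = diagExp v (if i v = 0 then z v else -z v) * k v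
    rw [hz v hv, neg_zero, ite_self, diagExp_zero, one_mul, mul_one]

/-- An element of `G` that is monomial at the places of `I` normalizes `D_I`, and its conjugation
action permutes the diagonal entries. -/
lemma exists_mul_eq_mul_of_mapsAxes (hk : ∀ v ∈ I, MapsAxes (k v) (i v)) {d : Grp K}
    (hd : d ∈ diagTorus I) : ∃ e ∈ diagTorus I, k * d = e * k ∧
      ∀ v ∈ I, e v (i v) (i v) = d v 0 0 ∧ e v (1 - i v) (1 - i v) = d v 1 1 := by
  obtain ⟨z, hz, rfl⟩ := mem_diagTorus_iff.1 hd
  refine ⟨_, torusExp_mem_diagTorus fun v hv => ?_, mapsAxes_mul_torusExp hk hz, fun v _ => ?_⟩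
  · rw [hz v hv, neg_zero, ite_self]
  · generalize hj : i v = j
    simp only [torusExp_apply, hj]
    fin_cases j <;> simp

/-- The form of `exists_mul_eq_mul_of_mapsAxes` that starts from the conjugate `e = k d k⁻¹`. -/
lemma exists_mul_eq_mul_of_mapsAxes' (hk : ∀ v ∈ I, MapsAxes (k v) (i v)) {e : Grp K}
    (he : e ∈ diagTorus I) : ∃ d ∈ diagTorus I, k * d = e * k ∧
      ∀ v ∈ I, e v (i v) (i v) = d v 0 0 ∧ e v (1 - i v) (1 - i v) = d v 1 1 := by
  obtain ⟨z, hz, rfl⟩ := mem_diagTorus_iff.1 he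
  have hd : torusExp (fun v => if i v = 0 then z v else -z v) ∈ diagTorus I :=
    torusExp_mem_diagTorus fun v hv => by rw [hz v hv, neg_zero, ite_self]
  have hz' : ∀ v ∉ I, (fun v => if i v = 0 then z v else -z v) v = 0 := fun v hv => by
    simp only [hz v hv, neg_zero, ite_self]
  have hzz : (fun v => if i v = 0 then (if i v = 0 then z v else -z v)
      else -(if i v = 0 then z v else -z v)) = z := by
    funext v
    split_ifs <;> simp
  have h1 := mapsAxes_mul_torusExp hk hz'
  simp only [hzz] at h1
  refine ⟨_, hd, h1, fun v _ => ?_⟩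
  generalize hj : i v = j
  simp only [torusExp_apply, hj]
  fin_cases j <;> simp

variable [NumberField K]

open scoped Pointwise in
/-- The closure of a `D_I`-orbit through a translate, monomial on `I`, of a rational point is the
orbit of a torus. -/
theorem exists_torus_closure_eq_of_mapsAxes (hk : ∀ v ∈ I, MapsAxes (k v) (i v)) (A : SL(2, K)) :
    ∃ S : Subgroup (Grp K), S ≤ diagTorus Finset.univ ∧ IsClosed (S : Set (Grp K)) ∧
      IsConnected (S : Set (Grp K)) ∧ diagTorus I ≤ S.map (MulAut.conj k).toMonoidHom ∧
      closure (MulAction.orbit (diagTorus I) (proj (k * emb A))) =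
        MulAction.orbit (S.map (MulAut.conj k).toMonoidHom) (proj (k * emb A)) := by
  obtain ⟨S, hSD, hSc, hSconn, hIS, hS⟩ := exists_torus_closure_eq I A
  refine ⟨S, hSD, hSc, hSconn, fun e he => ?_, ?_⟩
  · obtain ⟨d, hd, hde, -⟩ := exists_mul_eq_mul_of_mapsAxes' hk he
    refine ⟨d, hIS hd, ?_⟩
    change k * d * k⁻¹ = e
    rw [hde, mul_inv_cancel_right]
  have h1 : MulAction.orbit (diagTorus I) (proj (k * emb A)) =
      k • MulAction.orbit (diagTorus I) (proj (emb A)) := by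
    ext y
    constructor
    · rintro ⟨⟨e, he⟩, rfl⟩
      obtain ⟨d, hd, hde, -⟩ := exists_mul_eq_mul_of_mapsAxes' hk he
      refine ⟨_, ⟨⟨d, hd⟩, rfl⟩, ?_⟩
      change proj (k * (d * emb A)) = proj (e * (k * emb A))
      rw [← mul_assoc, ← mul_assoc, hde]
    · rintro ⟨_, ⟨⟨d, hd⟩, rfl⟩, rfl⟩
      obtain ⟨e, he, hde, -⟩ := exists_mul_eq_mul_of_mapsAxes hk hd
      refine ⟨⟨e, he⟩, ?_⟩
      change proj (e * (k * emb A)) = proj (k * (d * emb A))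
      rw [← mul_assoc, ← mul_assoc, hde]
  rw [h1, closure_smul, hS]
  ext y
  constructor
  · rintro ⟨_, ⟨⟨s, hs⟩, rfl⟩, rfl⟩
    refine ⟨⟨k * s * k⁻¹, s, hs, rfl⟩, ?_⟩
    change proj (k * s * k⁻¹ * (k * emb A)) = proj (k * (s * emb A))
    group
  · rintro ⟨⟨_, s, hs, rfl⟩, rfl⟩
    refine ⟨_, ⟨⟨s, hs⟩, rfl⟩, ?_⟩
    change proj (k * (s * emb A)) = proj (k * s * k⁻¹ * (k * emb A))
    group

/-- A subset of `G / Γ` that contains `k d π(A)` for all `d ∈ D_I` is not compact: pushing `d` to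
infinity in one direction shortens a rational vector. -/
lemma not_isCompact_of_forall_mem (hI : I.Nonempty) (k : Grp K) (A : SL(2, K)) {Y : Set (Space K)}
    (hY : ∀ d ∈ diagTorus I, proj (k * d * emb A) ∈ Y) : ¬ IsCompact Y := by
  classical
  intro hc
  obtain ⟨v₀, hv₀⟩ := hI
  have hd : ∀ n : ℕ, torusExp (Pi.single v₀ (-(n : ℂ))) ∈ diagTorus I := fun n =>
    torusExp_mem_diagTorus fun v hv =>
      Pi.single_eq_of_ne (fun h : v = v₀ => hv (h ▸ hv₀)) _
  obtain ⟨y, -, hy⟩ := hc.ultrafilter_le_nhds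
    ((Ultrafilter.of atTop).map fun n : ℕ => proj (k * torusExp (Pi.single v₀ (-(n : ℂ))) * emb A))
    (le_principal_iff.2 (mem_map.2 (Filter.univ_mem' fun n : ℕ => hY _ (hd n))))
  refine not_tendsto_height_zero (F := (Ultrafilter.of atTop : Ultrafilter ℕ)) (y := y)
    (d := fun n : ℕ => k * torusExp (Pi.single v₀ (-(n : ℂ))) * emb A) hy
    (SL_mulVec_ne_zero A⁻¹ (single_one_ne_zero 0)) (Tendsto.mono_left ?_ (Ultrafilter.of_le _))
  simp only [height_mul_mem_diagTorus (hd _)]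
  rw [← zero_mul (height k (Pi.single 0 1))]
  refine Tendsto.mul_const _ ?_
  have h1 : ∀ n : ℕ, ∏ v, ‖torusExp (Pi.single v₀ (-(n : ℂ))) v 0 0‖ ^ v.mult =
      Real.exp (-(n : ℝ)) ^ v₀.mult := fun n => by
    rw [Finset.prod_eq_single v₀]
    · simp
    · intro v _ hv
      simp [hv]
    · simp
  simp only [h1]
  have h2 : Tendsto (fun n : ℕ => Real.exp (-(n : ℝ))) atTop (𝓝 0) :=
    Real.tendsto_exp_neg_atTop_nhds_zero.comp tendsto_natCast_atTop_atTop
  simpa [v₀.mult_ne_zero] using h2.pow v₀.mult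

/-- The recurrence of `π(A)`, transported to `k π(A)`. -/
lemma exists_recurrence_of_mapsAxes {v₁ v₂ : InfinitePlace K} (h12 : v₁ ≠ v₂)
    (hI : ∀ v, v ∈ I ↔ v = v₁ ∨ v = v₂) (hk : ∀ v ∈ I, MapsAxes (k v) (i v)) (A : SL(2, K)) :
    ∃ δ : ℕ → Grp K, (∀ n, δ n ∈ diagTorus I) ∧
      Tendsto (fun n => δ n • proj (k * emb A)) atTop (𝓝 (proj (k * emb A))) ∧
      Tendsto (fun n => ‖δ n v₁ (i v₁) (i v₁)‖) atTop (𝓝 0) ∧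
      Tendsto (fun n => ‖δ n v₂ (1 - i v₂) (1 - i v₂)‖) atTop (𝓝 0) := by
  obtain ⟨d, hd, hx, h1, h2⟩ := exists_recurrence A h12 hI
  choose δ hδ hkd he using fun n => exists_mul_eq_mul_of_mapsAxes hk (hd n)
  refine ⟨δ, hδ, ?_, ?_, ?_⟩
  · have h3 : ∀ n, δ n • proj (k * emb A) = k • d n • proj (emb A) := fun n => by
      change proj (δ n * (k * emb A)) = proj (k * (d n * emb A))
      rw [← mul_assoc, ← mul_assoc, hkd]
    simp only [h3]
    exact hx.const_smul k
  · simpa only [(he _ v₁ ((hI v₁).2 (Or.inl rfl))).1] using h1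
  · simpa only [(he _ v₂ ((hI v₂).2 (Or.inr rfl))).2] using h2

/-- If `k` permutes the axes in the same way at `v₁` and `v₂`, and `k'` in different ways, then the
torus orbit through `k π(A)` does not contain `k' π(A')`: a sequence that returns `k' π(A')` to
itself contracts one and the same axis at both places, hence shortens a rational vector of
`k π(A)`. -/
lemma proj_notMem_closure_orbit {v₁ v₂ : InfinitePlace K} (h12 : v₁ ≠ v₂)
    (hI : ∀ v, v ∈ I ↔ v = v₁ ∨ v = v₂) (hk : ∀ v ∈ I, MapsAxes (k v) (i v)) (hi : i v₁ = i v₂)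
    {k' : Grp K} {i' : InfinitePlace K → Fin 2} (hk' : ∀ v ∈ I, MapsAxes (k' v) (i' v))
    (hi' : i' v₁ = 1 - i' v₂) (A A' : SL(2, K)) :
    proj (k' * emb A') ∉ closure (MulAction.orbit (diagTorus I) (proj (k * emb A))) := by
  intro hmem
  obtain ⟨S, hSD, -, -, -, hS⟩ := exists_torus_closure_eq_of_mapsAxes hk A
  rw [hS] at hmem
  obtain ⟨⟨_, s, hs, rfl⟩, hs'⟩ := hmem
  replace hs' : proj (k' * emb A') = proj (k * s * emb A) := by
    rw [← hs']
    change proj (k * s * k⁻¹ * (k * emb A)) = _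
    group
  obtain ⟨δ, hδ, hx, h1, h2⟩ := exists_recurrence_of_mapsAxes h12 hI hk' A'
  choose d hd hkd he using fun n => exists_mul_eq_mul_of_mapsAxes' hk (hδ n)
  have hdD : ∀ n, d n * s ∈ diagTorus (K := K) Finset.univ := fun n =>
    mul_mem (diagTorus_mono (Finset.subset_univ I) (hd n)) (hSD hs)
  have hx' : Tendsto (fun n => proj (k * (d n * s) * emb A)) atTop (𝓝 (proj (k' * emb A'))) := by
    refine hx.congr fun n => ?_
    rw [hs']
    change proj (δ n * (k * s * emb A)) = _
    rw [← mul_assoc, ← mul_assoc, ← hkd, ← mul_assoc]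
  have hv₁ := (hI v₁).2 (Or.inl rfl)
  have hv₂ := (hI v₂).2 (Or.inr rfl)
  obtain ⟨c, hc₁, hc₂⟩ : ∃ c : Fin 2, Tendsto (fun n => ‖d n v₁ c c‖) atTop (𝓝 0) ∧
      Tendsto (fun n => ‖d n v₂ c c‖) atTop (𝓝 0) := by
    have e1 := fun n => he n v₁ hv₁
    have e2 := fun n => he n v₂ hv₂
    rw [← hi'] at h2
    rw [← hi] at e2
    rcases eq_or_ne (i' v₁) (i v₁) with h | h
    · rw [h] at h1 h2
      exact ⟨0, by simpa only [(e1 _).1] using h1, by simpa only [(e2 _).1] using h2⟩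
    · have h' : i' v₁ = 1 - i v₁ := by omega
      rw [h'] at h1 h2
      exact ⟨1, by simpa only [(e1 _).2] using h1, by simpa only [(e2 _).2] using h2⟩
  refine not_tendsto_height_zero hx' (SL_mulVec_ne_zero A⁻¹ (single_one_ne_zero c)) ?_
  simp only [height_mul_mem_diagTorus (hdD _)]
  rw [← zero_mul (height k (Pi.single c 1))]
  refine Tendsto.mul_const _ ?_
  have hcc : ∀ n v, ‖(d n * s) v c c‖ = ‖d n v c c‖ * ‖s v c c‖ := fun n v => by
    obtain ⟨z, -, hz⟩ := mem_diagTorus_iff.1 (hd n)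
    rw [← hz]
    change ‖((diagExp v (z v)).1 * (s v).1) c c‖ = _
    rw [Matrix.mul_apply, Fin.sum_univ_two]
    fin_cases c <;> simp
  have hone : ∀ n v, v ∉ I → d n v c c = 1 := fun n v hv => by
    rw [(hd n).2 v hv]; simp
  have hfac : ∀ v ∈ I, Tendsto (fun n => ‖(d n * s) v c c‖ ^ v.mult) atTop (𝓝 0) := fun v hv => by
    have h3 : Tendsto (fun n => ‖d n v c c‖) atTop (𝓝 0) := by
      rcases (hI v).1 hv with rfl | rfl <;> assumption
    simpa only [hcc, zero_mul, zero_pow v.mult_ne_zero] using (h3.mul_const ‖s v c c‖).pow v.mult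
  have hall : ∀ v, ∃ l, Tendsto (fun n => ‖(d n * s) v c c‖ ^ v.mult) atTop (𝓝 l) := fun v => by
    by_cases hv : v ∈ I
    · exact ⟨_, hfac v hv⟩
    · exact ⟨‖s v c c‖ ^ v.mult, by
        simp only [hcc, hone _ v hv, norm_one, one_mul, tendsto_const_nhds]⟩
  choose l hl using hall
  have h4 := tendsto_finsetProd Finset.univ fun v _ => hl v
  rwa [Finset.prod_eq_zero (Finset.mem_univ v₁) (tendsto_nhds_unique (hl v₁) (hfac v₁ hv₁))] at h4

end Monomial

/-! ### Limits of a locally divergent orbit along a quadrant -/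

section Quadrant

/-- The matrix `u` is unipotent, with its only nonzero off-diagonal entry in row `i`. -/
def IsUnipotentAt {F : Type*} [CommRing F] (u : SL(2, F)) (i : Fin 2) : Prop :=
  u i i = 1 ∧ u (1 - i) (1 - i) = 1 ∧ u (1 - i) i = 0

lemma SL_mul_apply {R : Type*} [CommRing R] (A B : SL(2, R)) (a b : Fin 2) :
    (A * B) a b = A a 0 * B 0 b + A a 1 * B 1 b := by
  rw [Matrix.SpecialLinearGroup.coe_mul, Matrix.mul_apply, Fin.sum_univ_two]

lemma exists_SL_entries {R : Type*} [CommRing R] {a b c d : R} (h : a * d - b * c = 1) :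
    ∃ k : SL(2, R), k 0 0 = a ∧ k 0 1 = b ∧ k 1 0 = c ∧ k 1 1 = d :=
  ⟨⟨!![a, b; c, d], by rw [Matrix.det_fin_two_of, h]⟩, rfl, rfl, rfl, rfl⟩

/-- A matrix that maps `e_c` to the axis `e_i` is a monomial matrix up to a unipotent factor that
fixes `e_i`. -/
lemma exists_unipotent_mul_mapsAxes {F : Type*} [Field F] (M : SL(2, F)) {i c : Fin 2}
    (h : M (1 - i) c = 0) : ∃ u k : SL(2, F), M = u * k ∧ IsUnipotentAt u i ∧
      MapsAxes k (if c = 0 then i else 1 - i) := by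
  have hdet := M.2
  rw [Matrix.det_fin_two] at hdet
  fin_cases i <;> fin_cases c <;> simp at h
  · obtain ⟨u, u1, u2, u3, u4⟩ := exists_SL_entries
      (show (1 : F) * 1 - (M 0 1 * M 0 0) * 0 = 1 by ring)
    obtain ⟨k, k1, k2, k3, k4⟩ := exists_SL_entries
      (show M 0 0 * M 1 1 - 0 * 0 = 1 by linear_combination hdet + M 0 1 * h)
    refine ⟨u, k, ?_, by simp [IsUnipotentAt, u1, u3, u4], by simp [MapsAxes, k2, k3]⟩
    refine Matrix.SpecialLinearGroup.ext _ _ fun a b => ?_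
    rw [SL_mul_apply]
    fin_cases a <;> fin_cases b <;> simp [h, u1, u2, u3, u4, k1, k2, k3, k4]
    linear_combination -M 0 1 * (hdet + M 0 1 * h)
  · obtain ⟨u, u1, u2, u3, u4⟩ := exists_SL_entries
      (show (1 : F) * 1 - (-(M 0 0 * M 0 1)) * 0 = 1 by ring)
    obtain ⟨k, k1, k2, k3, k4⟩ := exists_SL_entries
      (show 0 * 0 - M 0 1 * M 1 0 = 1 by linear_combination hdet - M 0 0 * h)
    refine ⟨u, k, ?_, by simp [IsUnipotentAt, u1, u3, u4], by simp [MapsAxes, k1, k4]⟩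
    refine Matrix.SpecialLinearGroup.ext _ _ fun a b => ?_
    rw [SL_mul_apply]
    fin_cases a <;> fin_cases b <;> simp [h, u1, u2, u3, u4, k1, k2, k3, k4]
    linear_combination -M 0 0 * (hdet - M 0 0 * h)
  · obtain ⟨u, u1, u2, u3, u4⟩ := exists_SL_entries
      (show (1 : F) * 1 - 0 * (-(M 1 1 * M 1 0)) = 1 by ring)
    obtain ⟨k, k1, k2, k3, k4⟩ := exists_SL_entries
      (show 0 * 0 - M 0 1 * M 1 0 = 1 by linear_combination hdet - M 1 1 * h)
    refine ⟨u, k, ?_, by simp [IsUnipotentAt, u1, u2, u4], by simp [MapsAxes, k1, k4]⟩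
    refine Matrix.SpecialLinearGroup.ext _ _ fun a b => ?_
    rw [SL_mul_apply]
    fin_cases a <;> fin_cases b <;> simp [h, u1, u2, u3, u4, k1, k2, k3, k4]
    linear_combination -M 1 1 * (hdet - M 1 1 * h)
  · obtain ⟨u, u1, u2, u3, u4⟩ := exists_SL_entries
      (show (1 : F) * 1 - 0 * (M 1 0 * M 1 1) = 1 by ring)
    obtain ⟨k, k1, k2, k3, k4⟩ := exists_SL_entries
      (show M 0 0 * M 1 1 - 0 * 0 = 1 by linear_combination hdet + M 1 0 * h)
    refine ⟨u, k, ?_, by simp [IsUnipotentAt, u1, u2, u4], by simp [MapsAxes, k2, k3]⟩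
    refine Matrix.SpecialLinearGroup.ext _ _ fun a b => ?_
    rw [SL_mul_apply]
    fin_cases a <;> fin_cases b <;> simp [h, u1, u2, u3, u4, k1, k2, k3, k4]
    linear_combination -M 1 0 * (hdet + M 1 0 * h)

variable {K : Type*} [Field K]

lemma tendsto_conj_of_isUnipotentAt {ι : Type*} {F : Filter ι} {v : InfinitePlace K} {i : Fin 2}
    {u : SL(2, v.Completion)} (hu : IsUnipotentAt u i) {z : ι → ℂ}
    (h : Tendsto (fun n => ‖diagExp v (z n) i i‖) F (𝓝 0)) :
    Tendsto (fun n => diagExp v (z n) * u * (diagExp v (z n))⁻¹) F (𝓝 1) := by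
  obtain ⟨h0, h1, h2⟩ := hu
  have h3 := (tendsto_zero_iff_norm_tendsto_zero.2 h)
  have key : ∀ n a b, (diagExp v (z n) * u * (diagExp v (z n))⁻¹) a b =
      diagExp v (z n) a a * u a b * diagExp v (-z n) b b := fun n a b => by
    rw [← diagExp_neg]
    simp only [SL_mul_apply]
    fin_cases a <;> fin_cases b <;> simp
  have hm := expAt_mul_neg v
  refine tendsto_SL_iff.2 fun a b => ?_
  simp only [key]
  -- the only non-constant entry of the conjugate
  have hsq := (h3.mul_const (u i (1 - i))).mul h3
  rw [zero_mul, zero_mul] at hsq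
  fin_cases i <;> fin_cases a <;> fin_cases b <;> simp at h0 h1 h2 hsq ⊢ <;>
    (try simp [h0, h1, h2, hm, mul_comm (expAt v (-_))]) <;>
    first | exact tendsto_const_nhds | simpa [mul_comm, mul_assoc] using hsq

/-- Linearly independent `p`, `q`, the second one rescaled, are the columns of a matrix `B` in
`SL(2, K)`. -/
lemma exists_SL_columns {p q : Fin 2 → K} (hpq : det2 p q ≠ 0) : ∃ B : SL(2, K),
    ∀ (g : Grp K) (v : InfinitePlace K) (a : Fin 2),
      (((g v).1 *ᵥ vecAt K v p) a = 0 → (g * emb B) v a 0 = 0) ∧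
      (((g v).1 *ᵥ vecAt K v q) a = 0 → (g * emb B) v a 1 = 0) := by
  obtain ⟨B, h00, h01, h10, h11⟩ := exists_SL_entries
    (show p 0 * (q 1 / det2 p q) - q 0 / det2 p q * p 1 = 1 by
      rw [det2] at hpq ⊢
      field_simp)
  have hx : ∀ (g : Grp K) (v : InfinitePlace K) (a : Fin 2) (x : Fin 2 → K),
      ((g v).1 *ᵥ vecAt K v x) a =
        g v a 0 * algebraMap K v.Completion (x 0) + g v a 1 * algebraMap K v.Completion (x 1) := by
    intro g v a x
    rw [Matrix.mulVec, dotProduct, Fin.sum_univ_two]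
    rfl
  refine ⟨B, fun g v a => ⟨fun h => ?_, fun h => ?_⟩⟩
  · rw [Pi.mul_apply, SL_mul_apply, emb_apply_apply, emb_apply_apply, h00, h10, ← hx, h]
  · rw [Pi.mul_apply, SL_mul_apply, emb_apply_apply, emb_apply_apply, h01, h11, div_eq_mul_inv,
      div_eq_mul_inv, map_mul, map_mul, ← mul_assoc, ← mul_assoc, ← add_mul, ← hx, h, zero_mul]

/-- If at every place of `I` the coordinate axes are the images of the same two rational lines, then
`g` is monomial on `I` up to a rational factor. -/
lemma exists_mapsAxes_of_lines {I : Finset (InfinitePlace K)} {g : Grp K} {p q : Fin 2 → K}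
    (hpq : det2 p q ≠ 0) {i : InfinitePlace K → Fin 2}
    (h : ∀ v ∈ I, ((g v).1 *ᵥ vecAt K v p) (1 - i v) = 0 ∧ ((g v).1 *ᵥ vecAt K v q) (i v) = 0) :
    ∃ (k : Grp K) (A : SL(2, K)), g = k * emb A ∧ ∀ v ∈ I, MapsAxes (k v) (i v) := by
  obtain ⟨B, hB⟩ := exists_SL_columns hpq
  refine ⟨g * emb B, B⁻¹, ?_, fun v hv => ⟨(hB g v _).1 (h v hv).1, (hB g v _).2 (h v hv).2⟩⟩
  rw [mul_assoc, ← map_mul, mul_inv_cancel, map_one, mul_one]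

/-- Given linearly independent rational vectors, one mapped to the axis `e_i` at `v₁` and the other
to the axis `e_j` at `v₂`, `g` is rational and monomial on `I` up to a unipotent factor that is
contracted by the elements of `D_I` that contract `e_i` at `v₁` and `e_j` at `v₂`. -/
lemma exists_unipotent_mul_mapsAxes_mul_emb {v₁ v₂ : InfinitePlace K} (h12 : v₁ ≠ v₂)
    {I : Finset (InfinitePlace K)} (hI : ∀ v, v ∈ I ↔ v = v₁ ∨ v = v₂) {g : Grp K}
    {p q : Fin 2 → K} (hpq : det2 p q ≠ 0) {i j : Fin 2}
    (hp : ((g v₁).1 *ᵥ vecAt K v₁ p) (1 - i) = 0) (hq : ((g v₂).1 *ᵥ vecAt K v₂ q) (1 - j) = 0) :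
    ∃ (u k : Grp K) (A : SL(2, K)) (a : InfinitePlace K → Fin 2), g = u * (k * emb A) ∧
      (∀ v ∉ I, u v = 1) ∧ IsUnipotentAt (u v₁) i ∧ IsUnipotentAt (u v₂) j ∧
      a v₁ = i ∧ a v₂ = 1 - j ∧ ∀ v ∈ I, MapsAxes (k v) (a v) := by
  obtain ⟨B, hB⟩ := exists_SL_columns hpq
  obtain ⟨u₁, k₁, h1, hu₁, hk₁⟩ := exists_unipotent_mul_mapsAxes _ ((hB g v₁ _).1 hp)
  obtain ⟨u₂, k₂, h2, hu₂, hk₂⟩ := exists_unipotent_mul_mapsAxes _ ((hB g v₂ _).2 hq)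
  have hloc : ∀ v, ∃ (u k : SL(2, v.Completion)) (a : Fin 2), (g * emb B) v = u * k ∧
      (v ∉ I → u = 1) ∧ (v = v₁ → IsUnipotentAt u i ∧ a = i ∧ MapsAxes k a) ∧
      (v = v₂ → IsUnipotentAt u j ∧ a = 1 - j ∧ MapsAxes k a) := fun v => by
    by_cases hv1 : v = v₁
    · subst hv1
      exact ⟨u₁, k₁, _, h1, fun h => absurd ((hI v).2 (Or.inl rfl)) h, fun _ => ⟨hu₁, rfl, hk₁⟩,
        fun h => absurd h h12⟩
    by_cases hv2 : v = v₂
    · subst hv2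
      exact ⟨u₂, k₂, _, h2, fun h => absurd ((hI v).2 (Or.inr rfl)) h, fun h => absurd h hv1,
        fun _ => ⟨hu₂, rfl, hk₂⟩⟩
    · exact ⟨1, (g * emb B) v, 0, (one_mul _).symm, fun _ => rfl, fun h => absurd h hv1,
        fun h => absurd h hv2⟩
  choose u k a huk hu h1 h2 using hloc
  refine ⟨u, k, B⁻¹, a, ?_, hu, (h1 v₁ rfl).1, (h2 v₂ rfl).1, (h1 v₁ rfl).2.1, (h2 v₂ rfl).2.1,
    fun v hv => ?_⟩
  · rw [← mul_assoc, ← (funext huk : g * emb B = u * k), mul_assoc, ← map_mul, mul_inv_cancel,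
      map_one, mul_one]
  · rcases (hI v).1 hv with rfl | rfl
    exacts [(h1 v rfl).2.2, (h2 v rfl).2.2]

/-- The orbits of `π(u x)` and `π(x)` have the same limits along sequences that contract `u`. -/
lemma tendsto_smul_proj_iff {v₁ v₂ : InfinitePlace K}
    {I : Finset (InfinitePlace K)} (hI : ∀ v, v ∈ I ↔ v = v₁ ∨ v = v₂) {u : Grp K}
    (hu : ∀ v ∉ I, u v = 1) {i j : Fin 2} (h1 : IsUnipotentAt (u v₁) i)
    (h2 : IsUnipotentAt (u v₂) j) {ι : Type*} {F : Filter ι} {d : ι → Grp K}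
    (hd : ∀ n, d n ∈ diagTorus I) (hd1 : Tendsto (fun n => ‖d n v₁ i i‖) F (𝓝 0))
    (hd2 : Tendsto (fun n => ‖d n v₂ j j‖) F (𝓝 0)) {x : Grp K} {y : Space K} :
    Tendsto (fun n => d n • proj (u * x)) F (𝓝 y) ↔ Tendsto (fun n => d n • proj x) F (𝓝 y) := by
  have hc : Tendsto (fun n => d n * u * (d n)⁻¹) F (𝓝 1) := by
    choose z hz hzd using fun n => mem_diagTorus_iff.1 (hd n)
    have hv : ∀ v i, IsUnipotentAt (u v) i → Tendsto (fun n => ‖d n v i i‖) F (𝓝 0) →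
        Tendsto (fun n => d n v * u v * (d n v)⁻¹) F (𝓝 1) := fun v i h h' => by
      simp only [← hzd] at h' ⊢
      exact tendsto_conj_of_isUnipotentAt h h'
    refine tendsto_pi_nhds.2 fun v => ?_
    by_cases hvI : v ∈ I
    · rcases (hI v).1 hvI with rfl | rfl
      exacts [hv v i h1 hd1, hv v j h2 hd2]
    · refine tendsto_const_nhds.congr fun n => ?_
      change (1 : SL(2, v.Completion)) = d n v * u v * (d n v)⁻¹
      rw [hu v hvI, mul_one, mul_inv_cancel]
  constructor
  · intro h
    have := hc.inv.smul h
    rw [inv_one, one_smul] at this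
    refine this.congr fun n => ?_
    change proj ((d n * u * (d n)⁻¹)⁻¹ * (d n * (u * x))) = proj (d n * x)
    group
  · intro h
    have := hc.smul h
    rw [one_smul] at this
    refine this.congr fun n => ?_
    change proj (d n * u * (d n)⁻¹ * (d n * x)) = proj (d n * (u * x))
    group

variable [NumberField K]

/-- The heights of a vector that is contracted at one place and stays bounded at the others tend
to `0`. -/
lemma tendsto_height_zero {ι : Type*} {F : Filter ι} {d : ι → Grp K} {g : Grp K} {w : Fin 2 → K}
    {v₀ : InfinitePlace K}
    (h : Tendsto (fun n => ‖(d n v₀).1 *ᵥ ((g v₀).1 *ᵥ vecAt K v₀ w)‖) F (𝓝 0))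
    {C : InfinitePlace K → ℝ}
    (hC : ∀ v ≠ v₀, ∀ᶠ n in F, ‖(d n v).1 *ᵥ ((g v).1 *ᵥ vecAt K v w)‖ ≤ C v) :
    Tendsto (fun n => height (d n * g) w) F (𝓝 0) := by
  classical
  have hh : ∀ n, height (d n * g) w =
      ‖(d n v₀).1 *ᵥ ((g v₀).1 *ᵥ vecAt K v₀ w)‖ ^ v₀.mult *
        ∏ v ∈ Finset.univ.erase v₀, ‖(d n v).1 *ᵥ ((g v).1 *ᵥ vecAt K v w)‖ ^ v.mult := fun n => by
    rw [Finset.mul_prod_erase Finset.univ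
      (fun v => ‖(d n v).1 *ᵥ ((g v).1 *ᵥ vecAt K v w)‖ ^ v.mult) (Finset.mem_univ v₀)]
    refine Finset.prod_congr rfl fun v _ => ?_
    rw [Matrix.mulVec_mulVec]
    rfl
  have h1 : Tendsto (fun n => ‖(d n v₀).1 *ᵥ ((g v₀).1 *ᵥ vecAt K v₀ w)‖ ^ v₀.mult *
      ∏ v ∈ Finset.univ.erase v₀, C v ^ v.mult) F (𝓝 0) := by
    simpa only [zero_pow v₀.mult_ne_zero, zero_mul] using
      (h.pow v₀.mult).mul_const (∏ v ∈ Finset.univ.erase v₀, C v ^ v.mult)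
  refine squeeze_zero' (Eventually.of_forall fun n => height_nonneg _ _) ?_ h1
  have hC' : ∀ᶠ n in F, ∀ v ∈ Finset.univ.erase v₀,
      ‖(d n v).1 *ᵥ ((g v).1 *ᵥ vecAt K v w)‖ ≤ C v :=
    (eventually_all_finset _).2 fun v hv => hC v (Finset.ne_of_mem_erase hv)
  filter_upwards [hC'] with n hn
  rw [hh]
  gcongr with v hv
  exact hn v hv

end Quadrant

/-! ### The closure of a locally divergent orbit -/

section OrbitClosure

variable {K : Type*} [Field K] {I : Finset (InfinitePlace K)}

lemma norm_mulVec_le_of_apply_eq_zero {d : Grp K} (hd : d ∈ diagTorus I) {v : InfinitePlace K}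
    {x : Fin 2 → v.Completion} {i : Fin 2} (hx : x (1 - i) = 0) :
    ‖(d v).1 *ᵥ x‖ ≤ ‖d v i i‖ * ‖x‖ := by
  obtain ⟨z, -, rfl⟩ := mem_diagTorus_iff.1 hd
  have h0 : ((torusExp z v).1 *ᵥ x) 0 = torusExp z v 0 0 * x 0 := by
    rw [Matrix.mulVec, dotProduct, Fin.sum_univ_two]
    simp
  have h1 : ((torusExp z v).1 *ᵥ x) 1 = torusExp z v 1 1 * x 1 := by
    rw [Matrix.mulVec, dotProduct, Fin.sum_univ_two]
    simp
  refine (pi_norm_le_iff_of_nonneg (by positivity)).2 fun a => ?_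
  obtain rfl | rfl : a = i ∨ a = 1 - i := by omega
  · refine (le_of_eq ?_).trans (mul_le_mul_of_nonneg_left (norm_le_pi_norm x a) (norm_nonneg _))
    rw [← norm_mul]
    fin_cases a
    exacts [congrArg norm h0, congrArg norm h1]
  · refine (le_of_eq ?_).trans (by positivity : (0 : ℝ) ≤ _)
    fin_cases i
    · exact norm_eq_zero.2 (h1.trans (by rw [show x 1 = 0 from hx, mul_zero]))
    · exact norm_eq_zero.2 (h0.trans (by rw [show x 0 = 0 from hx, mul_zero]))

lemma norm_mulVec_le_of_abs_log_le {d : Grp K} (hd : d ∈ diagTorus I) {v : InfinitePlace K}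
    (x : Fin 2 → v.Completion) {R : ℝ} (h : |Real.log ‖d v 0 0‖| ≤ R) :
    ‖(d v).1 *ᵥ x‖ ≤ Real.exp R * ‖x‖ := by
  obtain ⟨z, -, rfl⟩ := mem_diagTorus_iff.1 hd
  rw [torusExp_apply, diagExp_apply_zero_zero, norm_expAt, Real.log_exp] at h
  refine (norm_diagExp_mulVec_le v (z v) x).trans ?_
  gcongr

/-- Along an ultrafilter, the `v`-components of elements of `D_I` stay bounded or contract one of
the two axes. -/
lemma bounded_or_tendsto_zero {ι : Type*} (U : Ultrafilter ι) {d : ι → Grp K}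
    (hd : ∀ n, d n ∈ diagTorus I) (v : InfinitePlace K) :
    (∃ R, ∀ᶠ n in U, |Real.log ‖d n v 0 0‖| ≤ R) ∨
      ∃ i : Fin 2, Tendsto (fun n => ‖d n v i i‖) U (𝓝 0) := by
  choose z hz' hz using fun n => mem_diagTorus_iff.1 (hd n)
  have h0 : ∀ n, ‖d n v 0 0‖ = Real.exp (z n v).re := fun n => by
    rw [← hz n, torusExp_apply, diagExp_apply_zero_zero, norm_expAt]
  have h1 : ∀ n, ‖d n v 1 1‖ = Real.exp (-(z n v).re) := fun n => by
    rw [← hz n, torusExp_apply, diagExp_apply_one_one, norm_expAt, Complex.neg_re]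
  simp only [h0, Real.log_exp]
  refine or_iff_not_imp_left.2 fun hR => ?_
  push Not at hR
  rcases U.em fun n => 0 ≤ (z n v).re with h | h
  · refine ⟨1, ?_⟩
    simp only [h1]
    refine Real.tendsto_exp_neg_atTop_nhds_zero.comp (tendsto_atTop.2 fun R => ?_)
    filter_upwards [hR R, h] with n hn hn'
    rw [abs_of_nonneg hn'] at hn
    exact hn.le
  · refine ⟨0, ?_⟩
    simp only [h0]
    refine Real.tendsto_exp_atBot.comp (tendsto_atBot.2 fun R => ?_)
    filter_upwards [hR (-R), h] with n hn hn'
    rw [abs_of_neg (not_le.1 hn')] at hn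
    linarith

lemma mulVec_vecAt_eq_zero_of_det2_eq_zero {p q : Fin 2 → K} (hp : p ≠ 0) (h : det2 p q = 0)
    {v : InfinitePlace K} {M : Matrix (Fin 2) (Fin 2) v.Completion} {a : Fin 2}
    (ha : (M *ᵥ vecAt K v p) a = 0) : (M *ᵥ vecAt K v q) a = 0 := by
  obtain ⟨c, rfl⟩ := exists_eq_smul_of_det2_eq_zero hp h
  rw [vecAt_smul, Matrix.mulVec_smul, Pi.smul_apply, ha, smul_zero]

lemma det2_swap_eq_zero {F : Type*} [CommRing F] {p q : Fin 2 → F} (h : det2 p q = 0) :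
    det2 q p = 0 := by
  rw [det2] at *
  linear_combination -h

/-- Rational vectors that `g_v` maps to different axes are linearly independent. -/
lemma det2_ne_zero_of_mulVec_apply_eq_zero {g : Grp K} {v : InfinitePlace K} {p q : Fin 2 → K}
    (hp : p ≠ 0) (hq : q ≠ 0) (hp1 : ((g v).1 *ᵥ vecAt K v p) 1 = 0)
    (hq0 : ((g v).1 *ᵥ vecAt K v q) 0 = 0) : det2 p q ≠ 0 := by
  intro h
  have h1 := vecAt_det2 v p q
  rw [h, map_zero, ← det2_SL_mulVec (g v), det2, hp1, zero_mul, sub_zero, mul_eq_zero] at h1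
  rcases h1 with h1 | h1
  · refine SL_mulVec_ne_zero (g v) (vecAt_ne_zero (v := v) hp) (funext fun a => ?_)
    fin_cases a
    exacts [h1, hp1]
  · refine SL_mulVec_ne_zero (g v) (vecAt_ne_zero (v := v) hq) (funext fun a => ?_)
    fin_cases a
    exacts [hq0, h1]

variable [NumberField K]

/-- A path `d` in `D_I`, `I = {v, w}`, that contracts a rational vector at `v` and keeps it bounded
at `w` diverges in `G / Γ`. -/
lemma not_tendsto_of_contracted {ι : Type*} {F : Filter ι} [F.NeBot] {d : ι → Grp K}
    (hd : ∀ n, d n ∈ diagTorus I) {v w : InfinitePlace K} (hI : ∀ u ∈ I, u = v ∨ u = w)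
    {g : Grp K} {p : Fin 2 → K} (hp : p ≠ 0) {i : Fin 2}
    (hpv : ((g v).1 *ᵥ vecAt K v p) (1 - i) = 0) (hdv : Tendsto (fun n => ‖d n v i i‖) F (𝓝 0))
    {C : ℝ} (hC : ∀ᶠ n in F, ‖(d n w).1 *ᵥ ((g w).1 *ᵥ vecAt K w p)‖ ≤ C) (y : Space K) :
    ¬ Tendsto (fun n => d n • proj g) F (𝓝 y) := by
  intro h
  have hb : ∀ u, ∃ C, u ≠ v → ∀ᶠ n in F, ‖(d n u).1 *ᵥ ((g u).1 *ᵥ vecAt K u p)‖ ≤ C := fun u => by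
    by_cases hu : u ∈ I
    · rcases hI u hu with rfl | rfl
      exacts [⟨0, fun h => absurd rfl h⟩, ⟨C, fun _ => hC⟩]
    · refine ⟨‖(g u).1 *ᵥ vecAt K u p‖, fun _ => Eventually.of_forall fun n => le_of_eq ?_⟩
      have h1 : (d n u).1 = 1 := congrArg Subtype.val ((hd n).2 u hu)
      rw [h1, Matrix.one_mulVec]
  choose B hB using hb
  refine not_tendsto_height_zero (d := fun n => d n * g) h hp
    (tendsto_height_zero (v₀ := v) (C := B) ?_ hB)
  refine squeeze_zero (fun n => norm_nonneg _)
    (fun n => norm_mulVec_le_of_apply_eq_zero (hd n) hpv) ?_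
  simpa only [zero_mul] using hdv.mul_const ‖(g v).1 *ᵥ vecAt K v p‖

/-- A limit point of `D_I π(g)` lies on the orbit, or is a limit along one of the quadrants of `D_I`
for which the two contracted rational lines are different. -/
lemma mem_orbit_or_exists_quadrant {v₁ v₂ : InfinitePlace K}
    (hI : ∀ v, v ∈ I ↔ v = v₁ ∨ v = v₂) {g : Grp K} {P₁ P₂ : Fin 2 → Fin 2 → K}
    (hP₁ : ∀ i, P₁ i ≠ 0 ∧ ((g v₁).1 *ᵥ vecAt K v₁ (P₁ i)) (1 - i) = 0)
    (hP₂ : ∀ i, P₂ i ≠ 0 ∧ ((g v₂).1 *ᵥ vecAt K v₂ (P₂ i)) (1 - i) = 0) {y : Space K}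
    (hy : y ∈ closure (MulAction.orbit (diagTorus I) (proj g))) :
    y ∈ MulAction.orbit (diagTorus I) (proj g) ∨
      ∃ i j, det2 (P₁ i) (P₂ j) ≠ 0 ∧ ∃ (U : Ultrafilter (Space K)) (d : Space K → Grp K),
        (∀ n, d n ∈ diagTorus I) ∧ Tendsto (fun n => ‖d n v₁ i i‖) U (𝓝 0) ∧
        Tendsto (fun n => ‖d n v₂ j j‖) U (𝓝 0) ∧ Tendsto (fun n => d n • proj g) U (𝓝 y) := by
  obtain ⟨U, d, hd, hU⟩ := exists_ultrafilter_of_mem_closure_orbit hy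
  have hcontr : ∀ v i (x : Fin 2 → v.Completion), x (1 - i) = 0 →
      Tendsto (fun n => ‖d n v i i‖) U (𝓝 0) → ∀ᶠ n in U, ‖(d n v).1 *ᵥ x‖ ≤ ‖x‖ := by
    intro v i x hx h
    filter_upwards [h.eventually (ge_mem_nhds zero_lt_one)] with n hn
    exact (norm_mulVec_le_of_apply_eq_zero (hd n) hx).trans
      (mul_le_of_le_one_left (norm_nonneg _) hn)
  have hbdd : ∀ v R (x : Fin 2 → v.Completion), (∀ᶠ n in U, |Real.log ‖d n v 0 0‖| ≤ R) →
      ∀ᶠ n in U, ‖(d n v).1 *ᵥ x‖ ≤ Real.exp R * ‖x‖ := fun v R x h =>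
    h.mono fun n hn => norm_mulVec_le_of_abs_log_le (hd n) x hn
  rcases bounded_or_tendsto_zero U hd v₁ with ⟨R₁, h1⟩ | ⟨i, h1⟩ <;>
    rcases bounded_or_tendsto_zero U hd v₂ with ⟨R₂, h2⟩ | ⟨j, h2⟩
  · -- `d` is bounded
    left
    obtain ⟨d', hd', hlim⟩ := exists_tendsto_of_norm_bounded hd (R := fun _ => max R₁ R₂)
      fun v hv => by
        rcases (hI v).1 hv with rfl | rfl
        exacts [h1.mono fun _ h => h.trans (le_max_left _ _),
          h2.mono fun _ h => h.trans (le_max_right _ _)]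
    rw [tendsto_nhds_unique hU (hlim.smul_const (proj g))]
    exact ⟨⟨d', hd'⟩, rfl⟩
  · exact absurd hU (not_tendsto_of_contracted hd (fun u hu => ((hI u).1 hu).symm) (hP₂ j).1
      (hP₂ j).2 h2 (hbdd _ _ _ h1) y)
  · exact absurd hU (not_tendsto_of_contracted hd (fun u hu => (hI u).1 hu) (hP₁ i).1
      (hP₁ i).2 h1 (hbdd _ _ _ h2) y)
  · by_cases hdet : det2 (P₁ i) (P₂ j) = 0
    · have h3 := mulVec_vecAt_eq_zero_of_det2_eq_zero (hP₂ j).1 (det2_swap_eq_zero hdet) (hP₂ j).2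
      exact absurd hU (not_tendsto_of_contracted hd (fun u hu => (hI u).1 hu) (hP₁ i).1
        (hP₁ i).2 h1 (hcontr _ _ _ h3 h2) y)
    · exact Or.inr ⟨i, j, hdet, U, d, hd, h1, h2, hU⟩

/-- Along a quadrant of `D_I` with different contracted rational lines, the orbit `D_I π(g)`
accumulates exactly at limit points of the orbit of a rational point, monomial on `I`. -/
lemma exists_quadrant_limit {v₁ v₂ : InfinitePlace K} (h12 : v₁ ≠ v₂)
    (hI : ∀ v, v ∈ I ↔ v = v₁ ∨ v = v₂) {g : Grp K} {p q : Fin 2 → K} (hpq : det2 p q ≠ 0)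
    {i j : Fin 2} (hp : ((g v₁).1 *ᵥ vecAt K v₁ p) (1 - i) = 0)
    (hq : ((g v₂).1 *ᵥ vecAt K v₂ q) (1 - j) = 0) :
    ∃ (k : Grp K) (A : SL(2, K)) (a : InfinitePlace K → Fin 2), a v₁ = i ∧ a v₂ = 1 - j ∧
      (∀ v ∈ I, MapsAxes (k v) (a v)) ∧
      proj (k * emb A) ∈ closure (MulAction.orbit (diagTorus I) (proj g)) ∧
      ∀ (U : Ultrafilter (Space K)) (d : Space K → Grp K) (y : Space K), (∀ n, d n ∈ diagTorus I) →
        Tendsto (fun n => ‖d n v₁ i i‖) U (𝓝 0) → Tendsto (fun n => ‖d n v₂ j j‖) U (𝓝 0) →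
        Tendsto (fun n => d n • proj g) U (𝓝 y) →
        y ∈ closure (MulAction.orbit (diagTorus I) (proj (k * emb A))) := by
  obtain ⟨u, k, A, a, rfl, hu, hu1, hu2, ha1, ha2, hk⟩ :=
    exists_unipotent_mul_mapsAxes_mul_emb h12 hI hpq hp hq
  refine ⟨k, A, a, ha1, ha2, hk, ?_, fun U d y hd h1 h2 h => ?_⟩
  · obtain ⟨δ, hδ, hx, h1, h2⟩ := exists_recurrence_of_mapsAxes h12 hI hk A
    rw [ha1] at h1
    rw [ha2, sub_sub_cancel] at h2
    exact mem_closure_of_tendsto ((tendsto_smul_proj_iff hI hu hu1 hu2 hδ h1 h2).2 hx)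
      (Eventually.of_forall fun n => ⟨⟨δ n, hδ n⟩, rfl⟩)
  · exact mem_closure_of_tendsto ((tendsto_smul_proj_iff hI hu hu1 hu2 hd h1 h2).1 h)
      (Eventually.of_forall fun n => ⟨⟨d n, hd n⟩, rfl⟩)

/-- If the lines `P₁ 0`, `P₁ 1` coincide with `P₂ j`, `P₂ (1 - j)`, then the closure of the orbit is
an orbit of a torus. -/
lemma isTorusOrbit_of_det2_eq_zero {v₁ v₂ : InfinitePlace K} (h12 : v₁ ≠ v₂)
    (hI : ∀ v, v ∈ I ↔ v = v₁ ∨ v = v₂) {g : Grp K} {P₁ P₂ : Fin 2 → Fin 2 → K}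
    (hP₁ : ∀ i, P₁ i ≠ 0 ∧ ((g v₁).1 *ᵥ vecAt K v₁ (P₁ i)) (1 - i) = 0)
    (hP₂ : ∀ i, P₂ i ≠ 0 ∧ ((g v₂).1 *ᵥ vecAt K v₂ (P₂ i)) (1 - i) = 0) {j : Fin 2}
    (h0 : det2 (P₁ 0) (P₂ j) = 0) (h1 : det2 (P₁ 1) (P₂ (1 - j)) = 0) :
    IsTorusOrbit (closure (MulAction.orbit (diagTorus I) (proj g))) := by
  classical
  have hdet : det2 (P₁ 0) (P₁ 1) ≠ 0 :=
    det2_ne_zero_of_mulVec_apply_eq_zero (hP₁ 0).1 (hP₁ 1).1 (hP₁ 0).2 (hP₁ 1).2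
  obtain ⟨k, A, rfl, hk⟩ := exists_mapsAxes_of_lines (I := I) (g := g) hdet
    (i := fun v => if v = v₁ then 0 else j) fun v hv => by
      rcases (hI v).1 hv with rfl | rfl
      · rw [if_pos rfl]
        exact ⟨(hP₁ 0).2, (hP₁ 1).2⟩
      · have h3 := mulVec_vecAt_eq_zero_of_det2_eq_zero (hP₂ j).1 (det2_swap_eq_zero h0) (hP₂ j).2
        have h4 := mulVec_vecAt_eq_zero_of_det2_eq_zero (hP₂ (1 - j)).1 (det2_swap_eq_zero h1)
          (hP₂ (1 - j)).2
        rw [sub_sub_cancel] at h4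
        rw [if_neg h12.symm]
        exact ⟨h3, h4⟩
  obtain ⟨S, hSD, hSc, hSconn, -, hS⟩ := exists_torus_closure_eq_of_mapsAxes hk A
  exact ⟨_, _, ⟨k, S, hSD, hSc, hSconn, rfl⟩, hS⟩

end OrbitClosure

/-! ### Finitely many translated `D`-orbits do not cover `G / Γ` -/

section Covering

variable {K : Type*} [Field K]

/-- A matrix conjugate to an element of `D_v` and unipotent is trivial. -/
lemma eq_zero_of_conj_diagExp {v : InfinitePlace K} {a n : SL(2, v.Completion)} {t : v.Completion}
    {z : ℂ} (h00 : n 0 0 = 1) (h01 : n 0 1 = t) (h11 : n 1 1 = 1) (h : n = a * diagExp v z * a⁻¹) :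
    t = 0 := by
  -- the trace `2` of `n` determines the diagonal matrix
  have htr : Matrix.trace n.1 = Matrix.trace (diagExp v z).1 := by
    rw [h, Matrix.SpecialLinearGroup.coe_mul, Matrix.trace_mul_comm,
      ← Matrix.SpecialLinearGroup.coe_mul, inv_mul_cancel_left]
  rw [Matrix.trace_fin_two, Matrix.trace_fin_two, diagExp_apply_zero_zero, diagExp_apply_one_one,
    h00, h11] at htr
  have hz : expAt v z = 1 := by
    have h1 := expAt_mul_neg v z
    have h2 : (expAt v z - 1) ^ 2 = 0 := by linear_combination expAt v z * htr.symm - h1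
    exact sub_eq_zero.1 (pow_eq_zero_iff two_ne_zero |>.1 h2)
  have hone : diagExp v z = 1 := by
    refine Matrix.SpecialLinearGroup.ext _ _ fun i j => ?_
    fin_cases i <;> fin_cases j <;> simp [hz, expAt_neg]
  rw [hone, mul_one, mul_inv_cancel] at h
  rw [← h01, h]
  simp

variable [NumberField K]

lemma countable_Gam : Countable (Gam K) := by
  have hK : Countable K := (Module.finBasis ℚ K).equivFun.toEquiv.countable_iff.2 inferInstance
  have hO : Countable (𝓞 K) := (RingOfIntegers.coe_injective (K := K)).countable
  have hS : Countable SL(2, 𝓞 K) :=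
    Function.Injective.countable (f := fun A i j => A.1 i j)
      fun A B h => Matrix.SpecialLinearGroup.ext _ _ fun i j => congrFun (congrFun h i) j
  exact (MonoidHom.rangeRestrict_surjective _).countable

/-- Countably many sets `π(a D b)` do not cover `G / Γ`: for fixed `a`, `b` and `γ ∈ Γ` the set
`a D b γ` contains at most one element of a unipotent one-parameter group, and `Γ` is countable. -/
theorem exists_forall_ne_proj_mul {ι : Type*} [Countable ι] (a b : ι → Grp K) :
    ∃ y : Space K, ∀ i, ∀ s ∈ diagTorus (K := K) Finset.univ, proj (a i * s * b i) ≠ y := by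
  classical
  by_contra hcon
  push Not at hcon
  -- the unipotent matrices `n (expAt v t)`, `t ∈ ℝ`, at one place `v`
  let v : InfinitePlace K := Classical.arbitrary _
  have hn : ∀ t : v.Completion, ∃ n : SL(2, v.Completion),
      n 0 0 = 1 ∧ n 0 1 = t ∧ n 1 0 = 0 ∧ n 1 1 = 1 := fun t => exists_SL_entries (by ring)
  choose n h00 h01 h10 h11 using hn
  choose i s hs h using fun t : ℝ => hcon (proj (Pi.mulSingle v (n (expAt v t))))
  choose A hA using fun t => proj_eq_iff.1 (h t)
  have hcount : Countable (ι × Gam K) := by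
    have := countable_Gam (K := K)
    infer_instance
  have hinj : Function.Injective fun t : ℝ =>
      ((i t, ⟨emb (intSL (A t)), A t, rfl⟩) : ι × Gam K) := by
    intro t t' htt
    obtain ⟨hi, hγ⟩ := Prod.ext_iff.1 htt
    replace hγ : emb (intSL (A t)) = emb (intSL (A t')) := congrArg Subtype.val hγ
    replace hi : i t = i t' := hi
    have e1 : Pi.mulSingle v (n (expAt v t)) * (Pi.mulSingle v (n (expAt v t')))⁻¹ =
        a (i t) * (s t * (s t')⁻¹) * (a (i t))⁻¹ := by
      rw [hA t, hA t', hγ, hi]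
      group
    have e2 := congrFun e1 v
    obtain ⟨z, -, hz⟩ := mem_diagTorus_iff.1 (mul_mem (hs t) (inv_mem (hs t')))
    rw [← hz] at e2
    simp only [Pi.mul_apply, Pi.inv_apply, Pi.mulSingle_eq_same] at e2
    have e3 : (n (expAt v t'))⁻¹ = n (-expAt v t') := by
      rw [inv_eq_iff_mul_eq_one]
      refine Matrix.SpecialLinearGroup.ext _ _ fun i j => ?_
      rw [SL_mul_apply]
      fin_cases i <;> fin_cases j <;> simp [h00, h01, h10, h11]
    rw [e3] at e2
    have e4 := eq_zero_of_conj_diagExp (t := expAt v t - expAt v t')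
      (by rw [SL_mul_apply, h00, h00, h10]; ring) (by rw [SL_mul_apply, h00, h01, h01, h11]; ring)
      (by rw [SL_mul_apply, h10, h11, h11]; ring) e2
    have e5 := congrArg norm (sub_eq_zero.1 e4)
    rw [norm_expAt, norm_expAt, Real.exp_eq_exp] at e5
    simpa using e5
  exact not_countable (α := ℝ) hinj.countable

end Covering

/-- An enumeration, without repetition, of the values of `O`. -/
lemma exists_enumeration {Q α : Type*} [Finite Q] (O : Q → α) :
    ∃ f : Fin (Nat.card (Set.range O)) → Q,
      Function.Injective (O ∘ f) ∧ ∀ q, ∃ n, O (f n) = O q := by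
  have e := Finite.equivFin (Set.range O)
  choose r hr using fun x : Set.range O => x.2
  refine ⟨fun n => r (e.symm n), fun n m h => ?_, fun q => ⟨e ⟨O q, q, rfl⟩, ?_⟩⟩
  · have h' : O (r (e.symm n)) = O (r (e.symm m)) := h
    rw [hr, hr] at h'
    exact e.symm.injective (Subtype.ext h')
  · rw [hr, e.symm_apply_apply]

end HilbertModular

end

open HilbertModular
open NumberField Topology Filter
open scoped MatrixGroups Matrix

theorem theorem1 {K : Type*} [Field K] [NumberField K]
    (I : Finset (NumberField.InfinitePlace K)) (hI : I.card = 2) (g : Grp K)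
    (hg : IsLocallyDivergent I (proj g)) :
    (¬ IsTorusOrbit
        (closure (MulAction.orbit (diagTorus I) (proj g))) →
      ∃ s : ℕ, 2 ≤ s ∧ s ≤ 4 ∧
        ∃ (T : Fin s → Subgroup (Grp K)) (h : Fin s → Grp K),
          (∀ i, IsTorus (T i) ∧ diagTorus I ≤ T i) ∧
          (∀ i, IsClosed (MulAction.orbit (T i) (proj (h i))) ∧
            ¬ IsCompact (MulAction.orbit (T i) (proj (h i)))) ∧
          (∀ i j, i ≠ j → MulAction.orbit (T i) (proj (h i)) ≠
            MulAction.orbit (T j) (proj (h j))) ∧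
          closure (MulAction.orbit (diagTorus I) (proj g)) =
            MulAction.orbit (diagTorus I) (proj g) ∪
              ⋃ i, MulAction.orbit (T i) (proj (h i))) ∧
    ¬ Dense (MulAction.orbit (diagTorus I) (proj g)) := by
  classical
  obtain ⟨v₁, v₂, h12, hI2⟩ := Finset.card_eq_two.1 hI
  have hI' : ∀ v, v ∈ I ↔ v = v₁ ∨ v = v₂ := fun v => by simp [hI2]
  choose P₁ hP₁ using exists_rational_of_isDivergentOrbit (hg v₁ ((hI' v₁).2 (Or.inl rfl)))
  choose P₂ hP₂ using exists_rational_of_isDivergentOrbit (hg v₂ ((hI' v₂).2 (Or.inr rfl)))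
  -- the admissible quadrants
  let Q := {q : Fin 2 × Fin 2 // det2 (P₁ q.1) (P₂ q.2) ≠ 0}
  choose k A a ha₁ ha₂ hk hmem hlim using fun q : Q =>
    exists_quadrant_limit h12 hI' q.2 (hP₁ q.1.1).2 (hP₂ q.1.2).2
  choose S hSD hSc hSconn hIT hT using fun q : Q => exists_torus_closure_eq_of_mapsAxes (hk q) (A q)
  have hclosure : closure (MulAction.orbit (diagTorus I) (proj g)) =
      MulAction.orbit (diagTorus I) (proj g) ∪
        ⋃ q : Q, closure (MulAction.orbit (diagTorus I) (proj (k q * emb (A q)))) := by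
    refine Set.Subset.antisymm (fun y hy => ?_) (Set.union_subset subset_closure
      (Set.iUnion_subset fun q => closure_minimal ?_ isClosed_closure))
    · rcases mem_orbit_or_exists_quadrant hI' hP₁ hP₂ hy with h | ⟨i, j, hij, U, d, hd, h1, h2, h⟩
      · exact Or.inl h
      · exact Or.inr (Set.mem_iUnion.2 ⟨⟨(i, j), hij⟩, hlim ⟨(i, j), hij⟩ U d y hd h1 h2 h⟩)
    · -- the closure of the orbit is invariant under `D_I`
      rintro _ ⟨d, rfl⟩
      have h1 := mem_closure_image (f := fun y : Space K => d • y)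
        (Continuous.continuousAt (continuous_const_smul (d : Grp K))) (hmem q)
      refine closure_mono ?_ h1
      rintro _ ⟨_, ⟨e, rfl⟩, rfl⟩
      exact ⟨d * e, mul_smul d e _⟩
  refine ⟨fun hnot => ?_, fun hdense => ?_⟩
  · -- different quadrants may give the same closed orbit
    obtain ⟨f, hf, hfQ⟩ := exists_enumeration fun q : Q =>
      closure (MulAction.orbit (diagTorus I) (proj (k q * emb (A q))))
    obtain ⟨i, hi⟩ : ∃ i, det2 (P₁ i) (P₂ (1 - i)) ≠ 0 := by
      by_contra! h
      exact hnot (isTorusOrbit_of_det2_eq_zero h12 hI' hP₁ hP₂ (j := 1) (h 0) (h 1))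
    obtain ⟨j, hj⟩ : ∃ j, det2 (P₁ j) (P₂ j) ≠ 0 := by
      by_contra! h
      exact hnot (isTorusOrbit_of_det2_eq_zero h12 hI' hP₁ hP₂ (j := 0) (h 0) (h 1))
    let q : Q := ⟨(i, 1 - i), hi⟩
    let q' : Q := ⟨(j, j), hj⟩
    have hne : closure (MulAction.orbit (diagTorus I) (proj (k q * emb (A q)))) ≠
        closure (MulAction.orbit (diagTorus I) (proj (k q' * emb (A q')))) := by
      intro h
      refine proj_notMem_closure_orbit h12 hI' (hk q) ?_ (hk q') ?_ (A q) (A q') ?_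
      · rw [ha₁, ha₂]
        exact (sub_sub_cancel _ _).symm
      · rw [ha₁, ha₂]
        exact (sub_sub_cancel _ _).symm
      · rw [h]
        exact subset_closure (MulAction.mem_orbit_self _)
    refine ⟨_, ?_, ?_, fun n => (S (f n)).map (MulAut.conj (k (f n))).toMonoidHom,
      fun n => k (f n) * emb (A (f n)), fun n => ⟨⟨_, _, hSD _, hSc _, hSconn _, rfl⟩, hIT _⟩,
      fun n => ?_, fun n m hnm h => hnm (hf ?_), ?_⟩
    · have : Nontrivial (Set.range fun q : Q =>
          closure (MulAction.orbit (diagTorus I) (proj (k q * emb (A q))))) :=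
        ⟨⟨_, q, rfl⟩, ⟨_, q', rfl⟩, fun h => hne (congrArg Subtype.val h)⟩
      exact Finite.one_lt_card
    · refine (Finite.card_range_le _).trans ((Finite.card_subtype_le _).trans ?_)
      simp
    · rw [← hT]
      refine ⟨isClosed_closure, not_isCompact_of_forall_mem ⟨v₁, (hI' v₁).2 (Or.inl rfl)⟩
        (k (f n)) (A (f n)) fun d hd => subset_closure ?_⟩
      obtain ⟨e, he, hke, -⟩ := exists_mul_eq_mul_of_mapsAxes (hk (f n)) hd
      rw [hke, mul_assoc]
      exact ⟨⟨e, he⟩, rfl⟩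
    · rw [← hT, ← hT] at h
      exact h
    · rw [hclosure]
      congr 1
      refine Set.Subset.antisymm (Set.iUnion_subset fun q => ?_) (Set.iUnion_subset fun n => ?_)
      · obtain ⟨n, hn⟩ := hfQ q
        rw [← hn]
        exact (hT (f n)).le.trans (Set.subset_iUnion_of_subset n subset_rfl)
      · rw [← hT]
        exact Set.subset_iUnion_of_subset (f n) subset_rfl
  · -- all orbits in the closure lie in sets `π(a D b)`
    obtain ⟨y, hy⟩ := exists_forall_ne_proj_mul
      (fun o : Option Q => o.elim 1 k) (fun o => o.elim g fun q => emb (A q))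
    have hy' := hdense y
    rw [hclosure] at hy'
    rcases hy' with ⟨d, rfl⟩ | hy'
    · refine hy none d (diagTorus_mono (Finset.subset_univ I) d.2) ?_
      change proj (1 * (d : Grp K) * g) = proj ((d : Grp K) * g)
      rw [one_mul]
    · obtain ⟨q, hq⟩ := Set.mem_iUnion.1 hy'
      rw [hT] at hq
      obtain ⟨⟨_, s, hs, rfl⟩, rfl⟩ := hq
      refine hy (some q) s (hSD q hs) ?_
      change proj (k q * s * emb (A q)) = proj (k q * s * (k q)⁻¹ * (k q * emb (A q)))
      group
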